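/- A *stacked polyhedron* is a polyhedron in $\mathbb R^3$ with triangular faces that is formed from a single nondegenerate tetrahedron by repeatedly gluing a nondegenerate tetrahedron onto a single triangular face of the solid built so far (the new tetrahedron meets that solid in exactly that face), and in which no two triangles sharing an edge are coplanar. A polyhedron is *topologically convex* if it is combinatorially equivalent to a convex polyhedron. *Replacing a face $abc$ by a stacked hat* means gluing, one after the other, tetrahedra with new apexes $d,e,f,g$ onto the triangles $abc$, $bcd$, $cde$, $def$ (for some ordering $a,b,c$ of the vertices of the face). A *nonoverlapping multipiece edge unfolding* of a polyhedron consists of a set of cut edges and a congruent placement of every face in the plane, such that faces sharing an uncut edge are attached along that edge and no two faces of the same piece overlap (have intersecting interiors); its *pieces* are the connected components of the surface that remain after cutting, i.e. the components of the graph on the faces in which faces sharing an uncut edge are adjacent. **Theorem.** For every integer $k\ge 0$ and every $\varepsilon>0$ there are stacked polyhedra $Q$ and $P$ such that 1. $Q$ is obtained from a regular tetrahedron of edge length $1$ by gluing, $k$ times in succession, a tetrahedron onto a face of the current solid, with the apex at distance less than $\varepsilon$ from the incenter of that face; $Q$ has exactly $4+2k$ faces and $4+k$ vertices; 2. $P$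 is obtained from $Q$ by replacing every face of $Q$ by a stacked hat; 3. $P$ is topologically convex; and 4. every nonoverlapping multipiece edge unfolding of $P$ has at least $k+2$ pieces. -/

import Mathlib

/-- Euclidean 3-space. -/
abbrev Space3 : Type := EuclideanSpace ℝ (Fin 3)

/-- The Euclidean plane. -/
abbrev Plane2 : Type := EuclideanSpace ℝ (Fin 2)

/-- A solid in space together with the list of triangles (given by their vertex sets) that make
up its surface. On its own this is only data: everything below is about stacked polyhedra. -/
structure TriSolid where
  body : Set Space3
  faces : Finset (Finset Space3)

namespace TriSolid

open Classical in
/-- The vertices: the corners of the faces. -/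
noncomputable def vertices (P : TriSolid) : Finset Space3 :=
  P.faces.biUnion id

open Classical in
/-- The edges: the two-point subsets of the faces. -/
noncomputable def edges (P : TriSolid) : Finset (Finset Space3) :=
  P.faces.biUnion (fun f => f.powersetCard 2)

/-- The solid tetrahedron with vertex set `t`. -/
noncomputable def tetrahedron (t : Finset Space3) : TriSolid where
  body := convexHull ℝ (t : Set Space3)
  faces := t.powersetCard 3

open Classical in
/-- A tetrahedron with apex `d` can be glued onto the face `f` of `P`: it is nondegenerate and
meets the solid `P` in exactly the triangle `f`. -/
def CanGlue (P : TriSolid) (f : Finset Space3) (d : Space3) : Prop :=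
  f ∈ P.faces ∧ d ∉ f ∧
    AffineIndependent ℝ (fun x : (insert d f : Finset Space3) => (x : Space3)) ∧
    convexHull ℝ ((insert d f : Finset Space3) : Set Space3) ∩ P.body =
      convexHull ℝ (f : Set Space3)

open Classical in
/-- The result of gluing the tetrahedron with apex `d` onto the face `f`: the triangle `f`
disappears from the surface, the three other triangles of the tetrahedron are added. -/
noncomputable def glue (P : TriSolid) (f : Finset Space3) (d : Space3) : TriSolid where
  body := P.body ∪ convexHull ℝ ((insert d f : Finset Space3) : Set Space3)
  faces := P.faces.erase f ∪ ((insert d f).powersetCard 3).erase f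

/-- Solids formed from a single nondegenerate tetrahedron by repeatedly gluing a tetrahedron onto
a single triangular face. -/
inductive Stacked : TriSolid → Prop
  | base (t : Finset Space3) (hcard : t.card = 4)
      (ht : AffineIndependent ℝ (fun x : t => (x : Space3))) : Stacked (tetrahedron t)
  | step (P : TriSolid) (f : Finset Space3) (d : Space3) (hP : Stacked P)
      (h : P.CanGlue f d) : Stacked (P.glue f d)

open Classical in
/-- No two triangles of the surface that share an edge are coplanar, so that the listed triangles
and their sides are the actual faces and edges of the solid. -/
def NoFlatEdges (P : TriSolid) : Prop :=
  ∀ f ∈ P.faces, ∀ g ∈ P.faces, f ≠ g → (f ∩ g).card = 2 →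
    AffineIndependent ℝ (fun x : (f ∪ g : Finset Space3) => (x : Space3))

/-- A stacked polyhedron. -/
def IsStackedPolyhedron (P : TriSolid) : Prop :=
  P.Stacked ∧ P.NoFlatEdges

/-- `P` is combinatorially equivalent to a convex polyhedron. The vertices `v` of `P` correspond
to points `q v`; the faces (of dimension 0, 1, 2) of the convex hull of these points, each given
as the set of points where some nonzero linear functional is maximal, have to be exactly the
vertices, edges and triangles of the surface of `P`. (This forces `q` to be injective on the
vertices, every `q v` to be a vertex of the hull, and the hull to be three-dimensional.) -/
def IsTopologicallyConvex (P : TriSolid) : Prop :=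
  ∃ q : Space3 → Space3, ∀ S : Finset Space3, S ⊆ P.vertices →
    ((S.Nonempty ∧ ∃ f ∈ P.faces, S ⊆ f) ↔
      ∃ l : Space3 →L[ℝ] ℝ, l ≠ 0 ∧
        ∀ v ∈ P.vertices, (v ∈ S ↔ ∀ w ∈ P.vertices, l (q w) ≤ l (q v)))

open Classical in
/-- The graph on the faces in which two faces are adjacent when they share an edge that is not
cut. -/
def uncutGraph (P : TriSolid) (cuts : Finset (Finset Space3)) :
    SimpleGraph {f : Finset Space3 // f ∈ P.faces} where
  Adj f g := f ≠ g ∧ f.1 ∩ g.1 ∈ P.edges ∧ f.1 ∩ g.1 ∉ cuts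
  symm := ⟨fun f g h => by
    rw [Finset.inter_comm g.1 f.1]
    exact ⟨h.1.symm, h.2⟩⟩
  loopless := ⟨fun f h => h.1 rfl⟩

open Classical in
/-- A nonoverlapping multipiece edge unfolding of `P`: a set of cut edges, and for each face a
congruent placement in the plane, such that faces that share an uncut edge stay attached along
it, and such that no two faces of the same piece overlap (so in particular attached faces lie on
different sides of their common edge). The pieces are the connected components that are left
after cutting; different pieces may be placed independently of each other. -/
structure EdgeUnfolding (P : TriSolid) where
  cuts : Finset (Finset Space3)
  cuts_subset : cuts ⊆ P.edges
  place : {f : Finset Space3 // f ∈ P.faces} → (Space3 →ᵃ[ℝ] Plane2)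
  isometric : ∀ f, ∀ x ∈ convexHull ℝ (f.1 : Set Space3), ∀ y ∈ convexHull ℝ (f.1 : Set Space3),
    dist (place f x) (place f y) = dist x y
  attached : ∀ f g, (P.uncutGraph cuts).Adj f g →
    ∀ x ∈ convexHull ℝ ((f.1 ∩ g.1 : Finset Space3) : Set Space3), place f x = place g x
  nonoverlapping : ∀ f g, f ≠ g → (P.uncutGraph cuts).Reachable f g →
    Disjoint (interior (place f '' convexHull ℝ (f.1 : Set Space3)))
      (interior (place g '' convexHull ℝ (g.1 : Set Space3)))

/-- The number of pieces of an unfolding. -/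
noncomputable def EdgeUnfolding.numPieces {P : TriSolid} (U : P.EdgeUnfolding) : ℕ :=
  Nat.card (P.uncutGraph U.cuts).ConnectedComponent

/-- `Refinement ε k Q`: the solid `Q` arises from a regular tetrahedron (of edge length 1) by
gluing, `k` times, onto a face a tetrahedron whose apex has distance less than `ε` from the
incenter of that face. -/
inductive Refinement (ε : ℝ) : ℕ → TriSolid → Prop
  | base (t : Finset Space3) (hcard : t.card = 4)
      (ht : ∀ x ∈ t, ∀ y ∈ t, x ≠ y → dist x y = 1) : Refinement ε 0 (tetrahedron t)
  | step (k : ℕ) (Q : TriSolid) (s : Affine.Simplex ℝ Space3 2) (f : Finset Space3) (d : Space3)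
      (hQ : Refinement ε k Q) (hf : (f : Set Space3) = Set.range s.points)
      (h : Q.CanGlue f d) (hd : dist d s.incenter < ε) : Refinement ε (k + 1) (Q.glue f d)

open Classical in
/-- `P'` arises from `P` by replacing the face `F` by a stacked hat: with `F = abc`, tetrahedra
with apexes `d, e, f, g` are glued in turn onto the triangles `abc`, `bcd`, `cde`, `def`. The nine
triangles that replace `abc` are the brim `abd, bce, acd`, the band `bde, cdf, cef` and the crown
`deg, efg, dfg`. -/
def AttachHat (P : TriSolid) (F : Finset Space3) (P' : TriSolid) : Prop :=
  ∃ a b c d e f g : Space3, F = {a, b, c} ∧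
    P.CanGlue {a, b, c} d ∧
    (P.glue {a, b, c} d).CanGlue {b, c, d} e ∧
    ((P.glue {a, b, c} d).glue {b, c, d} e).CanGlue {c, d, e} f ∧
    (((P.glue {a, b, c} d).glue {b, c, d} e).glue {c, d, e} f).CanGlue {d, e, f} g ∧
    P' = (((P.glue {a, b, c} d).glue {b, c, d} e).glue {c, d, e} f).glue {d, e, f} g

open Classical in
/-- `AttachHats P S P'`: the solid `P'` arises from `P` by replacing each triangle in `S` by a
stacked hat. -/
inductive AttachHats (P : TriSolid) : Finset (Finset Space3) → TriSolid → Prop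
  | none : AttachHats P ∅ P
  | more (S : Finset (Finset Space3)) (F : Finset Space3) (P' P'' : TriSolid)
      (h : AttachHats P S P') (hF : F ∉ S) (hat : P'.AttachHat F P'') :
      AttachHats P (insert F S) P''

end TriSolid

/-! A hat is shaped so that its inner vertices d, e, f carry strongly negative curvature: at each of
them the triangles of the hat, even with one of the two crown triangles there left out, have total
angle above 2π (`HatAngles`). On the other hand, triangles of one piece laid out around a common
corner without overlap have angle sum at most 2π, because small circular sectors in them are
disjoint parts of one disc (`sum_angle_le_two_pi`). So every unfolding must cut an edge along each
long enough path of triangles around d, e or f (`exists_cut_of_fan`), and such cuts always split the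
nine triangles into two nonempty classes that are not attached to each other inside the hat
(`exists_separated_hatFaces`).

This gives 2(4 + 2k) classes in all. An uncut edge between different classes joins different hats,
hence is an edge of `Q`, and there are at most 6 + 3k of these. Each such edge merges at most two
classes, so at least (8 + 4k) - (6 + 3k) = k + 2 pieces remain (`two_mul_card_faces_le`, via
`card_le_card_add_card_connectedComponent`).

For the construction, all solids are kept star-shaped about the origin (`IsStar`). Then gluing
becomes linear algebra: an apex in the open cone over a face and beyond its plane can always be
glued (`IsStar.canGlue`), and the result is again star-shaped (`IsStar.glue`). Moving the apex along
its ray avoids the finitely many face planes, so no coplanar neighbours arise. The solid `Q` comes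
from pushing incenters slightly outward.

A hat is first drawn flat: d, e, f lie in the triangle, with d, e, f close together, and the spike
apex g is near 2d. The angles around a point of a flat triangle add up to exactly 2π, so it suffices
that each crown angle exceeds the angle of the base triangle def that it replaces
(`hatAngles_of_flat`). As def shrinks, the edges of the spike all take the direction of d, and a
long isosceles def pointing the right way satisfies the strict inequalities (`exists_crown_shape`).
These survive the small radial perturbation that makes the hat nondegenerate (`hasHat_of_flat`).

Topological convexity holds for every stacked solid: in a convex realization the new vertex is
placed just beyond the centroid of the facet (`IsRealization.glue`). -/

namespace TriSolid

/-! ### Star-shaped solids and gluing in cone coordinates. -/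

/-- `w` is a nonnegative weight supported on `F`. -/
structure IsWeight (F : Finset Space3) (w : Space3 → ℝ) : Prop where
  nonneg : ∀ v, 0 ≤ w v
  supp : ∀ v, v ∉ F → w v = 0

/-- A solid that is star-shaped about the origin: the cones over its faces form a simplicial fan,
and the solid is the union of the tetrahedra spanned by the origin and the faces. -/
structure IsStar (P : TriSolid) : Prop where
  card_face : ∀ F ∈ P.faces, F.card = 3
  unique : ∀ F ∈ P.faces, ∀ G ∈ P.faces, ∀ w w', IsWeight F w → IsWeight G w' →
    ∑ v ∈ F, w v • v = ∑ v ∈ G, w' v • v → w = w'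
  body_eq : P.body = {x | ∃ F ∈ P.faces, ∃ w, IsWeight F w ∧ ∑ v ∈ F, w v ≤ 1 ∧
    ∑ v ∈ F, w v • v = x}

/-- `d` lies in the open cone over `F`, with coordinates `μ`. -/
structure IsConePoint (F : Finset Space3) (d : Space3) (μ : Space3 → ℝ) : Prop where
  pos : ∀ v ∈ F, 0 < μ v
  supp : ∀ v, v ∉ F → μ v = 0
  sum_eq : ∑ v ∈ F, μ v • v = d

theorem IsConePoint.isWeight {F : Finset Space3} {d : Space3} {μ : Space3 → ℝ}
    (h : IsConePoint F d μ) : IsWeight F μ where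
  nonneg v := by
    by_cases hv : v ∈ F
    · exact (h.pos v hv).le
    · exact (h.supp v hv).ge
  supp := h.supp

/-- The positive and negative parts of the coefficients are two weights on the same face with the
same vector sum, so `unique` makes them equal. -/
theorem IsStar.linearIndependent {P : TriSolid} (hP : P.IsStar) {F : Finset Space3}
    (hF : F ∈ P.faces) (c : Space3 → ℝ) (hc : ∑ v ∈ F, c v • v = 0) : ∀ v ∈ F, c v = 0 := by
  classical
  have h := hP.unique F hF F hF (fun v => if v ∈ F then max (c v) 0 else 0)
    (fun v => if v ∈ F then max (-c v) 0 else 0)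
    ⟨fun v => by split_ifs <;> simp, fun v hv => by simp [hv]⟩
    ⟨fun v => by split_ifs <;> simp, fun v hv => by simp [hv]⟩ (by
      rw [← sub_eq_zero, ← Finset.sum_sub_distrib, ← hc]
      refine Finset.sum_congr rfl fun v hv => ?_
      simp only [hv, if_true, ← sub_smul]
      congr 1
      rcases le_total (c v) 0 with h | h <;> simp [h])
  intro v hv
  have := congrFun h v
  simp only [hv, if_true] at this
  rcases le_total (c v) 0 with h | h <;> simp [h] at this <;> linarith

open Classical in
theorem mem_powersetCard_insert {F h : Finset Space3} {d : Space3} (hF : F.card = 3) (hd : d ∉ F) :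
    (h ∈ (insert d F).powersetCard 3 ∧ h ≠ F) ↔ ∃ a ∈ F, h = insert d (F.erase a) := by
  rw [Finset.mem_powersetCard]
  constructor
  · rintro ⟨⟨hs, hc⟩, hne⟩
    have hdh : d ∈ h := by
      by_contra hdh
      exact hne (Finset.eq_of_subset_of_card_le
        ((Finset.subset_insert_iff_of_notMem hdh).1 hs) (by omega))
    have hsub : h.erase d ⊆ F := Finset.subset_insert_iff.1 hs
    have hcard : (h.erase d).card = 2 := by rw [Finset.card_erase_of_mem hdh, hc]
    obtain ⟨a, ha⟩ : (F \ h.erase d).Nonempty := by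
      rw [← Finset.card_pos, Finset.card_sdiff_of_subset hsub]; omega
    rw [Finset.mem_sdiff] at ha
    refine ⟨a, ha.1, ?_⟩
    have : h.erase d = F.erase a := by
      refine Finset.eq_of_subset_of_card_le (fun x hx => ?_) ?_
      · refine Finset.mem_erase.2 ⟨?_, hsub hx⟩
        rintro rfl; exact ha.2 hx
      · rw [Finset.card_erase_of_mem ha.1]; omega
    rw [← this, Finset.insert_erase hdh]
  · rintro ⟨a, ha, rfl⟩
    refine ⟨⟨Finset.insert_subset_insert _ (Finset.erase_subset _ _), ?_⟩, ?_⟩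
    · rw [Finset.card_insert_of_notMem (by simp [hd]), Finset.card_erase_of_mem ha, hF]
    · intro h; exact hd (h ▸ Finset.mem_insert_self _ _)

open Classical in
theorem mem_faces_glue {P : TriSolid} {F h : Finset Space3} {d : Space3} (hF : F.card = 3)
    (hd : d ∉ F) : h ∈ (P.glue F d).faces ↔
      (h ∈ P.faces ∧ h ≠ F) ∨ ∃ a ∈ F, h = insert d (F.erase a) := by
  rw [← mem_powersetCard_insert hF hd]
  simp only [glue, Finset.mem_union, Finset.mem_erase]
  tauto

theorem affineIndependent_finset_iff (s : Finset Space3) :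
    AffineIndependent ℝ (fun x : s => (x : Space3)) ↔
      ∀ c : Space3 → ℝ, ∑ v ∈ s, c v = 0 → ∑ v ∈ s, c v • v = 0 → ∀ v ∈ s, c v = 0 := by
  classical
  rw [affineIndependent_iff_of_fintype]
  constructor
  · intro h c h0 h1 v hv
    refine h (fun x => c x) ?_ ?_ ⟨v, hv⟩
    · rwa [Finset.sum_coe_sort s c]
    · rw [Finset.weightedVSub_eq_linear_combination]
      · rwa [Finset.sum_coe_sort s (fun x => c x • x)]
      · rwa [Finset.sum_coe_sort s c]
  · intro h w h0 h1 ⟨v, hv⟩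
    rw [Finset.weightedVSub_eq_linear_combination (hw := h0)] at h1
    have := h (fun x => if hx : x ∈ s then w ⟨x, hx⟩ else 0) ?_ ?_ v hv
    · simpa [hv] using this
    · rw [← Finset.sum_coe_sort, ← h0]
      exact Finset.sum_congr rfl fun x _ => by simp
    · rw [← Finset.sum_coe_sort, ← h1]
      exact Finset.sum_congr rfl fun x _ => by simp

open Classical in
theorem affineIndependent_insert {F : Finset Space3} {d : Space3} (hdF : d ∉ F)
    (hF : ∀ c : Space3 → ℝ, ∑ v ∈ F, c v • v = 0 → ∀ v ∈ F, c v = 0)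
    (hd : ∀ c : Space3 → ℝ, ∑ v ∈ F, c v = 1 → ∑ v ∈ F, c v • v ≠ d) :
    AffineIndependent ℝ (fun x : (insert d F : Finset Space3) => (x : Space3)) := by
  rw [affineIndependent_finset_iff]
  intro c h0 h1
  rw [Finset.sum_insert hdF] at h0 h1
  have hcd : c d = 0 := by
    by_contra hne
    refine hd (fun v => -(c d)⁻¹ * c v) ?_ ?_
    · rw [← Finset.mul_sum]; field_simp; linarith
    · simp only [mul_smul]
      rw [← Finset.smul_sum, eq_neg_iff_add_eq_zero.2 ((add_comm _ _).trans h1), smul_neg,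
        neg_smul, neg_neg, smul_smul, inv_mul_cancel₀ hne, one_smul]
  intro v hv
  rcases Finset.mem_insert.1 hv with rfl | hv
  · exact hcd
  · exact hF c (by simpa [hcd] using h1) v hv

open Classical in
theorem sum_push {F : Finset Space3} {d : Space3} {μ w : Space3 → ℝ} (hdF : d ∉ F)
    (hμ : IsConePoint F d μ) :
    ∑ v ∈ F, (w v + w d * μ v) • v = ∑ v ∈ insert d F, w v • v := by
  simp only [add_smul, mul_smul]
  rw [Finset.sum_add_distrib, ← Finset.smul_sum, hμ.sum_eq, Finset.sum_insert hdF, add_comm]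

open Classical in
theorem IsWeight.sum_erase {F : Finset Space3} {d a : Space3} {w : Space3 → ℝ}
    {M : Type*} [AddCommMonoid M] [Module ℝ M] (x : Space3 → M)
    (hw : IsWeight (insert d (F.erase a)) w) (_ : a ≠ d) :
    ∑ v ∈ insert d (F.erase a), w v • x v = ∑ v ∈ insert d F, w v • x v := by
  refine Finset.sum_subset (Finset.insert_subset_insert _ (Finset.erase_subset _ _)) ?_
  intro v _ hv
  rw [hw.supp v hv, zero_smul]

namespace IsStar

variable {P : TriSolid} {F : Finset Space3} {d : Space3} {μ : Space3 → ℝ}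

/-- A vertex `d` of `G` would be represented both by the unit weight at `d` and by `μ`, which is
positive at some vertex of `F` other than `d`. -/
theorem notMem_of_isConePoint (hP : P.IsStar) (hF : F ∈ P.faces) (hμ : IsConePoint F d μ)
    {G : Finset Space3} (hG : G ∈ P.faces) : d ∉ G := by
  classical
  intro hd
  have h := hP.unique F hF G hG μ (fun v => if v = d then 1 else 0) hμ.isWeight
    ⟨fun v => by split_ifs <;> simp, fun v hv => by
      rw [if_neg]; rintro rfl; exact hv hd⟩ (by rw [hμ.sum_eq]; simp [hd])
  obtain ⟨a, ha, hne⟩ := Finset.exists_mem_ne (by rw [hP.card_face F hF]; norm_num) d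
  have := congrFun h a
  have h2 := hμ.pos a ha
  simp [hne] at this
  linarith

open Classical in
/-- Pushing a weight on `insert d F` down to `F`. -/
theorem isWeight_push (hμ : IsConePoint F d μ) {w : Space3 → ℝ} (hw : ∀ v, 0 ≤ w v) :
    IsWeight F (fun v => if v ∈ F then w v + w d * μ v else 0) where
  nonneg v := by
    split_ifs with h
    · exact add_nonneg (hw v) (mul_nonneg (hw d) (hμ.pos v h).le)
    · exact le_rfl
  supp v hv := if_neg hv

open Classical in
theorem sum_push_eq (hdF : d ∉ F) (hμ : IsConePoint F d μ) (w : Space3 → ℝ) :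
    ∑ v ∈ F, (if v ∈ F then w v + w d * μ v else 0) • v = ∑ v ∈ insert d F, w v • v := by
  rw [← sum_push hdF hμ]
  exact Finset.sum_congr rfl fun v hv => by rw [if_pos hv]

-- Let a point of the new tetrahedron lie in the old solid. Pushing its weight at `d` down to `F`
-- gives its unique cone coordinates, whose total is at most 1. The original total is exactly 1 and
-- `∑ μ > 1`, so the weight at `d` was zero.
open Classical in
theorem canGlue (hP : P.IsStar) (hF : F ∈ P.faces) (hμ : IsConePoint F d μ)
    (hs : 1 < ∑ v ∈ F, μ v) : P.CanGlue F d := by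
  have hdF := hP.notMem_of_isConePoint hF hμ hF
  refine ⟨hF, hdF, affineIndependent_insert hdF (hP.linearIndependent hF) ?_, ?_⟩
  · intro c hc hcd
    have := hP.linearIndependent hF (fun v => c v - μ v) (by
      simp only [sub_smul]; rw [Finset.sum_sub_distrib, hcd, hμ.sum_eq, sub_self])
    have : ∑ v ∈ F, c v = ∑ v ∈ F, μ v := Finset.sum_congr rfl fun v hv => by
      linarith [this v hv]
    linarith
  · ext x
    simp only [Set.mem_inter_iff, Finset.mem_convexHull']
    constructor
    · rintro ⟨⟨w, hw0, hw1, rfl⟩, hx⟩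
      rw [hP.body_eq] at hx
      obtain ⟨G, hG, w', hw', hs', he⟩ := hx
      set u : Space3 → ℝ := fun v => if v ∈ insert d F then w v else 0 with hu
      have hu0 : ∀ v, 0 ≤ u v := fun v => by
        simp only [hu]; split_ifs with h
        · exact hw0 v h
        · exact le_rfl
      have huF : ∀ v ∈ insert d F, u v = w v := fun v hv => if_pos hv
      have key := hP.unique F hF G hG _ w' (isWeight_push hμ hu0) hw' (by
        rw [sum_push_eq hdF hμ, he]
        exact Finset.sum_congr rfl fun v hv => by rw [huF v hv])
      have hsum : ∑ v ∈ F, (u v + u d * μ v) ≤ 1 := by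
        refine le_trans (le_of_eq ?_) hs'
        have h1 : ∑ v ∈ F, w' v = ∑ v ∈ F, (u v + u d * μ v) :=
          Finset.sum_congr rfl fun v hv => by
            rw [← key]; exact if_pos hv
        rw [← h1]
        have hz : ∀ v, v ∉ F → w' v = 0 := fun v hv => by rw [← key]; exact if_neg hv
        exact (Finset.sum_subset Finset.subset_union_left fun v _ hv => hz v hv).trans
          (Finset.sum_subset Finset.subset_union_right fun v _ hv => hw'.supp v hv).symm
      rw [Finset.sum_add_distrib, ← Finset.mul_sum] at hsum
      rw [Finset.sum_insert hdF] at hw1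
      have h2 : ∑ v ∈ F, u v = ∑ v ∈ F, w v :=
        Finset.sum_congr rfl fun v hv => huF v (Finset.mem_insert_of_mem hv)
      have h3 : u d = w d := huF d (Finset.mem_insert_self _ _)
      have h4 := hw0 d (Finset.mem_insert_self _ _)
      have hd0 : w d = 0 := by rw [h2, h3] at hsum; nlinarith
      refine ⟨w, fun y hy => hw0 y (Finset.mem_insert_of_mem hy), by linarith, ?_⟩
      rw [Finset.sum_insert hdF, hd0, zero_smul, zero_add]
    · rintro ⟨w, hw0, hw1, rfl⟩
      have hFd : ∀ v ∈ F, v ≠ d := fun v hv h => hdF (h ▸ hv)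
      have e3 : ∀ v ∈ F, (if v = d then 0 else w v) = w v := fun v hv => if_neg (hFd v hv)
      constructor
      · refine ⟨fun v => if v = d then 0 else w v, fun y hy => ?_, ?_, ?_⟩
        · beta_reduce
          split_ifs with h
          · exact le_rfl
          · exact hw0 y ((Finset.mem_insert.1 hy).resolve_left h)
        · rw [Finset.sum_insert hdF, if_pos rfl, zero_add, ← hw1]
          exact Finset.sum_congr rfl fun v hv => if_neg (hFd v hv)
        · rw [Finset.sum_insert hdF]
          simp only [if_true, zero_smul, zero_add]
          exact Finset.sum_congr rfl fun v hv => by rw [e3 v hv]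
      · rw [hP.body_eq]
        refine ⟨F, hF, fun v => if v ∈ F then w v else 0, ⟨fun v => ?_, fun v hv => if_neg hv⟩,
          ?_, ?_⟩
        · split_ifs with h
          · exact hw0 v h
          · exact le_rfl
        · rw [← hw1]; exact (Finset.sum_congr rfl fun v hv => if_pos hv).le
        · exact Finset.sum_congr rfl fun v hv => by simp only [hv, if_true]

open Classical in
/-- A nonnegative combination of `insert d F` is one of a new face, with at most the same sum. -/
theorem exists_weight_new_face (hP : P.IsStar) (hF : F ∈ P.faces) (hμ : IsConePoint F d μ)
    (hs : 1 < ∑ v ∈ F, μ v) {w : Space3 → ℝ} (hw : IsWeight (insert d F) w) :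
    ∃ a ∈ F, ∃ w', IsWeight (insert d (F.erase a)) w' ∧
      ∑ v ∈ insert d (F.erase a), w' v ≤ ∑ v ∈ insert d F, w v ∧
      ∑ v ∈ insert d (F.erase a), w' v • v = ∑ v ∈ insert d F, w v • v := by
  have hdF := hP.notMem_of_isConePoint hF hμ hF
  have hne : F.Nonempty := by rw [← Finset.card_pos, hP.card_face F hF]; norm_num
  -- The smallest ratio says how many multiples of `∑ μ v • v` can be traded for `d` before some
  -- weight vanishes, which happens at `a`. The trade does not raise the total because `∑ μ > 1`.
  obtain ⟨a, ha, hmin⟩ := F.exists_min_image (fun v => w v / μ v) hne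
  set θ := w a / μ a with hθ
  have hθ0 : 0 ≤ θ := div_nonneg (hw.nonneg a) (hμ.pos a ha).le
  set w' : Space3 → ℝ := fun v => if v = d then w d + θ else w v - θ * μ v with hw'
  have hwd : w' d = w d + θ := if_pos rfl
  have hwF : ∀ v, v ≠ d → w' v = w v - θ * μ v := fun v hv => if_neg hv
  have hFd : ∀ v ∈ F, v ≠ d := fun v hv h => hdF (h ▸ hv)
  have hW : IsWeight (insert d (F.erase a)) w' := by
    refine ⟨fun v => ?_, fun v hv => ?_⟩
    · by_cases hvd : v = d
      · rw [hvd, hwd]; exact add_nonneg (hw.nonneg d) hθ0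
      · rw [hwF v hvd]
        by_cases hv : v ∈ F
        · have := hmin v hv
          rw [le_div_iff₀ (hμ.pos v hv)] at this
          linarith
        · rw [hμ.supp v hv, mul_zero, sub_zero]; exact hw.nonneg v
    · rw [Finset.mem_insert, Finset.mem_erase, not_or, not_and_or, not_not] at hv
      rw [hwF v hv.1]
      rcases hv.2 with rfl | h
      · rw [hθ, div_mul_cancel₀ _ (hμ.pos v ha).ne', sub_self]
      · rw [hμ.supp v h, mul_zero, sub_zero]
        exact hw.supp v (by simp [hv.1, h])
  have e2 := hW.sum_erase (fun v => v) (hFd a ha)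
  have e1 := hW.sum_erase (fun _ => (1 : ℝ)) (hFd a ha)
  simp only [smul_eq_mul, mul_one] at e1
  refine ⟨a, ha, w', hW, ?_, ?_⟩
  · rw [e1, Finset.sum_insert hdF, Finset.sum_insert hdF, hwd,
      Finset.sum_congr rfl fun v hv => hwF v (hFd v hv), Finset.sum_sub_distrib, ← Finset.mul_sum]
    nlinarith
  · rw [e2, Finset.sum_insert hdF, Finset.sum_insert hdF, hwd,
      Finset.sum_congr rfl fun v hv => by rw [hwF v (hFd v hv)]]
    simp only [sub_smul, mul_smul, add_smul]
    rw [Finset.sum_sub_distrib, ← Finset.smul_sum, hμ.sum_eq]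
    abel

-- Pushed down to `F`, both weights live on the old fan and agree there. Against an old face `G ≠
-- F`, a vertex of `F` outside `G` has pushed weight zero, which forces `w d = 0`. Against a new
-- face, `w a = 0` and `w' b = 0` bound `w d` and `w' d` by each other.
open Classical in
theorem glue_unique (hP : P.IsStar) (hF : F ∈ P.faces) (hμ : IsConePoint F d μ)
    {a : Space3} (ha : a ∈ F) {w : Space3 → ℝ} (hw : IsWeight (insert d (F.erase a)) w)
    {G : Finset Space3} {w' : Space3 → ℝ}
    (hG : (G ∈ P.faces ∧ G ≠ F) ∨ ∃ b ∈ F, G = insert d (F.erase b)) (hw' : IsWeight G w')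
    (he : ∑ v ∈ insert d (F.erase a), w v • v = ∑ v ∈ G, w' v • v) : w = w' := by
  have hdF := hP.notMem_of_isConePoint hF hμ hF
  have hFd : ∀ v ∈ F, v ≠ d := fun v hv h => hdF (h ▸ hv)
  have e1 := hw.sum_erase (fun v => v) (hFd a ha)
  have hwa : w a = 0 := hw.supp a (by simp [hFd a ha])
  have hoff : ∀ v, v ∉ F → v ≠ d → w v = 0 := fun v hv hvd => hw.supp v (by simp [hv, hvd])
  rcases hG with ⟨hG, hGF⟩ | ⟨b, hb, rfl⟩
  · have key := hP.unique F hF G hG _ w' (isWeight_push hμ hw.nonneg) hw' (by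
      rw [sum_push_eq hdF hμ, ← e1, he])
    obtain ⟨b, hbF, hbG⟩ : ∃ b ∈ F, b ∉ G := by
      by_contra! h
      exact hGF (Finset.eq_of_subset_of_card_le h
        (by rw [hP.card_face G hG, hP.card_face F hF])).symm
    have hb := congrFun key b
    rw [hw'.supp b hbG, if_pos hbF] at hb
    have hwd : w d = 0 := by
      have h1 := hw.nonneg b
      have h2 := mul_nonneg (hw.nonneg d) (hμ.pos b hbF).le
      have h3 : w d * μ b = 0 := by linarith
      exact (mul_eq_zero.1 h3).resolve_right (hμ.pos b hbF).ne'
    funext v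
    rw [← key]
    by_cases hv : v ∈ F
    · simp [hv, hwd]
    · by_cases hvd : v = d
      · simp [hvd, hdF, hwd]
      · simp [hv, hoff v hv hvd]
  · have e2 := hw'.sum_erase (fun v => v) (hFd b hb)
    have hwb : w' b = 0 := hw'.supp b (by simp [hFd b hb])
    have hoff' : ∀ v, v ∉ F → v ≠ d → w' v = 0 := fun v hv hvd => hw'.supp v (by simp [hv, hvd])
    have key := hP.unique F hF F hF _ _ (isWeight_push hμ hw.nonneg)
      (isWeight_push hμ hw'.nonneg) (by
        rw [sum_push_eq hdF hμ, sum_push_eq hdF hμ, ← e1, ← e2, he])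
    have key' : ∀ v ∈ F, w v + w d * μ v = w' v + w' d * μ v := fun v hv => by
      simpa [hv] using congrFun key v
    have h1 := key' a ha
    have h2 := key' b hb
    have hd : w d = w' d := by
      rw [hwa] at h1; rw [hwb] at h2
      have p1 := hμ.pos a ha
      have p2 := hμ.pos b hb
      have n1 := hw'.nonneg a
      have n2 := hw.nonneg b
      refine le_antisymm ?_ ?_
      · refine le_of_mul_le_mul_right ?_ p2; linarith
      · refine le_of_mul_le_mul_right ?_ p1; linarith
    funext v
    by_cases hv : v ∈ F
    · have := key' v hv
      rw [hd] at this
      linarith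
    · by_cases hvd : v = d
      · rw [hvd, hd]
      · rw [hoff v hv hvd, hoff' v hv hvd]

-- For the body, points over `F` or in the new tetrahedron are rewritten over a new face without
-- raising the total. Conversely, a point over a new face is pushed down to `F`; it lies in the old
-- solid if the pushed total is at most 1 and in the new tetrahedron otherwise.
open Classical in
theorem glue (hP : P.IsStar) (hF : F ∈ P.faces) (hμ : IsConePoint F d μ)
    (hs : 1 < ∑ v ∈ F, μ v) : (P.glue F d).IsStar := by
  have hdF := hP.notMem_of_isConePoint hF hμ hF
  have hFd : ∀ v ∈ F, v ≠ d := fun v hv h => hdF (h ▸ hv)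
  have hc := hP.card_face F hF
  have hmem : ∀ h, h ∈ (P.glue F d).faces ↔ _ := fun h => mem_faces_glue (P := P) hc hdF
  refine ⟨fun G hG => ?_, fun G hG H hH w w' hw hw' he => ?_, ?_⟩
  · rcases (hmem G).1 hG with h | ⟨a, ha, rfl⟩
    · exact hP.card_face G h.1
    · rw [Finset.card_insert_of_notMem (by simp [hdF]), Finset.card_erase_of_mem ha, hc]
  · rcases (hmem G).1 hG with h | ⟨a, ha, rfl⟩
    · rcases (hmem H).1 hH with h' | ⟨a, ha, rfl⟩
      · exact hP.unique G h.1 H h'.1 w w' hw hw' he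
      · exact (hP.glue_unique hF hμ ha hw' (Or.inl h) hw he.symm).symm
    · exact hP.glue_unique hF hμ ha hw ((hmem H).1 hH) hw' he
  · change P.body ∪ convexHull ℝ ((insert d F : Finset Space3) : Set Space3) = _
    ext x
    constructor
    · have main : ∀ w, IsWeight (insert d F) w → ∑ v ∈ insert d F, w v ≤ 1 →
          ∃ G ∈ (P.glue F d).faces, ∃ w', IsWeight G w' ∧ ∑ v ∈ G, w' v ≤ 1 ∧
            ∑ v ∈ G, w' v • v = ∑ v ∈ insert d F, w v • v := by
        intro w hw h1
        obtain ⟨a, ha, w', hw', h2, h3⟩ := hP.exists_weight_new_face hF hμ hs hw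
        exact ⟨_, (hmem _).2 (Or.inr ⟨a, ha, rfl⟩), w', hw', h2.trans h1, h3⟩
      rintro (hx | hx)
      · rw [hP.body_eq] at hx
        obtain ⟨G, hG, w, hw, h1, rfl⟩ := hx
        by_cases hGF : G = F
        · subst hGF
          have hwd : w d = 0 := hw.supp d hdF
          obtain ⟨H, hH, w', hw', h2, h3⟩ := main w
            ⟨hw.nonneg, fun v hv => hw.supp v fun h => hv (Finset.mem_insert_of_mem h)⟩ (by
              rw [Finset.sum_insert hdF, hwd, zero_add]; exact h1)
          refine ⟨H, hH, w', hw', h2, h3.trans ?_⟩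
          rw [Finset.sum_insert hdF, hwd, zero_smul, zero_add]
        · exact ⟨G, (hmem G).2 (Or.inl ⟨hG, hGF⟩), w, hw, h1, rfl⟩
      · rw [Finset.mem_convexHull'] at hx
        obtain ⟨w, hw0, hw1, rfl⟩ := hx
        have e : ∀ v ∈ insert d F, (if v ∈ insert d F then w v else 0) = w v :=
          fun v hv => if_pos hv
        obtain ⟨H, hH, w', hw', h2, h3⟩ := main (fun v => if v ∈ insert d F then w v else 0)
          ⟨fun v => by
            split_ifs with h
            · exact hw0 v h
            · exact le_rfl, fun v hv => if_neg hv⟩ (by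
              rw [Finset.sum_congr rfl e, hw1])
        exact ⟨H, hH, w', hw', h2, h3.trans (Finset.sum_congr rfl fun v hv => by rw [e v hv])⟩
    · rintro ⟨G, hG, w, hw, h1, rfl⟩
      rcases (hmem G).1 hG with h | ⟨a, ha, rfl⟩
      · left; rw [hP.body_eq]; exact ⟨G, h.1, w, hw, h1, rfl⟩
      · have e1 := hw.sum_erase (fun v => v) (hFd a ha)
        have e2 := hw.sum_erase (fun _ => (1 : ℝ)) (hFd a ha)
        simp only [smul_eq_mul, mul_one] at e2
        rw [e2, Finset.sum_insert hdF] at h1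
        rw [e1]
        by_cases hle : ∑ v ∈ F, (w v + w d * μ v) ≤ 1
        · left
          rw [hP.body_eq]
          refine ⟨F, hF, _, isWeight_push hμ hw.nonneg, ?_, sum_push_eq hdF hμ w⟩
          exact le_trans (Finset.sum_congr rfl fun v hv => if_pos hv).le hle
        · right
          rw [not_le, Finset.sum_add_distrib, ← Finset.mul_sum] at hle
          rw [Finset.mem_convexHull']
          have hpos : 0 < ∑ v ∈ F, μ v - 1 := by linarith
          -- Trading `θ` units of `d` for `θ • μ` raises the total by `θ * (∑ μ - 1)`; this `θ`
          -- makes it exactly 1, as a convex combination requires.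
          set θ := (1 - w d - ∑ v ∈ F, w v) / (∑ v ∈ F, μ v - 1) with hθ
          have hθ0 : 0 ≤ θ := div_nonneg (by linarith) hpos.le
          have hθ1 : θ ≤ w d := by rw [hθ, div_le_iff₀ hpos]; nlinarith
          have hθ2 : θ * (∑ v ∈ F, μ v - 1) = 1 - w d - ∑ v ∈ F, w v := by
            rw [hθ]; field_simp
          have e3 : ∀ v ∈ F, (if v = d then w d - θ else w v + θ * μ v) = w v + θ * μ v :=
            fun v hv => if_neg (hFd v hv)
          refine ⟨fun v => if v = d then w d - θ else w v + θ * μ v, fun v hv => ?_, ?_, ?_⟩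
          · dsimp only; split_ifs with h
            · linarith
            · exact add_nonneg (hw.nonneg v)
                (mul_nonneg hθ0 (hμ.pos v ((Finset.mem_insert.1 hv).resolve_left h)).le)
          · rw [Finset.sum_insert hdF, if_pos rfl, Finset.sum_congr rfl e3,
              Finset.sum_add_distrib, ← Finset.mul_sum]
            linarith
          · rw [Finset.sum_insert hdF, Finset.sum_insert hdF,
              Finset.sum_congr rfl fun v hv => congrArg (· • v) (e3 v hv)]
            simp only [if_true, sub_smul, mul_smul, add_smul]
            rw [Finset.sum_add_distrib, ← Finset.smul_sum, hμ.sum_eq]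
            abel

end IsStar

/-! ### Coplanarity, edge incidence and counts under gluing. -/

/-- `d` does not lie in the plane of any face of `P`. -/
def OffPlanes (P : TriSolid) (d : Space3) : Prop :=
  ∀ G ∈ P.faces, ∀ c : Space3 → ℝ, ∑ v ∈ G, c v = 1 → ∑ v ∈ G, c v • v ≠ d

/-- Every edge lies on at most two faces. -/
def EdgeLeTwo (P : TriSolid) : Prop :=
  ∀ e : Finset Space3, e.card = 2 → ∀ S ⊆ P.faces, (∀ f ∈ S, e ⊆ f) → S.card ≤ 2

/-- A star-shaped stacked polyhedron. -/
structure IsStarStacked (P : TriSolid) : Prop where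
  star : P.IsStar
  stacked : P.Stacked
  noFlat : P.NoFlatEdges
  edge : P.EdgeLeTwo

/-- The vertices of a face are linearly independent, so its plane misses the origin and contains `t
• p` for at most one `t`. -/
theorem IsStar.finite_bad {P : TriSolid} (hP : P.IsStar) (p : Space3) :
    {t : ℝ | ¬ P.OffPlanes (t • p)}.Finite := by
  have : {t : ℝ | ¬ P.OffPlanes (t • p)} ⊆ ⋃ G ∈ P.faces,
      {t : ℝ | ∃ c : Space3 → ℝ, ∑ v ∈ G, c v = 1 ∧ ∑ v ∈ G, c v • v = t • p} := by
    intro t ht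
    change ¬ P.OffPlanes (t • p) at ht
    unfold OffPlanes at ht
    push Not at ht
    obtain ⟨G, hG, c, h1, h2⟩ := ht
    simp only [Set.mem_iUnion]
    exact ⟨G, hG, c, h1, h2⟩
  refine Set.Finite.subset (Set.Finite.biUnion P.faces.finite_toSet fun G hG => ?_) this
  refine Set.Subsingleton.finite ?_
  rintro t ⟨c, h1, h2⟩ t' ⟨c', h1', h2'⟩
  have h := hP.linearIndependent hG (fun v => t' * c v - t * c' v) (by
    simp only [sub_smul, mul_smul]
    rw [Finset.sum_sub_distrib, ← Finset.smul_sum, ← Finset.smul_sum, h2, h2', smul_smul,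
      smul_smul, mul_comm, sub_self])
  have h3 := Finset.sum_eq_zero h
  rw [Finset.sum_sub_distrib, ← Finset.mul_sum, ← Finset.mul_sum, h1, h1'] at h3
  linarith

section glue
variable {P : TriSolid} {F : Finset Space3} {d : Space3} {μ : Space3 → ℝ}

-- If a new triangle shares an edge with an old face `g`, the edge avoids `d`, so their union is
-- `insert d g`, and `d` is off the plane of `g`. Two different new triangles together span the
-- glued tetrahedron.
open Classical in
theorem NoFlatEdges.glue (hn : P.NoFlatEdges) (hP : P.IsStar) (hF : F ∈ P.faces)
    (hμ : IsConePoint F d μ) (hd : P.OffPlanes d) :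
    (P.glue F d).NoFlatEdges := by
  have hdF := hP.notMem_of_isConePoint hF hμ hF
  have hc := hP.card_face F hF
  have mixed : ∀ a ∈ F, ∀ g ∈ P.faces, (insert d (F.erase a) ∩ g).card = 2 →
      insert d (F.erase a) ∪ g = insert d g := by
    intro a ha g hg h2
    have hdg := hP.notMem_of_isConePoint hF hμ hg
    rw [Finset.insert_inter_of_notMem hdg] at h2
    have : F.erase a ∩ g = F.erase a := Finset.eq_of_subset_of_card_le Finset.inter_subset_left
      (by rw [Finset.card_erase_of_mem ha]; omega)
    rw [Finset.insert_union, Finset.union_eq_right.2 (Finset.inter_eq_left.1 this)]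
  have indep : ∀ g ∈ P.faces,
      AffineIndependent ℝ (fun x : (insert d g : Finset Space3) => (x : Space3)) := fun g hg =>
    affineIndependent_insert (hP.notMem_of_isConePoint hF hμ hg) (hP.linearIndependent hg)
      (hd g hg)
  intro f hf g hg hfg h2
  rw [mem_faces_glue hc hdF] at hf hg
  rcases hf with hf | ⟨a, ha, rfl⟩
  · rcases hg with hg | ⟨b, hb, rfl⟩
    · exact hn f hf.1 g hg.1 hfg h2
    · rw [Finset.inter_comm] at h2
      rw [Finset.union_comm, mixed b hb f hf.1 h2]
      exact indep f hf.1
  · rcases hg with hg | ⟨b, hb, rfl⟩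
    · rw [mixed a ha g hg.1 h2]
      exact indep g hg.1
    · have hab : a ≠ b := by rintro rfl; exact hfg rfl
      have : insert d (F.erase a) ∪ insert d (F.erase b) = insert d F := by
        ext x
        simp only [Finset.mem_union, Finset.mem_insert, Finset.mem_erase]
        by_cases hxa : x = a
        · subst hxa; simp [hab]
        · simp only [hxa, ne_eq, not_false_eq_true, true_and]; tauto
      rw [this]
      exact indep F hF

-- An edge at `d` lies only on new triangles, one for each vertex of `F` not on the edge. An edge of
-- `F` exchanges `F` for a single new triangle. Any other edge lies only on old faces.
open Classical in
theorem EdgeLeTwo.glue (he : P.EdgeLeTwo) (hP : P.IsStar) (hF : F ∈ P.faces)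
    (hμ : IsConePoint F d μ) : (P.glue F d).EdgeLeTwo := by
  have hdF := hP.notMem_of_isConePoint hF hμ hF
  have hc := hP.card_face F hF
  intro e h2 S hS hSe
  by_cases hde : d ∈ e
  · obtain ⟨x, hx⟩ : ∃ x, e.erase d = {x} := by
      rw [← Finset.card_eq_one, Finset.card_erase_of_mem hde, h2]
    have hxe : x ∈ e.erase d := by rw [hx]; simp
    rw [Finset.mem_erase] at hxe
    have hnew : ∀ f ∈ S, ∃ a ∈ F, a ≠ x ∧ x ∈ F ∧ f = insert d (F.erase a) := by
      intro f hf
      have hfe := hSe f hf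
      rcases (mem_faces_glue hc hdF).1 (hS hf) with h | ⟨a, ha, rfl⟩
      · exact absurd (hfe hde) (hP.notMem_of_isConePoint hF hμ h.1)
      · have := Finset.mem_of_mem_insert_of_ne (hfe hxe.2) hxe.1
        rw [Finset.mem_erase] at this
        exact ⟨a, ha, this.1.symm, this.2, rfl⟩
    rcases S.eq_empty_or_nonempty with rfl | ⟨f, hf⟩
    · simp
    obtain ⟨-, -, -, hxF, -⟩ := hnew f hf
    have hsub : S ⊆ (F.erase x).image (fun a => insert d (F.erase a)) := by
      intro f hf
      obtain ⟨a, ha, hax, -, rfl⟩ := hnew f hf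
      exact Finset.mem_image.2 ⟨a, Finset.mem_erase.2 ⟨hax, ha⟩, rfl⟩
    refine (Finset.card_le_card hsub).trans (Finset.card_image_le.trans ?_)
    rw [Finset.card_erase_of_mem hxF]; omega
  · by_cases heF : e ⊆ F
    · have hsub : S ⊆ insert (insert d e) ((S.filter (· ∈ P.faces)).erase F) := by
        intro f hf
        rcases (mem_faces_glue hc hdF).1 (hS hf) with h | ⟨a, ha, rfl⟩
        · simp [hf, h]
        · have h1 := hSe _ hf
          have h3 : e ⊆ F.erase a := (Finset.subset_insert_iff_of_notMem hde).1 h1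
          rw [Finset.eq_of_subset_of_card_le h3
            (by rw [Finset.card_erase_of_mem ha]; omega)]
          simp
      have hle := he e h2 (insert F ((S.filter (· ∈ P.faces)).erase F)) (by
        intro f hf
        rcases Finset.mem_insert.1 hf with rfl | hf
        · exact hF
        · exact (Finset.mem_filter.1 (Finset.mem_of_mem_erase hf)).2) (by
        intro f hf
        rcases Finset.mem_insert.1 hf with rfl | hf
        · exact heF
        · exact hSe _ (Finset.mem_filter.1 (Finset.mem_of_mem_erase hf)).1)
      rw [Finset.card_insert_of_notMem (Finset.notMem_erase _ _)] at hle
      exact (Finset.card_le_card hsub).trans ((Finset.card_insert_le _ _).trans hle)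
    · refine he e h2 S (fun f hf => ?_) hSe
      rcases (mem_faces_glue hc hdF).1 (hS hf) with h | ⟨a, ha, rfl⟩
      · exact h.1
      · refine absurd ?_ heF
        exact ((Finset.subset_insert_iff_of_notMem hde).1 (hSe _ hf)).trans (Finset.erase_subset _ _)

theorem IsStarStacked.glue (h : P.IsStarStacked) (hF : F ∈ P.faces)
    (hμ : IsConePoint F d μ) (hs : 1 < ∑ v ∈ F, μ v) (hd : P.OffPlanes d) :
    (P.glue F d).IsStarStacked where
  star := h.star.glue hF hμ hs
  stacked := .step P F d h.stacked (h.star.canGlue hF hμ hs)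
  noFlat := h.noFlat.glue h.star hF hμ hd
  edge := h.edge.glue h.star hF hμ

open Classical in
theorem card_faces_glue (hP : P.IsStar) (hF : F ∈ P.faces) (hμ : IsConePoint F d μ) :
    (P.glue F d).faces.card = P.faces.card + 2 := by
  have hdF := hP.notMem_of_isConePoint hF hμ hF
  have hc := hP.card_face F hF
  have : (P.glue F d).faces = P.faces.erase F ∪ F.image (fun a => insert d (F.erase a)) := by
    ext h
    rw [mem_faces_glue hc hdF]
    simp only [Finset.mem_union, Finset.mem_erase, Finset.mem_image]
    constructor
    · rintro (h | ⟨a, ha, rfl⟩)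
      · exact Or.inl h.symm
      · exact Or.inr ⟨a, ha, rfl⟩
    · rintro (h | ⟨a, ha, rfl⟩)
      · exact Or.inl h.symm
      · exact Or.inr ⟨a, ha, rfl⟩
  rw [this, Finset.card_union_of_disjoint, Finset.card_erase_of_mem hF, Finset.card_image_of_injOn,
    hc]
  · have : 0 < P.faces.card := Finset.card_pos.2 ⟨F, hF⟩
    omega
  · intro a ha b hb hab
    by_contra hne
    have : a ∈ insert d (F.erase b) :=
      Finset.mem_insert_of_mem (Finset.mem_erase.2 ⟨hne, ha⟩)
    rw [← show _ = insert d (F.erase b) from hab] at this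
    simp only [Finset.mem_insert, Finset.mem_erase, ne_eq, not_true_eq_false, false_and,
      or_false] at this
    exact hdF (this ▸ ha)
  · rw [Finset.disjoint_left]
    intro g hg hg'
    obtain ⟨a, _, rfl⟩ := Finset.mem_image.1 hg'
    exact hP.notMem_of_isConePoint hF hμ (Finset.mem_of_mem_erase hg) (Finset.mem_insert_self _ _)

open Classical in
theorem vertices_glue (hF : F ∈ P.faces) (hc : F.card = 3) (hdF : d ∉ F) :
    (P.glue F d).vertices = insert d P.vertices := by
  ext x
  simp only [vertices, Finset.mem_insert, Finset.mem_biUnion, id]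
  constructor
  · rintro ⟨f, hf, hx⟩
    rcases (mem_faces_glue hc hdF).1 hf with h | ⟨a, ha, rfl⟩
    · exact Or.inr ⟨f, h.1, hx⟩
    · rcases Finset.mem_insert.1 hx with rfl | hx
      · exact Or.inl rfl
      · exact Or.inr ⟨F, hF, Finset.mem_of_mem_erase hx⟩
  · rintro (rfl | ⟨f, hf, hx⟩)
    · obtain ⟨a, ha⟩ : F.Nonempty := Finset.card_pos.1 (by omega)
      exact ⟨_, (mem_faces_glue hc hdF).2 (Or.inr ⟨a, ha, rfl⟩), Finset.mem_insert_self _ _⟩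
    · by_cases hfF : f = F
      · subst hfF
        obtain ⟨b, hb, hne⟩ := Finset.exists_mem_ne (by omega : 1 < f.card) x
        exact ⟨_, (mem_faces_glue hc hdF).2 (Or.inr ⟨b, hb, rfl⟩),
          Finset.mem_insert_of_mem (Finset.mem_erase.2 ⟨hne.symm, hx⟩)⟩
      · exact ⟨f, (mem_faces_glue hc hdF).2 (Or.inl ⟨hf, hfF⟩), hx⟩

theorem card_vertices_glue (hP : P.IsStar) (hF : F ∈ P.faces) (hμ : IsConePoint F d μ) :
    (P.glue F d).vertices.card = P.vertices.card + 1 := by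
  classical
  rw [vertices_glue hF (hP.card_face F hF) (hP.notMem_of_isConePoint hF hμ hF), Finset.card_insert_of_notMem]
  simp only [vertices, Finset.mem_biUnion, id, not_exists, not_and]
  exact fun f hf => hP.notMem_of_isConePoint hF hμ hf

theorem card_edges_glue (hP : P.IsStar) (hF : F ∈ P.faces) (hμ : IsConePoint F d μ) :
    (P.glue F d).edges.card ≤ P.edges.card + 3 := by
  classical
  have hdF := hP.notMem_of_isConePoint hF hμ hF
  have hc := hP.card_face F hF
  have : (P.glue F d).edges ⊆ P.edges ∪ F.image (fun a => {d, a}) := by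
    intro e he
    simp only [edges, Finset.mem_biUnion, Finset.mem_powersetCard] at he
    obtain ⟨f, hf, hef, h2⟩ := he
    simp only [edges, Finset.mem_union, Finset.mem_biUnion, Finset.mem_powersetCard,
      Finset.mem_image]
    rcases (mem_faces_glue hc hdF).1 hf with h | ⟨a, ha, rfl⟩
    · exact Or.inl ⟨f, h.1, hef, h2⟩
    · by_cases hde : d ∈ e
      · right
        obtain ⟨x, hx⟩ : ∃ x, e.erase d = {x} := by
          rw [← Finset.card_eq_one, Finset.card_erase_of_mem hde, h2]
        have hxe : x ∈ e.erase d := by rw [hx]; simp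
        have := Finset.subset_insert_iff.1 hef hxe
        refine ⟨x, Finset.mem_of_mem_erase this, ?_⟩
        rw [← Finset.insert_erase hde, hx]
      · left
        exact ⟨F, hF, ((Finset.subset_insert_iff_of_notMem hde).1 hef).trans
          (Finset.erase_subset _ _), h2⟩
  refine (Finset.card_le_card this).trans ((Finset.card_union_le _ _).trans ?_)
  have := Finset.card_image_le (s := F) (f := fun a => ({d, a} : Finset Space3))
  omega

end glue

/-! ### The regular tetrahedron and its refinements. -/

theorem IsConePoint.smul {F : Finset Space3} {d : Space3} {μ : Space3 → ℝ}
    (h : IsConePoint F d μ) {t : ℝ} (ht : 0 < t) : IsConePoint F (t • d) (fun v => t * μ v) where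
  pos v hv := mul_pos ht (h.pos v hv)
  supp v hv := by rw [h.supp v hv, mul_zero]
  sum_eq := by simp only [mul_smul]; rw [← Finset.smul_sum, h.sum_eq]

theorem exists_off_planes {P : TriSolid} (hP : P.IsStar) (p : Space3) {x y : ℝ} (hxy : x < y) :
    ∃ t, x < t ∧ t < y ∧ P.OffPlanes (t • p) := by
  obtain ⟨t, ht, hb⟩ := (Set.Ioo_infinite hxy).exists_notMem_finite (hP.finite_bad p)
  exact ⟨t, ht.1, ht.2, not_not.1 hb⟩

/-- A tetrahedron with centroid at the origin is star-shaped. -/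
theorem isStar_tetrahedron (t : Finset Space3) (hcard : t.card = 4)
    (ht : AffineIndependent ℝ (fun x : t => (x : Space3))) (h0 : ∑ v ∈ t, v = 0) :
    (tetrahedron t).IsStar := by
  classical
  rw [affineIndependent_finset_iff] at ht
  have hface : ∀ F ∈ (tetrahedron t).faces, ∃ a ∈ t, F = t.erase a := by
    intro F hF
    obtain ⟨hs, hc⟩ := Finset.mem_powersetCard.1 hF
    obtain ⟨a, ha⟩ : (t \ F).Nonempty := by
      rw [← Finset.card_pos, Finset.card_sdiff_of_subset hs]; omega
    rw [Finset.mem_sdiff] at ha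
    refine ⟨a, ha.1, Finset.eq_of_subset_of_card_le (fun x hx => ?_) ?_⟩
    · refine Finset.mem_erase.2 ⟨?_, hs hx⟩
      rintro rfl; exact ha.2 hx
    · rw [Finset.card_erase_of_mem ha.1]; omega
  have hface' : ∀ a ∈ t, t.erase a ∈ (tetrahedron t).faces := fun a ha =>
    Finset.mem_powersetCard.2 ⟨Finset.erase_subset _ _, by
      rw [Finset.card_erase_of_mem ha, hcard]⟩
  -- The vertices sum to zero and are affinely independent, so every linear relation among them is a
  -- multiple of the all-ones relation.
  have rel : ∀ c : Space3 → ℝ, ∑ v ∈ t, c v • v = 0 → ∀ v ∈ t, c v = (∑ v ∈ t, c v) / 4 := by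
    intro c hc v hv
    have := ht (fun v => c v - (∑ v ∈ t, c v) / 4) (by
      rw [Finset.sum_sub_distrib, Finset.sum_const, hcard]; simp; ring) (by
      simp only [sub_smul]
      rw [Finset.sum_sub_distrib, hc, ← Finset.smul_sum, h0]; simp) v hv
    linarith
  have ext_sum : ∀ a w, IsWeight (t.erase a) w → ∑ v ∈ t.erase a, w v • v = ∑ v ∈ t, w v • v :=
    fun a w hw => Finset.sum_subset (Finset.erase_subset _ _) fun v _ hv => by
      rw [hw.supp v hv, zero_smul]
  have ext_sum' : ∀ a w, IsWeight (t.erase a) w → ∑ v ∈ t.erase a, w v = ∑ v ∈ t, w v :=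
    fun a w hw => Finset.sum_subset (Finset.erase_subset _ _) fun v _ hv => hw.supp v hv
  refine ⟨fun F hF => (Finset.mem_powersetCard.1 hF).2, ?_, ?_⟩
  · intro F hF G hG w w' hw hw' he
    obtain ⟨a, ha, rfl⟩ := hface F hF
    obtain ⟨b, hb, rfl⟩ := hface G hG
    rw [ext_sum a w hw, ext_sum b w' hw'] at he
    have key := rel (fun v => w v - w' v) (by
      simp only [sub_smul]; rw [Finset.sum_sub_distrib, he, sub_self])
    have k1 := key a ha
    have k2 := key b hb
    rw [hw.supp a (Finset.notMem_erase _ _)] at k1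
    rw [hw'.supp b (Finset.notMem_erase _ _)] at k2
    have n1 := hw.nonneg b
    have n2 := hw'.nonneg a
    funext v
    by_cases hv : v ∈ t
    · have := key v hv
      linarith
    · rw [hw.supp v fun h => hv (Finset.mem_of_mem_erase h),
        hw'.supp v fun h => hv (Finset.mem_of_mem_erase h)]
  · ext x
    change x ∈ convexHull ℝ (t : Set Space3) ↔ _
    rw [Finset.mem_convexHull']
    constructor
    · rintro ⟨w, hw0, hw1, rfl⟩
      obtain ⟨a, ha, hmin⟩ := t.exists_min_image w (Finset.card_pos.1 (by omega))
      have hW : IsWeight (t.erase a) (fun v => if v ∈ t then w v - w a else 0) := by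
        refine ⟨fun v => ?_, fun v hv => ?_⟩
        · split_ifs with h
          · linarith [hmin v h]
          · exact le_rfl
        · split_ifs with h
          · rw [Finset.mem_erase, not_and_or, not_not] at hv
            rcases hv with rfl | hv
            · ring
            · exact absurd h hv
          · rfl
      refine ⟨t.erase a, hface' a ha, _, hW, ?_, ?_⟩
      · rw [ext_sum' a _ hW, Finset.sum_congr rfl fun v hv => if_pos hv, Finset.sum_sub_distrib, hw1]
        have := Finset.sum_nonneg (s := t) (f := fun _ => w a) fun _ _ => hw0 a ha
        linarith
      · rw [ext_sum a _ hW, Finset.sum_congr rfl fun v hv => congrArg (· • v) (if_pos hv)]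
        simp only [sub_smul]
        rw [Finset.sum_sub_distrib, ← Finset.smul_sum, h0, smul_zero, sub_zero]
    · rintro ⟨F, hF, w, hw, h1, rfl⟩
      obtain ⟨a, ha, rfl⟩ := hface F hF
      rw [ext_sum' a w hw] at h1
      refine ⟨fun v => w v + (1 - ∑ v ∈ t, w v) / 4, fun v _ => ?_, ?_, ?_⟩
      · have := hw.nonneg v
        linarith
      · rw [Finset.sum_add_distrib, Finset.sum_const, hcard]; simp; ring
      · simp only [add_smul]
        rw [Finset.sum_add_distrib, ← Finset.smul_sum, h0, smul_zero, add_zero, ext_sum a w hw]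

theorem isStarStacked_tetrahedron (t : Finset Space3) (hcard : t.card = 4)
    (ht : AffineIndependent ℝ (fun x : t => (x : Space3))) (h0 : ∑ v ∈ t, v = 0) :
    (tetrahedron t).IsStarStacked := by
  classical
  have hcf : ∀ f ∈ (tetrahedron t).faces, f ⊆ t ∧ f.card = 3 := fun f hf =>
    Finset.mem_powersetCard.1 hf
  refine ⟨isStar_tetrahedron t hcard ht h0, .base t hcard ht, fun f hf g hg _ h2 => ?_,
    fun e he S hS hSe => ?_⟩
  · have h4 := Finset.card_union_add_card_inter f g
    have hu : (f ∪ g) = t := Finset.eq_of_subset_of_card_le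
      (Finset.union_subset (hcf f hf).1 (hcf g hg).1) (by
        have := (hcf f hf).2; have := (hcf g hg).2; omega)
    convert! ht
  · rcases S.eq_empty_or_nonempty with rfl | ⟨f0, hf0⟩
    · simp
    have het : e ⊆ t := (hSe f0 hf0).trans (hcf f0 (hS hf0)).1
    have hsub : S ⊆ (t \ e).image (fun a => t.erase a) := by
      intro f hf
      obtain ⟨hft, hf3⟩ := hcf f (hS hf)
      obtain ⟨a, ha⟩ : (t \ f).Nonempty := by
        rw [← Finset.card_pos, Finset.card_sdiff_of_subset hft]; omega
      rw [Finset.mem_sdiff] at ha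
      refine Finset.mem_image.2 ⟨a, Finset.mem_sdiff.2 ⟨ha.1, fun h => ha.2 (hSe f hf h)⟩, ?_⟩
      refine (Finset.eq_of_subset_of_card_le (fun x hx => ?_) ?_).symm
      · refine Finset.mem_erase.2 ⟨?_, hft hx⟩
        rintro rfl; exact ha.2 hx
      · rw [Finset.card_erase_of_mem ha.1]; omega
    refine (Finset.card_le_card hsub).trans (Finset.card_image_le.trans ?_)
    rw [Finset.card_sdiff_of_subset het]; omega

theorem exists_regular_tetrahedron : ∃ t : Finset Space3, t.card = 4 ∧
    (∀ x ∈ t, ∀ y ∈ t, x ≠ y → dist x y = 1) ∧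
    AffineIndependent ℝ (fun x : t => (x : Space3)) ∧ ∑ v ∈ t, v = 0 := by
  classical
  -- The vertices are alternate corners of a cube of side `2 * s`, whose face diagonals have squared
  -- length `8 * s ^ 2`.
  obtain ⟨s, hs, hs8⟩ : ∃ s : ℝ, 0 < s ∧ s ^ 2 * 8 = 1 :=
    ⟨Real.sqrt (1 / 8), by positivity, by rw [Real.sq_sqrt (by norm_num)]; norm_num⟩
  set p : Fin 4 → Space3 := ![!₂[s, s, s], !₂[s, -s, -s], !₂[-s, s, -s], !₂[-s, -s, s]] with hp
  have hd : ∀ i j, i ≠ j → dist (p i) (p j) = 1 := by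
    intro i j hij
    rw [EuclideanSpace.dist_eq, Real.sqrt_eq_one]
    simp only [Real.dist_eq, sq_abs, Fin.sum_univ_three]
    fin_cases i <;> fin_cases j <;> first | exact absurd rfl hij | (simp [hp]; nlinarith)
  have hinj : Function.Injective p := by
    intro i j h
    by_contra hne
    have := hd i j hne
    rw [h, dist_self] at this
    norm_num at this
  refine ⟨Finset.univ.image p, ?_, ?_, ?_, ?_⟩
  · rw [Finset.card_image_of_injective _ hinj]; rfl
  · intro x hx y hy hxy
    obtain ⟨i, -, rfl⟩ := Finset.mem_image.1 hx
    obtain ⟨j, -, rfl⟩ := Finset.mem_image.1 hy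
    exact hd i j fun h => hxy (by rw [h])
  · rw [affineIndependent_finset_iff]
    intro c h0 h1 v hv
    obtain ⟨i, -, rfl⟩ := Finset.mem_image.1 hv
    rw [Finset.sum_image hinj.injOn, Fin.sum_univ_four] at h0 h1
    have e0 := congrArg (fun v : Space3 => v 0) h1
    have e1 := congrArg (fun v : Space3 => v 1) h1
    have e2 := congrArg (fun v : Space3 => v 2) h1
    set c0 := c (p 0)
    set c1 := c (p 1)
    set c2 := c (p 2)
    set c3 := c (p 3)
    simp [hp] at e0 e1 e2
    have f0 : c0 + c1 - c2 - c3 = 0 := by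
      refine (mul_eq_zero.1 (?_ : s * _ = 0)).resolve_left hs.ne'; linarith
    have f1 : c0 - c1 + c2 - c3 = 0 := by
      refine (mul_eq_zero.1 (?_ : s * _ = 0)).resolve_left hs.ne'; linarith
    have f2 : c0 - c1 - c2 + c3 = 0 := by
      refine (mul_eq_zero.1 (?_ : s * _ = 0)).resolve_left hs.ne'; linarith
    fin_cases i
    · change c0 = 0; linarith
    · change c1 = 0; linarith
    · change c2 = 0; linarith
    · change c3 = 0; linarith
  · rw [Finset.sum_image hinj.injOn, Fin.sum_univ_four]
    ext i
    fin_cases i <;> simp [hp]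

open Classical in
/-- The incenter of a face of a star-shaped solid lies in the open cone over it. -/
theorem IsStar.exists_incenter {P : TriSolid} (hP : P.IsStar) {F : Finset Space3}
    (hF : F ∈ P.faces) : ∃ (s : Affine.Simplex ℝ Space3 2) (μ : Space3 → ℝ),
      (F : Set Space3) = Set.range s.points ∧ IsConePoint F s.incenter μ ∧ ∑ v ∈ F, μ v = 1 := by
  have hc := hP.card_face F hF
  let e := (F.equivFinOfCardEq hc).symm
  have haff : AffineIndependent ℝ (fun x : F => (x : Space3)) := by
    rw [affineIndependent_finset_iff]
    exact fun c _ h1 => hP.linearIndependent hF c h1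
  let s : Affine.Simplex ℝ Space3 2 := ⟨fun i => (e i : Space3), haff.comp_embedding e.toEmbedding⟩
  obtain ⟨w, hw1, hw, hwp⟩ := s.incenter_mem_interior
  rw [Finset.affineCombination_eq_linear_combination _ _ _ hw1] at hwp
  set μ : Space3 → ℝ := fun v => if h : v ∈ F then w (e.symm ⟨v, h⟩) else 0 with hμ
  have hμe : ∀ i, μ (e i) = w i := fun i => by simp [hμ]
  refine ⟨s, μ, ?_, ⟨fun v hv => ?_, fun v hv => by simp [hμ, hv], ?_⟩, ?_⟩
  · ext v
    constructor
    · intro hv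
      exact ⟨e.symm ⟨v, hv⟩, by simp [s]⟩
    · rintro ⟨i, rfl⟩
      exact (e i).2
  · simp only [hμ, hv, dif_pos]
    exact (hw _).1
  · rw [← hwp, ← Finset.sum_coe_sort, ← e.sum_comp]
    exact Finset.sum_congr rfl fun i _ => by rw [hμe]
  · rw [← hw1, ← Finset.sum_coe_sort, ← e.sum_comp]
    exact Finset.sum_congr rfl fun i _ => hμe i

/-- The final count needs only an upper bound on the number of edges, so it suffices that each
gluing adds at most three. -/
theorem exists_refinement (k : ℕ) {ε : ℝ} (hε : 0 < ε) : ∃ Q : TriSolid, Refinement ε k Q ∧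
    Q.IsStarStacked ∧ Q.faces.card = 4 + 2 * k ∧ Q.vertices.card = 4 + k ∧
    Q.edges.card ≤ 6 + 3 * k := by
  classical
  induction k with
  | zero =>
    obtain ⟨t, hc, hd, ht, h0⟩ := exists_regular_tetrahedron
    refine ⟨tetrahedron t, .base t hc hd, isStarStacked_tetrahedron t hc ht h0, ?_, ?_, ?_⟩
    · simp [tetrahedron, hc]
    · rw [← hc]
      congr 1
      ext x
      simp only [vertices, tetrahedron, Finset.mem_biUnion, Finset.mem_powersetCard, id]
      constructor
      · rintro ⟨f, hf, hx⟩; exact hf.1 hx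
      · intro hx
        obtain ⟨f, hxf, hft, hf⟩ := Finset.exists_subsuperset_card_eq (n := 3)
          (Finset.singleton_subset_iff.2 hx) (by simp) (by omega)
        exact ⟨f, ⟨hft, hf⟩, hxf (Finset.mem_singleton_self x)⟩
    · have : (tetrahedron t).edges ⊆ t.powersetCard 2 := by
        intro e he
        simp only [edges, tetrahedron, Finset.mem_biUnion, Finset.mem_powersetCard] at he ⊢
        obtain ⟨f, hf, hef, h2⟩ := he
        exact ⟨hef.trans hf.1, h2⟩
      refine (Finset.card_le_card this).trans ?_
      rw [Finset.card_powersetCard, hc]; decide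
  | succ k ih =>
    obtain ⟨Q, hr, hQ, hf, hv, he⟩ := ih
    obtain ⟨F, hF⟩ : Q.faces.Nonempty := Finset.card_pos.1 (by omega)
    obtain ⟨s, μ, hs, hμ, h1⟩ := hQ.star.exists_incenter hF
    -- Scaling the incenter by `t` moves it by `(t - 1) * ‖s.incenter‖`, which this bound keeps
    -- below `ε`; the `+ 1` keeps the denominator positive.
    obtain ⟨t, ht1, ht2, hoff⟩ := exists_off_planes hQ.star s.incenter
      (show (1 : ℝ) < 1 + ε / (‖s.incenter‖ + 1) by
        have : 0 < ε / (‖s.incenter‖ + 1) := by positivity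
        linarith)
    have hμ' := hμ.smul (zero_lt_one.trans ht1)
    have hsum : 1 < ∑ v ∈ F, t * μ v := by rw [← Finset.mul_sum, h1, mul_one]; exact ht1
    refine ⟨Q.glue F (t • s.incenter), .step k Q s F _ hr hs (hQ.star.canGlue hF hμ' hsum) ?_,
      hQ.glue hF hμ' hsum hoff, ?_, ?_, ?_⟩
    · rw [dist_eq_norm, show t • s.incenter - s.incenter = (t - 1) • s.incenter by
        rw [sub_smul, one_smul], norm_smul, Real.norm_of_nonneg (by linarith)]
      have hpos : 0 < ‖s.incenter‖ + 1 := by positivity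
      have : (t - 1) * (‖s.incenter‖ + 1) < ε := by
        rw [← lt_div_iff₀ hpos]; linarith
      nlinarith [norm_nonneg s.incenter]
    · rw [card_faces_glue hQ.star hF hμ', hf]; ring
    · rw [card_vertices_glue hQ.star hF hμ', hv]; ring
    · have := card_edges_glue hQ.star hF hμ'
      omega

/-! ### Convex realizations of stacked solids. -/

/-- The points `q v` realize the boundary complex of `P` as that of a convex polytope. -/
def IsRealization (P : TriSolid) (q : Space3 → Space3) : Prop :=
  ∀ S : Finset Space3, S ⊆ P.vertices →
    ((S.Nonempty ∧ ∃ f ∈ P.faces, S ⊆ f) ↔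
      ∃ l : Space3 →L[ℝ] ℝ, l ≠ 0 ∧
        ∀ v ∈ P.vertices, (v ∈ S ↔ ∀ w ∈ P.vertices, l (q w) ≤ l (q v)))

/-- `l` is maximal over the points `q v`, `v ∈ V`, exactly for `v ∈ S`. -/
def Exposes (V : Finset Space3) (q : Space3 → Space3) (S : Finset Space3)
    (l : Space3 →L[ℝ] ℝ) : Prop :=
  ∀ v ∈ V, (v ∈ S ↔ ∀ w ∈ V, l (q w) ≤ l (q v))

section Exposes
variable {V S : Finset Space3} {q : Space3 → Space3} {l : Space3 →L[ℝ] ℝ}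

theorem Exposes.eq (h : Exposes V q S l) (hS : S ⊆ V) {v w : Space3} (hv : v ∈ S) (hw : w ∈ S) :
    l (q v) = l (q w) :=
  le_antisymm ((h w (hS hw)).1 hw v (hS hv)) ((h v (hS hv)).1 hv w (hS hw))

theorem Exposes.lt (h : Exposes V q S l) (hS : S ⊆ V) {v w : Space3} (hv : v ∈ V) (hvS : v ∉ S)
    (hw : w ∈ S) : l (q v) < l (q w) := by
  by_contra hle
  rw [not_lt] at hle
  exact hvS ((h v hv).2 fun u hu => ((h w (hS hw)).1 hw u hu).trans hle)

theorem exposes_of_eq_of_lt (m : ℝ) (hS : S.Nonempty) (hSV : S ⊆ V) (h1 : ∀ v ∈ S, l (q v) = m)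
    (h2 : ∀ v ∈ V, v ∉ S → l (q v) < m) : Exposes V q S l := by
  intro v hv
  constructor
  · intro hvS w hw
    rw [h1 v hvS]
    by_cases hwS : w ∈ S
    · exact (h1 w hwS).le
    · exact (h2 w hw hwS).le
  · intro h
    by_contra hvS
    obtain ⟨w, hw⟩ := hS
    have := h w (hSV hw)
    rw [h1 w hw] at this
    exact absurd (h2 v hv hvS) (not_lt.2 this)

end Exposes

theorem face_subset_vertices {P : TriSolid} {F : Finset Space3} (hF : F ∈ P.faces) :
    F ⊆ P.vertices := by
  classical
  exact fun x hx => Finset.mem_biUnion.2 ⟨F, hF, hx⟩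

section step
variable {P : TriSolid} {q : Space3 → Space3} {F : Finset Space3}

theorem IsRealization.exists_exposes (hq : P.IsRealization q) (hF : F ∈ P.faces)
    {S : Finset Space3} (hS : S.Nonempty) (hSF : S ⊆ F) :
    ∃ l : Space3 →L[ℝ] ℝ, l ≠ 0 ∧ Exposes P.vertices q S l :=
  (hq S (hSF.trans (face_subset_vertices hF))).1 ⟨hS, F, hF, hSF⟩

/-- Two functionals that are constant on a facet are proportional. -/
theorem IsRealization.eq_smul (hq : P.IsRealization q) (hF : F ∈ P.faces) (hc : F.card = 3)
    {l l₀ : Space3 →L[ℝ] ℝ} (h₀ : Exposes P.vertices q F l₀) {x : Space3} (hxV : x ∈ P.vertices)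
    (hxF : x ∉ F) (hl : ∀ v ∈ F, ∀ w ∈ F, l (q v) = l (q w)) : ∃ κ : ℝ, l = κ • l₀ := by
  classical
  have hFV := face_subset_vertices hF
  obtain ⟨a, b, c, hab, hac, hbc, rfl⟩ := Finset.card_eq_three.1 hc
  obtain ⟨l1, -, h1⟩ := hq.exists_exposes hF (S := {a, b}) (by simp) (by
    intro v; simp only [Finset.mem_insert, Finset.mem_singleton]; tauto)
  obtain ⟨l2, -, h2⟩ := hq.exists_exposes hF (S := {a, c}) (by simp) (by
    intro v; simp only [Finset.mem_insert, Finset.mem_singleton]; tauto)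
  have e1 : l1 (q b) = l1 (q a) := h1.eq (by
    refine subset_trans ?_ hFV
    intro v; simp only [Finset.mem_insert, Finset.mem_singleton]; tauto) (by simp) (by simp)
  have e1' : l1 (q c) < l1 (q a) := h1.lt (by
    refine subset_trans ?_ hFV
    intro v; simp only [Finset.mem_insert, Finset.mem_singleton]; tauto) (hFV (by simp))
    (by simp [hac.symm, hbc.symm]) (by simp)
  have e2 : l2 (q c) = l2 (q a) := h2.eq (by
    refine subset_trans ?_ hFV
    intro v; simp only [Finset.mem_insert, Finset.mem_singleton]; tauto) (by simp) (by simp)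
  have e2' : l2 (q b) < l2 (q a) := h2.lt (by
    refine subset_trans ?_ hFV
    intro v; simp only [Finset.mem_insert, Finset.mem_singleton]; tauto) (hFV (by simp))
    (by simp [hab.symm, hbc]) (by simp)
  have e0 : l₀ (q b) = l₀ (q a) := h₀.eq hFV (by simp) (by simp)
  have e0' : l₀ (q c) = l₀ (q a) := h₀.eq hFV (by simp) (by simp)
  have e0'' : l₀ (q x) < l₀ (q a) := h₀.lt hFV hxV hxF (by simp)
  -- The functionals `l₀`, `l1`, `l2` detect the three coefficients in turn, so these vectors form a
  -- basis. Both `l` and `l₀` vanish on the first two, hence the third alone determines the factor.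
  let u : Fin 3 → Space3 := ![q b - q a, q c - q a, q x - q a]
  have hind : LinearIndependent ℝ u := by
    rw [Fintype.linearIndependent_iff]
    intro g hg
    rw [Fin.sum_univ_three] at hg
    simp only [u, Matrix.cons_val_zero, Matrix.cons_val_one, Matrix.cons_val_two,
      Matrix.head_cons, Matrix.tail_cons] at hg
    have k0 := congrArg l₀ hg
    have k1 := congrArg l1 hg
    have k2 := congrArg l2 hg
    simp only [map_add, map_smul, map_sub, map_zero, smul_eq_mul, e0, e0', e1, e2, sub_self,
      mul_zero, zero_add, add_zero] at k0 k1 k2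
    have g2 : g 2 = 0 := (mul_eq_zero.1 k0).resolve_right (by linarith)
    rw [g2, zero_mul, add_zero] at k1 k2
    have g1 : g 1 = 0 := (mul_eq_zero.1 k1).resolve_right (by linarith)
    have g0 : g 0 = 0 := (mul_eq_zero.1 k2).resolve_right (by linarith)
    intro i; fin_cases i
    · exact g0
    · exact g1
    · exact g2
  let B := basisOfLinearIndependentOfCardEqFinrank hind (by simp)
  refine ⟨(l (q x) - l (q a)) / (l₀ (q x) - l₀ (q a)), ?_⟩
  apply ContinuousLinearMap.coe_injective
  refine B.ext fun i => ?_
  have hB : B i = u i := by simp [B]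
  rw [hB]
  have f1 := hl b (by simp) a (by simp)
  have f2 := hl c (by simp) a (by simp)
  fin_cases i
  · simp [u, e0, f1]
  · simp [u, e0', f2]
  · simp [u]
    rw [div_mul_cancel₀ _ (by linarith)]

-- The unit functionals that are maximal at `v` form a compact set. Each is strictly smaller at the
-- centroid of `F` than at `v`, since otherwise `F` and `v` would lie in a common face, which has
-- only three vertices. Compactness gives a uniform gap, which absorbs a small displacement.
open Filter Topology in
theorem IsRealization.eventually_beneath (hq : P.IsRealization q) (hcard : ∀ f ∈ P.faces, f.card = 3)
    (hF : F ∈ P.faces) (u : Space3) {v : Space3} (hv : v ∈ P.vertices) (hvF : v ∉ F) :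
    ∀ᶠ δ in 𝓝[>] (0 : ℝ), ∀ l : Space3 →L[ℝ] ℝ, l ≠ 0 →
      (∀ w ∈ P.vertices, l (q w) ≤ l (q v)) →
        l ((3⁻¹ : ℝ) • ∑ a ∈ F, q a + δ • u) < l (q v) := by
  classical
  have hc := hcard F hF
  set cen := (3⁻¹ : ℝ) • ∑ a ∈ F, q a with hcen
  let K : Set (Space3 →L[ℝ] ℝ) :=
    Metric.sphere 0 1 ∩ {l | ∀ w ∈ P.vertices, l (q w) ≤ l (q v)}
  have hKc : IsCompact K := by
    refine (isCompact_sphere _ _).inter_right ?_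
    have : {l : Space3 →L[ℝ] ℝ | ∀ w ∈ P.vertices, l (q w) ≤ l (q v)} =
        ⋂ w ∈ P.vertices, {l | l (q w) ≤ l (q v)} := by ext; simp
    rw [this]
    refine isClosed_biInter fun w _ => isClosed_le ?_ ?_ <;> fun_prop
  have hlt : ∀ l ∈ K, l cen < l (q v) := by
    rintro l ⟨hl1, hl⟩
    have hsum : l cen = 3⁻¹ * ∑ a ∈ F, l (q a) := by simp [hcen]
    by_contra hle
    rw [not_lt, hsum] at hle
    have hle' : ∀ a ∈ F, l (q a) ≤ l (q v) := fun a ha => hl a (face_subset_vertices hF ha)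
    have heq : ∀ a ∈ F, l (q a) = l (q v) := by
      by_contra! hne
      obtain ⟨a, ha, hne⟩ := hne
      have := Finset.sum_lt_sum hle' ⟨a, ha, lt_of_le_of_ne (hle' a ha) hne⟩
      rw [Finset.sum_const, hc] at this
      simp at this
      linarith
    have hl0 : l ≠ 0 := by
      rintro rfl; simp at hl1
    obtain ⟨-, f, hf, hsub⟩ := (hq (P.vertices.filter fun x => ∀ w ∈ P.vertices, l (q w) ≤ l (q x))
      (Finset.filter_subset _ _)).2 ⟨l, hl0, fun x hx => by simp [hx]⟩
    have hFf : F ⊆ f := fun a ha => hsub (Finset.mem_filter.2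
      ⟨face_subset_vertices hF ha, fun w hw => by rw [heq a ha]; exact hl w hw⟩)
    have := Finset.eq_of_subset_of_card_le hFf (by rw [hcard f hf, hc])
    exact hvF (this ▸ hsub (Finset.mem_filter.2 ⟨hv, hl⟩))
  obtain ⟨κ, hκ, hκK⟩ : ∃ κ : ℝ, 0 < κ ∧ ∀ l ∈ K, κ ≤ l (q v) - l cen := by
    rcases K.eq_empty_or_nonempty with h | h
    · exact ⟨1, one_pos, by simp [h]⟩
    · obtain ⟨l, hl, hmin⟩ := hKc.exists_isMinOn h (f := fun l => l (q v) - l cen)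
        (by fun_prop)
      exact ⟨_, sub_pos.2 (hlt l hl), fun l' hl' => hmin hl'⟩
  have h0 : Tendsto (fun δ : ℝ => δ * ‖u‖) (𝓝[>] 0) (𝓝 0) := by
    have : Tendsto (fun δ : ℝ => δ * ‖u‖) (𝓝 0) (𝓝 (0 * ‖u‖)) := by
      exact (continuous_id.mul continuous_const).tendsto 0
    rw [zero_mul] at this
    exact this.mono_left nhdsWithin_le_nhds
  filter_upwards [h0.eventually (gt_mem_nhds hκ), self_mem_nhdsWithin] with δ hδ hδ0 l hl0 hl
  have hn : 0 < ‖l‖ := norm_pos_iff.2 hl0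
  have hmem : ‖l‖⁻¹ • l ∈ K := by
    refine ⟨by simp [norm_smul, hn.ne'], fun w hw => ?_⟩
    simp only [smul_apply, smul_eq_mul]
    exact mul_le_mul_of_nonneg_left (hl w hw) (by positivity)
  have h1 := hκK _ hmem
  simp only [smul_apply, smul_eq_mul] at h1
  rw [← mul_sub, inv_mul_eq_div, le_div_iff₀ hn] at h1
  rw [map_add, map_smul l δ u, smul_eq_mul]
  have h2 : l u ≤ ‖l‖ * ‖u‖ := (le_abs_self _).trans (l.le_opNorm u)
  have h3 : δ * l u ≤ δ * (‖l‖ * ‖u‖) := mul_le_mul_of_nonneg_left h2 (le_of_lt hδ0)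
  have h4 : δ * ‖u‖ * ‖l‖ < κ * ‖l‖ := mul_lt_mul_of_pos_right hδ hn
  nlinarith

-- The new vertex goes just beyond the centroid of `F`, above the plane of `F` and below every other
-- supporting plane that matters. Faces away from `F` and proper faces of `F` survive, `F` itself
-- disappears, and the faces at the new vertex are its joins with proper faces of `F`.
open Filter Topology in
open Classical in
theorem IsRealization.glue (hq : P.IsRealization q) (hcard : ∀ f ∈ P.faces, f.card = 3)
    (hF : F ∈ P.faces) (hV : ∃ x ∈ P.vertices, x ∉ F) {d : Space3} (hd : d ∉ P.vertices)
    (hV' : (P.glue F d).vertices = insert d P.vertices) :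
    ∃ q', (P.glue F d).IsRealization q' := by
  have hFV := face_subset_vertices hF
  have hc := hcard F hF
  have hdF : d ∉ F := fun h => hd (hFV h)
  obtain ⟨x, hxV, hxF⟩ := hV
  obtain ⟨l₀, hl₀, h₀⟩ := hq.exists_exposes hF (S := F) (Finset.card_pos.1 (by omega)) subset_rfl
  obtain ⟨a₀, ha₀⟩ : F.Nonempty := Finset.card_pos.1 (by omega)
  obtain ⟨u, hu⟩ : ∃ u, l₀ u = 1 := by
    obtain ⟨y, hy⟩ : ∃ y, l₀ y ≠ 0 := by
      by_contra! h
      exact hl₀ (ContinuousLinearMap.ext h)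
    exact ⟨(l₀ y)⁻¹ • y, by simp [hy]⟩
  set cen := (3⁻¹ : ℝ) • ∑ a ∈ F, q a with hcen
  -- Two requirements on `δ`: the new point stays below every supporting plane at an old vertex
  -- outside `F` (`hA`), and each proper nonempty subset of `F` keeps some supporting plane above
  -- the new point (`hB`).
  have hA : ∀ᶠ δ in 𝓝[>] (0 : ℝ), ∀ v ∈ P.vertices \ F, ∀ l : Space3 →L[ℝ] ℝ, l ≠ 0 →
      (∀ w ∈ P.vertices, l (q w) ≤ l (q v)) → l (cen + δ • u) < l (q v) := by
    rw [Filter.eventually_all_finset]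
    intro v hv
    rw [Finset.mem_sdiff] at hv
    exact hq.eventually_beneath hcard hF u hv.1 hv.2
  have hB : ∀ᶠ δ in 𝓝[>] (0 : ℝ), ∀ S ∈ F.powerset, S.Nonempty → S ≠ F →
      ∃ l : Space3 →L[ℝ] ℝ, l ≠ 0 ∧ Exposes P.vertices q S l ∧
        ∀ v ∈ S, l (cen + δ • u) < l (q v) := by
    rw [Filter.eventually_all_finset]
    intro S hS
    rw [Finset.mem_powerset] at hS
    by_cases hSn : S.Nonempty
    swap
    · exact Filter.Eventually.of_forall fun δ h => absurd h hSn
    by_cases hSF : S = F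
    · exact Filter.Eventually.of_forall fun δ _ h => absurd hSF h
    obtain ⟨l, hl, hle⟩ := hq.exists_exposes hF hSn hS
    obtain ⟨s, hs⟩ := hSn
    have hSV := hS.trans hFV
    obtain ⟨b, hb, hbS⟩ : ∃ b ∈ F, b ∉ S := by
      by_contra! h
      exact hSF (hS.antisymm h)
    have hlt : l cen < l (q s) := by
      have h1 := Finset.sum_lt_sum (s := F) (f := fun a => l (q a)) (g := fun _ => l (q s))
        (fun a ha => (hle s (hSV hs)).1 hs a (hFV ha)) ⟨b, hb, hle.lt hSV (hFV hb) hbS hs⟩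
      rw [Finset.sum_const, hc] at h1
      simp only [hcen, map_smul, map_sum, smul_eq_mul]
      simp at h1
      linarith
    have ht : Tendsto (fun δ : ℝ => l (cen + δ • u)) (𝓝[>] 0) (𝓝 (l cen)) := by
      have : Tendsto (fun δ : ℝ => l (cen + δ • u)) (𝓝 0) (𝓝 (l (cen + (0 : ℝ) • u))) :=
        Continuous.tendsto (by fun_prop) 0
      rw [zero_smul, add_zero] at this
      exact this.mono_left nhdsWithin_le_nhds
    filter_upwards [ht.eventually (gt_mem_nhds hlt)] with δ hδ _ _
    exact ⟨l, hl, hle, fun v hv => by rwa [hle.eq hSV hv hs]⟩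
  obtain ⟨δ, ⟨hA, hB⟩, hδ⟩ := ((hA.and hB).and self_mem_nhdsWithin).exists
  have hδ : 0 < δ := hδ
  set p := cen + δ • u with hp
  have hp₀ : l₀ p = l₀ (q a₀) + δ := by
    have : ∑ a ∈ F, l₀ (q a) = 3 * l₀ (q a₀) := by
      rw [Finset.sum_congr rfl fun a ha => h₀.eq hFV ha ha₀, Finset.sum_const, hc]; simp
    simp only [hp, hcen, map_add, map_smul, map_sum, smul_eq_mul, this, hu]
    ring
  let q' : Space3 → Space3 := Function.update q d p
  have hqd : q' d = p := Function.update_self _ _ _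
  have hqV : ∀ v ∈ P.vertices, q' v = q v := fun v hv =>
    Function.update_of_ne (ne_of_mem_of_not_mem hv hd) _ _
  refine ⟨q', fun S hS => ?_⟩
  rw [hV'] at hS ⊢
  have hmem := fun h => mem_faces_glue (P := P) (h := h) hc hdF
  have exp_old : ∀ T : Finset Space3, T ⊆ P.vertices → T.Nonempty → ∀ l : Space3 →L[ℝ] ℝ,
      Exposes P.vertices q T l → (∀ v ∈ T, l p < l (q v)) → Exposes (insert d P.vertices) q' T l := by
    intro T hT hTn l hl hlp
    obtain ⟨t, ht⟩ := hTn
    refine exposes_of_eq_of_lt (l (q t)) ⟨t, ht⟩ (hT.trans (Finset.subset_insert _ _)) ?_ ?_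
    · intro v hv
      rw [hqV v (hT hv)]
      exact hl.eq hT hv ht
    · intro v hv hvT
      rcases Finset.mem_insert.1 hv with rfl | hv
      · rw [hqd]; exact hlp t ht
      · rw [hqV v hv]; exact hl.lt hT hv hvT ht
  constructor
  · rintro ⟨hSn, f, hf, hSf⟩
    change ∃ l : Space3 →L[ℝ] ℝ, l ≠ 0 ∧ Exposes (insert d P.vertices) q' S l
    have sub_case : S ⊆ F → S ≠ F → ∃ l : Space3 →L[ℝ] ℝ, l ≠ 0 ∧
        Exposes (insert d P.vertices) q' S l := by
      intro h1 h2
      obtain ⟨l, hl, hle, hlp⟩ := hB S (Finset.mem_powerset.2 h1) hSn h2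
      exact ⟨l, hl, exp_old S (h1.trans hFV) hSn l hle hlp⟩
    rcases (hmem f).1 hf with ⟨hfP, hfF⟩ | ⟨a, ha, rfl⟩
    · by_cases hSF : S ⊆ F
      · refine sub_case hSF ?_
        rintro rfl
        exact hfF (Finset.eq_of_subset_of_card_le hSf (by rw [hcard f hfP, hc])).symm
      · obtain ⟨v, hvS, hvF⟩ := Finset.not_subset.1 hSF
        have hSV := hSf.trans (face_subset_vertices hfP)
        obtain ⟨l, hl, hle⟩ := hq.exists_exposes hfP hSn hSf
        refine ⟨l, hl, exp_old S hSV hSn l hle fun w hw => ?_⟩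
        rw [hle.eq hSV hw hvS]
        exact hA v (Finset.mem_sdiff.2 ⟨hSV hvS, hvF⟩) l hl ((hle v (hSV hvS)).1 hvS)
    · by_cases hdS : d ∈ S
      · have hTF : S.erase d ⊆ F.erase a := Finset.subset_insert_iff.1 hSf
        have haS : a ∉ S.erase d := fun h => by simpa using hTF h
        have key : ∀ (m : ℝ) (l : Space3 →L[ℝ] ℝ), l p = m → (∀ v ∈ S.erase d, l (q v) = m) →
            (∀ v ∈ P.vertices, v ∉ S.erase d → l (q v) < m) → l ≠ 0 ∧
              Exposes (insert d P.vertices) q' S l := by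
          intro m l h1 h2 h3
          refine ⟨?_, exposes_of_eq_of_lt m hSn hS ?_ ?_⟩
          · rintro rfl
            have := h3 a (hFV ha) haS
            simp at this h1
            linarith
          · intro v hv
            by_cases hvd : v = d
            · rw [hvd, hqd, h1]
            · have hv' := Finset.mem_erase.2 ⟨hvd, hv⟩
              rw [hqV v (hFV (Finset.mem_of_mem_erase (hTF hv')))]
              exact h2 v hv'
          · intro v hv hvS
            have hvd : v ≠ d := by rintro rfl; exact hvS hdS
            have hv := Finset.mem_of_mem_insert_of_ne hv hvd
            rw [hqV v hv]
            exact h3 v hv fun h => hvS (Finset.mem_of_mem_erase h)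
        rcases (S.erase d).eq_empty_or_nonempty with hT | ⟨t, ht⟩
        · refine ⟨l₀, key _ l₀ rfl (by simp [hT]) fun v hv _ => ?_⟩
          have := (h₀ a₀ (hFV ha₀)).1 ha₀ v hv
          rw [hp₀]; linarith
        · have hTF' : S.erase d ⊆ F := hTF.trans (Finset.erase_subset _ _)
          have hTV := hTF'.trans hFV
          obtain ⟨l, -, hle, hlp⟩ := hB _ (Finset.mem_powerset.2 hTF') ⟨t, ht⟩
            (fun h => haS (h ▸ ha))
          -- For `l` the new point lies below the level of `S.erase d`, while `l₀` exceeds its level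
          -- on `F` by `δ` at `p`. This multiple of `l₀` lifts `p` exactly to the level of `S.erase
          -- d`, which stays maximal among old vertices since it lies in `F`.
          set θ := (l (q t) - l p) / δ with hθ
          have hθ0 : 0 < θ := div_pos (sub_pos.2 (hlp t ht)) hδ
          have hθδ : θ * δ = l (q t) - l p := div_mul_cancel₀ _ hδ.ne'
          refine ⟨l + θ • l₀, key (l (q t) + θ * l₀ (q a₀)) _ ?_ ?_ ?_⟩
          · simp only [add_apply, smul_apply, smul_eq_mul,
              hp₀, mul_add]
            linarith
          · intro v hv
            simp only [add_apply, smul_apply, smul_eq_mul]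
            rw [hle.eq hTV hv ht, h₀.eq hFV (hTF' hv) ha₀]
          · intro v hv hvT
            simp only [add_apply, smul_apply, smul_eq_mul]
            have h1 := hle.lt hTV hv hvT ht
            have h2 := mul_le_mul_of_nonneg_left ((h₀ a₀ (hFV ha₀)).1 ha₀ v hv) hθ0.le
            linarith
      · have hSF : S ⊆ F.erase a := (Finset.subset_insert_iff_of_notMem hdS).1 hSf
        refine sub_case (hSF.trans (Finset.erase_subset _ _)) ?_
        rintro rfl
        simpa using hSF ha
  · rintro ⟨l, hl, hle⟩
    have hle : Exposes (insert d P.vertices) q' S l := hle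
    have hprop : (∀ v ∈ F, ∀ w ∈ F, l (q v) = l (q w)) → ∃ κ : ℝ, l = κ • l₀ :=
      hq.eq_smul hF hc h₀ hxV hxF
    have hSn : S.Nonempty := by
      obtain ⟨m, hm, hmax⟩ := (insert d P.vertices).exists_max_image (fun v => l (q' v))
        (Finset.insert_nonempty _ _)
      exact ⟨m, (hle m hm).2 hmax⟩
    refine ⟨hSn, ?_⟩
    have new_case : ∀ a ∈ F, S ⊆ insert d (F.erase a) → ∃ f ∈ (P.glue F d).faces, S ⊆ f :=
      fun a ha h => ⟨_, (hmem _).2 (Or.inr ⟨a, ha, rfl⟩), h⟩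
    by_cases hdS : d ∈ S
    · have hSF : S ⊆ insert d F := by
        intro v hv
        by_contra hvn
        rw [Finset.mem_insert, not_or] at hvn
        have hvV := Finset.mem_of_mem_insert_of_ne (hS hv) hvn.1
        have hmaxv := (hle v (hS hv)).1 hv
        have h1 := hA v (Finset.mem_sdiff.2 ⟨hvV, hvn.2⟩) l hl fun w hw => by
          have := hmaxv w (Finset.mem_insert_of_mem hw)
          rwa [hqV w hw, hqV v hvV] at this
        have h2 := hle.eq hS hv hdS
        rw [hqV v hvV, hqd] at h2
        linarith
      -- If `S` contained `F` as well as `d`, then `l` would be constant on `F`, hence a multiple of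
      -- `l₀`, and `l₀` does not take the same value at `p` as on `F`.
      obtain ⟨a, ha, haS⟩ : ∃ a ∈ F, a ∉ S := by
        by_contra! hFS
        obtain ⟨κ, rfl⟩ := hprop fun v hv w hw => by
          have := hle.eq hS (hFS v hv) (hFS w hw)
          rwa [hqV v (hFV hv), hqV w (hFV hw)] at this
        have := hle.eq hS hdS (hFS a₀ ha₀)
        rw [hqd, hqV a₀ (hFV ha₀)] at this
        simp only [smul_apply, smul_eq_mul, hp₀] at this
        have : κ * δ = 0 := by linarith
        rcases mul_eq_zero.1 this with h | h
        · exact hl (by rw [h, zero_smul])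
        · exact hδ.ne' h
      refine new_case a ha fun v hv => ?_
      rcases Finset.mem_insert.1 (hSF hv) with rfl | hvF
      · exact Finset.mem_insert_self _ _
      · exact Finset.mem_insert_of_mem (Finset.mem_erase.2 ⟨fun h => haS (h ▸ hv), hvF⟩)
    · have hSV : S ⊆ P.vertices := (Finset.subset_insert_iff_of_notMem hdS).1 hS
      obtain ⟨s, hs⟩ := hSn
      have hexp : Exposes P.vertices q S l := by
        refine exposes_of_eq_of_lt (l (q s)) ⟨s, hs⟩ hSV (fun v hv => ?_) fun v hv hvS => ?_
        · have := hle.eq hS hv hs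
          rwa [hqV v (hSV hv), hqV s (hSV hs)] at this
        · have := hle.lt hS (Finset.mem_insert_of_mem hv) hvS hs
          rwa [hqV v hv, hqV s (hSV hs)] at this
      obtain ⟨-, f, hf, hSf⟩ := (hq S hSV).2 ⟨l, hl, hexp⟩
      by_cases hfF : f = F
      · subst hfF
        obtain ⟨a, ha, haS⟩ : ∃ a ∈ f, a ∉ S := by
          by_contra! hFS
          have hSF : S = f := hSf.antisymm hFS
          subst hSF
          -- The factor `κ` would have to be negative to keep `p` below `F` and positive to keep `x`
          -- below it.
          obtain ⟨κ, rfl⟩ := hprop fun v hv w hw => hexp.eq hSV hv hw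
          have h1 := hexp.lt hSV hxV hxF ha₀
          have h2 := hle.lt hS (Finset.mem_insert_self _ _) hdS ha₀
          have h3 := h₀.lt hSV hxV hxF ha₀
          rw [hqd, hqV a₀ (hFV ha₀)] at h2
          simp only [smul_apply, smul_eq_mul, hp₀] at h1 h2
          have : κ * δ < 0 := by linarith
          have hκ : κ < 0 := by
            by_contra h
            exact absurd this (not_lt.2 (mul_nonneg (not_lt.1 h) hδ.le))
          nlinarith
        refine new_case a ha fun v hv => Finset.mem_insert_of_mem
          (Finset.mem_erase.2 ⟨fun h => haS (h ▸ hv), hSf hv⟩)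
      · exact ⟨f, (hmem f).2 (Or.inl ⟨hf, hfF⟩), hSf⟩

end step

-- Up to an additive constant, a linear functional can take any prescribed values on the four
-- vertices, so the indicator of a proper nonempty subset exposes it. A functional equal on all four
-- vertices is zero, so the full vertex set is never exposed.
open Classical in
theorem IsRealization.tetrahedron {t : Finset Space3} (hcard : t.card = 4)
    (ht : AffineIndependent ℝ (fun x : t => (x : Space3))) :
    (TriSolid.tetrahedron t).IsRealization id := by
  have hV : (TriSolid.tetrahedron t).vertices = t := by
    ext x
    simp only [vertices, TriSolid.tetrahedron, Finset.mem_biUnion, Finset.mem_powersetCard, id]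
    constructor
    · rintro ⟨f, hf, hx⟩; exact hf.1 hx
    · intro hx
      obtain ⟨f, hxf, hft, hf⟩ := Finset.exists_subsuperset_card_eq (n := 3)
        (Finset.singleton_subset_iff.2 hx) (by simp) (by omega)
      exact ⟨f, ⟨hft, hf⟩, hxf (Finset.mem_singleton_self x)⟩
  let B : AffineBasis t ℝ Space3 := ⟨fun x => (x : Space3), ht, by
    rw [ht.affineSpan_eq_top_iff_card_eq_finrank_add_one]; simp [hcard]⟩
  have hfun : ∀ c : Space3 → ℝ, ∃ (l : Space3 →L[ℝ] ℝ) (m : ℝ), ∀ v ∈ t, l v = c v + m := by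
    intro c
    let A : Space3 →ᵃ[ℝ] ℝ :=
      (∑ x : t, c x • (LinearMap.proj x : (t → ℝ) →ₗ[ℝ] ℝ)).toAffineMap.comp B.coords
    refine ⟨LinearMap.toContinuousLinearMap A.linear, - A 0, fun v hv => ?_⟩
    have h1 : A v = c v := by
      have : A v = ∑ x : t, c x * B.coord x v := by
        simp [A]
      have h3 : ∀ x : t, B.coord x v = if x = ⟨v, hv⟩ then 1 else 0 := fun x =>
        B.coord_apply x ⟨v, hv⟩
      simp [this, h3]
    have h2 := A.linearMap_vsub v 0
    simp only [vsub_eq_sub, sub_zero] at h2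
    simp only [LinearMap.coe_toContinuousLinearMap', h2, h1]
    ring
  have hconst : ∀ l : Space3 →L[ℝ] ℝ, (∀ v ∈ t, ∀ w ∈ t, l v = l w) → l = 0 := by
    intro l hl
    obtain ⟨a, ha⟩ : t.Nonempty := Finset.card_pos.1 (by omega)
    have : l.toLinearMap.toAffineMap = AffineMap.const ℝ Space3 (l a) := by
      refine AffineMap.ext_on B.tot ?_
      rintro _ ⟨x, rfl⟩
      exact hl _ x.2 _ ha
    have h0 : ∀ x, l x = l a := fun x => congrArg (fun f : Space3 →ᵃ[ℝ] ℝ => f x) this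
    ext x
    rw [h0 x, ← h0 0, map_zero]; rfl
  intro S hS
  rw [hV] at hS ⊢
  constructor
  · rintro ⟨hSn, f, hf, hSf⟩
    obtain ⟨hft, hf3⟩ := Finset.mem_powersetCard.1 hf
    obtain ⟨a, ha⟩ : (t \ f).Nonempty := by
      rw [← Finset.card_pos, Finset.card_sdiff_of_subset hft]; omega
    rw [Finset.mem_sdiff] at ha
    have haS : a ∉ S := fun h => ha.2 (hSf h)
    obtain ⟨l, m, hl⟩ := hfun fun v => if v ∈ S then 1 else 0
    refine ⟨l, ?_, exposes_of_eq_of_lt (1 + m) hSn hS (fun v hv => ?_) fun v hv hvS => ?_⟩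
    · rintro rfl
      obtain ⟨s, hs⟩ := hSn
      have h1 := hl s (hS hs)
      have h2 := hl a ha.1
      simp only [hs, haS, if_true, if_false] at h1 h2
      simp at h1 h2
      linarith
    · simp [hl v (hS hv), hv]
    · simp [hl v hv, hvS]
  · rintro ⟨l, hl, hle⟩
    have hle : Exposes t id S l := hle
    obtain ⟨s, hs, hmax⟩ := t.exists_max_image l (Finset.card_pos.1 (by omega))
    refine ⟨⟨s, (hle s hs).2 hmax⟩, ?_⟩
    obtain ⟨a, ha, haS⟩ : ∃ a ∈ t, a ∉ S := by
      by_contra! h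
      have hSt : S = t := hS.antisymm h
      exact hl (hconst l fun v hv w hw => hle.eq hS (hSt ▸ hv) (hSt ▸ hw))
    refine ⟨t.erase a, Finset.mem_powersetCard.2 ⟨Finset.erase_subset _ _, ?_⟩, fun v hv =>
      Finset.mem_erase.2 ⟨fun h => haS (h ▸ hv), hS hv⟩⟩
    rw [Finset.card_erase_of_mem ha, hcard]

open Classical in
theorem Stacked.card_eq_and_subset_body {P : TriSolid} (hP : P.Stacked) :
    (∀ f ∈ P.faces, f.card = 3 ∧ (f : Set Space3) ⊆ P.body) ∧ 4 ≤ P.vertices.card := by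
  induction hP with
  | base t hcard ht =>
    refine ⟨fun f hf => ?_, ?_⟩
    · obtain ⟨hft, hf3⟩ := Finset.mem_powersetCard.1 hf
      exact ⟨hf3, (Finset.coe_subset.2 hft).trans (subset_convexHull ℝ _)⟩
    · rw [← hcard]
      refine Finset.card_le_card fun x hx => ?_
      obtain ⟨f, hxf, hft, hf⟩ := Finset.exists_subsuperset_card_eq (n := 3)
        (Finset.singleton_subset_iff.2 hx) (by simp) (by omega)
      exact Finset.mem_biUnion.2 ⟨f, Finset.mem_powersetCard.2 ⟨hft, hf⟩,
        hxf (Finset.mem_singleton_self x)⟩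
  | step P F d hP h ih =>
    obtain ⟨ih, ih4⟩ := ih
    obtain ⟨hF, hdF, -, -⟩ := h
    have hc := (ih F hF).1
    refine ⟨fun f hf => ?_, ?_⟩
    · rcases (mem_faces_glue hc hdF).1 hf with h | ⟨a, ha, rfl⟩
      · exact ⟨(ih f h.1).1, (ih f h.1).2.trans Set.subset_union_left⟩
      · refine ⟨?_, ?_⟩
        · rw [Finset.card_insert_of_notMem (by simp [hdF]), Finset.card_erase_of_mem ha, hc]
        · refine (Set.Subset.trans ?_ (subset_convexHull ℝ _)).trans Set.subset_union_right
          exact Finset.coe_subset.2 (Finset.insert_subset_insert _ (Finset.erase_subset _ _))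
    · rw [vertices_glue hF hc hdF]
      exact ih4.trans (Finset.card_le_card (Finset.subset_insert _ _))

-- A vertex lies in the body, so an apex that was already a vertex would lie in the triangle `F`,
-- against affine independence.
open Classical in
theorem CanGlue.notMem_vertices {P : TriSolid} {F : Finset Space3} {d : Space3}
    (h : P.CanGlue F d) (hP : P.Stacked) : d ∉ P.vertices := by
  intro hd
  obtain ⟨f, hf, hdf⟩ := Finset.mem_biUnion.1 hd
  obtain ⟨-, hdF, hind, hint⟩ := h
  have h1 : d ∈ convexHull ℝ (F : Set Space3) := by
    rw [← hint]
    exact ⟨subset_convexHull ℝ _ (Finset.mem_coe.2 (Finset.mem_insert_self _ _)),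
      (hP.card_eq_and_subset_body.1 f hf).2 hdf⟩
  rw [Finset.mem_convexHull'] at h1
  obtain ⟨w, -, hw1, hwd⟩ := h1
  rw [affineIndependent_finset_iff] at hind
  have hFd : ∀ v ∈ F, v ≠ d := fun v hv h => hdF (h ▸ hv)
  have e1 : ∀ v ∈ F, (if v = d then (-1 : ℝ) else w v) = w v := fun v hv => if_neg (hFd v hv)
  have := hind (fun v => if v = d then -1 else w v) (by
    rw [Finset.sum_insert hdF, Finset.sum_congr rfl e1, hw1]; simp) (by
    rw [Finset.sum_insert hdF, Finset.sum_congr rfl fun v hv => congrArg (· • v) (e1 v hv), hwd]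
    simp) d (Finset.mem_insert_self _ _)
  simp at this

/-- Every stacked solid is combinatorially equivalent to a convex polytope. -/
theorem Stacked.isTopologicallyConvex {P : TriSolid} (hP : P.Stacked) :
    P.IsTopologicallyConvex := by
  induction hP with
  | base t hcard ht => exact ⟨id, IsRealization.tetrahedron hcard ht⟩
  | step P F d hP h ih =>
    classical
    obtain ⟨q, hq⟩ := ih
    obtain ⟨hf, h4⟩ := hP.card_eq_and_subset_body
    have hq : P.IsRealization q := hq
    have hc := (hf F h.1).1
    refine hq.glue (fun f h => (hf f h).1) h.1 ?_ (h.notMem_vertices hP)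
      (vertices_glue h.1 hc h.2.1)
    by_contra! hsub
    have := Finset.card_le_card hsub
    omega

end TriSolid

/-! ### Areas of sectors and angle sums of nonoverlapping triangles. -/

open MeasureTheory in
theorem lintegral_Ioo_ofReal_id {r : ℝ} (hr : 0 ≤ r) :
    ∫⁻ x in Set.Ioo 0 r, ENNReal.ofReal x = ENNReal.ofReal (r ^ 2 / 2) := by
  have hi : IntegrableOn (fun x : ℝ => x) (Set.Ioo 0 r) :=
    (continuous_id.integrableOn_Icc (a := 0) (b := r)).mono_set Set.Ioo_subset_Icc_self
  rw [← ofReal_integral_eq_lintegral_ofReal hi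
    ((ae_restrict_iff' measurableSet_Ioo).2 (Filter.Eventually.of_forall fun x hx => hx.1.le)),
    ← integral_Ioc_eq_integral_Ioo, ← intervalIntegral.integral_of_le hr, integral_id]
  congr 1; ring

open MeasureTheory in
/-- A lower bound for the area of a circular sector. -/
theorem sector_volume_ge {r θ : ℝ} (hr : 0 ≤ r) (hθ : θ ≤ Real.pi) {S : Set ℂ}
    (hS : MeasurableSet S)
    (h : ∀ ρ φ : ℝ, 0 < ρ → ρ < r → 0 < φ → φ < θ →
      (ρ * (Real.cos φ + Real.sin φ * Complex.I) : ℂ) ∈ S) :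
    ENNReal.ofReal (θ * r ^ 2 / 2) ≤ volume S := by
  rw [← lintegral_indicator_one hS, ← Complex.lintegral_comp_polarCoord_symm]
  have hsub : Set.Ioo 0 r ×ˢ Set.Ioo 0 θ ⊆ polarCoord.target := by
    rintro ⟨ρ, φ⟩ ⟨h1, h2⟩
    rw [polarCoord_target]
    exact ⟨h1.1, (neg_lt_zero.2 Real.pi_pos).trans h2.1, h2.2.trans_le hθ⟩
  refine le_trans ?_ (lintegral_mono_set hsub)
  have : ∀ p ∈ Set.Ioo 0 r ×ˢ Set.Ioo 0 θ,
      ENNReal.ofReal p.1 • S.indicator (1 : ℂ → ENNReal) (Complex.polarCoord.symm p) =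
        ENNReal.ofReal p.1 := by
    rintro ⟨ρ, φ⟩ ⟨h1, h2⟩
    rw [Complex.polarCoord_symm_apply, Set.indicator_of_mem]
    · simp
    · simpa using h ρ φ h1.1 h1.2 h2.1 h2.2
  rw [setLIntegral_congr_fun (measurableSet_Ioo.prod measurableSet_Ioo) this,
    Measure.volume_eq_prod, ← Measure.prod_restrict,
    lintegral_prod (fun p : ℝ × ℝ => ENNReal.ofReal p.1) (by fun_prop)]
  simp only [lintegral_const, Measure.restrict_apply_univ, Real.volume_Ioo, sub_zero]
  rw [lintegral_mul_const _ (by fun_prop), lintegral_Ioo_ofReal_id hr,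
    ← ENNReal.ofReal_mul (by positivity)]
  apply ENNReal.ofReal_le_ofReal
  linarith

/-- Any two vectors can be put into standard position by an isometry onto `ℂ`. -/
theorem exists_isometry_standard {u : Plane2} (hu : u ≠ 0) (v : Plane2) :
    ∃ ψ : Plane2 ≃ₗᵢ[ℝ] ℂ, ψ u = (‖u‖ : ℂ) ∧ 0 ≤ (ψ v).im := by
  let φ : Plane2 ≃ₗᵢ[ℝ] ℂ := Complex.orthonormalBasisOneI.repr.symm
  have hφu : φ u ≠ 0 := by simpa using hu
  have hn : ‖φ u‖ = ‖u‖ := φ.norm_map u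
  have hn0 : (‖u‖ : ℂ) ≠ 0 := by simpa using hu
  let a : Circle := ⟨(starRingEnd ℂ) (φ u) / ‖u‖, by
    simp [Submonoid.unitSphere, hn, hu]⟩
  have ha : rotation a (φ u) = (‖u‖ : ℂ) := by
    rw [rotation_apply]
    change (starRingEnd ℂ) (φ u) / ‖u‖ * φ u = _
    rw [div_mul_eq_mul_div, mul_comm, Complex.mul_conj, Complex.normSq_eq_norm_sq, hn]
    field_simp
    push_cast; ring
  by_cases him : 0 ≤ (rotation a (φ v)).im
  · exact ⟨φ.trans (rotation a), ha, him⟩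
  · refine ⟨(φ.trans (rotation a)).trans Complex.conjLIE, ?_, ?_⟩
    · simp only [LinearIsometryEquiv.trans_apply, ha, Complex.conjLIE_apply, Complex.conj_ofReal]
    · simp only [LinearIsometryEquiv.trans_apply, Complex.conjLIE_apply, Complex.conj_im]
      linarith

open MeasureTheory InnerProductGeometry in
/-- Near a corner, a triangle contains a circular sector. -/
theorem exists_sector (p : Plane2) {u v : Plane2} (h0 : 0 < angle u v) (hpi : angle u v < Real.pi)
    (hu : u ≠ 0) (hv : v ≠ 0) :
    ∃ R : ℝ, 0 < R ∧ ∀ r, 0 < r → r < R → ∃ S ⊆ Metric.ball (0 : Plane2) r, MeasurableSet S ∧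
      ENNReal.ofReal (angle u v * r ^ 2 / 2) ≤ volume S ∧
      ∀ w ∈ S, p + w ∈ interior (convexHull ℝ {p, p + u, p + v}) := by
  obtain ⟨ψ, hψu, hψv⟩ := exists_isometry_standard hu v
  set z := ψ v with hz
  set θ := angle u v with hθ
  have hup : 0 < ‖u‖ := norm_pos_iff.2 hu
  have hvp : 0 < ‖v‖ := norm_pos_iff.2 hv
  have hre : z.re = ‖v‖ * Real.cos θ := by
    have h1 : inner ℝ (ψ u) (ψ v) = inner ℝ u v := ψ.inner_map_map u v
    rw [hψu, ← hz, Complex.inner, ← cos_angle_mul_norm_mul_norm u v, ← hθ] at h1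
    simp at h1
    refine mul_left_cancel₀ hup.ne' ?_
    linarith
  have hsin : 0 < Real.sin θ := Real.sin_pos_of_pos_of_lt_pi h0 hpi
  have him : z.im = ‖v‖ * Real.sin θ := by
    have h1 : ‖z‖ ^ 2 = ‖v‖ ^ 2 := by rw [hz, ψ.norm_map]
    rw [← Complex.normSq_eq_norm_sq, Complex.normSq_apply, hre] at h1
    have h2 := Real.sin_sq_add_cos_sq θ
    have h3 : z.im ^ 2 = (‖v‖ * Real.sin θ) ^ 2 := by
      have : ‖v‖ ^ 2 * (Real.sin θ ^ 2 + Real.cos θ ^ 2) = ‖v‖ ^ 2 := by rw [h2, mul_one]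
      nlinarith
    exact (pow_left_inj₀ hψv (by positivity) two_ne_zero).1 h3
  have himp : 0 < z.im := by rw [him]; positivity
  -- For points of norm below `r` in the sector, `r * C` bounds the sum of the two coordinates with
  -- respect to `u` and `v`, so `r * C < 1` keeps them inside the triangle.
  set C := (z.im + |z.re|) / (‖u‖ * z.im) + 1 / z.im with hC
  have hC0 : 0 < C := by positivity
  refine ⟨1 / C, by positivity, fun r hr hrR => ?_⟩
  have hrC : r * C < 1 := by rwa [lt_div_iff₀ hC0] at hrR
  -- With `ψ u` on the positive real axis, the first two inequalities say that both coordinates with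
  -- respect to `ψ u` and `z` are positive.
  set S₀ : Set ℂ := {w | 0 < w.im ∧ w.im * z.re < w.re * z.im ∧ ‖w‖ < r} with hS₀
  have hS₀o : IsOpen S₀ := by
    exact (isOpen_lt continuous_const Complex.continuous_im).inter
      ((isOpen_lt (Complex.continuous_im.mul continuous_const)
        (Complex.continuous_re.mul continuous_const)).inter
          (isOpen_lt continuous_norm continuous_const))
  have hSo : IsOpen (ψ ⁻¹' S₀) := hS₀o.preimage ψ.continuous
  refine ⟨ψ ⁻¹' S₀, fun w hw => ?_, hSo.measurableSet, ?_, fun w hw => ?_⟩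
  · have := hw.2.2
    rw [ψ.norm_map] at this
    simpa using this
  · rw [ψ.measurePreserving.measure_preimage hS₀o.measurableSet.nullMeasurableSet]
    refine sector_volume_ge hr.le hpi.le hS₀o.measurableSet fun ρ φ h1 h2 h3 h4 => ?_
    have hφ : 0 < Real.sin φ := Real.sin_pos_of_pos_of_lt_pi h3 (h4.trans hpi)
    have hd : 0 < Real.sin (θ - φ) :=
      Real.sin_pos_of_pos_of_lt_pi (by linarith) (by linarith)
    rw [Real.sin_sub] at hd
    refine ⟨?_, ?_, ?_⟩
    · simp [-Complex.ofReal_cos, -Complex.ofReal_sin]; positivity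
    · simp only [Complex.mul_im, Complex.mul_re, Complex.add_im, Complex.add_re,
        Complex.ofReal_re, Complex.ofReal_im, Complex.I_re, Complex.I_im, hre, him]
      have : 0 < ρ * ‖v‖ * (Real.sin θ * Real.cos φ - Real.cos θ * Real.sin φ) := by positivity
      nlinarith
    · rw [Complex.ofReal_cos, Complex.ofReal_sin, norm_mul, Complex.norm_cos_add_sin_mul_I]
      simpa [abs_of_pos h1] using h2
  · rw [mem_interior]
    refine ⟨(fun x => x - p) ⁻¹' (ψ ⁻¹' S₀), fun x hx => ?_, hSo.preimage (by fun_prop), by simpa⟩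
    obtain ⟨k1, k2, k3⟩ := hx
    set w := ψ (x - p) with hw
    set β := w.im / z.im with hβ
    set α := (w.re * z.im - w.im * z.re) / (‖u‖ * z.im) with hα
    have hβ0 : 0 < β := div_pos k1 himp
    have hα0 : 0 < α := div_pos (by linarith) (by positivity)
    have hx : x - p = α • u + β • v := by
      apply ψ.injective
      rw [map_add, map_smul, map_smul, hψu, ← hz, ← hw]
      have e1 : α * ‖u‖ * z.im = w.re * z.im - w.im * z.re := by
        rw [hα]; field_simp
      have e2 : β * z.im = w.im := by rw [hβ]; field_simp
      clear_value α β
      apply Complex.ext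
      · simp only [Complex.add_re, Complex.smul_re, Complex.ofReal_re, smul_eq_mul]
        refine mul_right_cancel₀ himp.ne' ?_
        rw [add_mul, e1, ← e2]; ring
      · simp [e2]
    have hle : α + β < 1 := by
      refine lt_of_le_of_lt ?_ hrC
      have e1 := (Complex.abs_re_le_norm w).trans k3.le
      have e2 := (Complex.abs_im_le_norm w).trans k3.le
      have e3 : w.re * z.im ≤ r * z.im :=
        mul_le_mul_of_nonneg_right ((le_abs_self _).trans e1) himp.le
      have e4 : -(w.im * z.re) ≤ r * |z.re| := by
        refine (neg_le_abs _).trans ?_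
        rw [abs_mul]
        exact mul_le_mul_of_nonneg_right e2 (abs_nonneg _)
      rw [hC, mul_add, mul_div_assoc', mul_div_assoc', mul_one]
      refine add_le_add ?_ ?_
      · exact div_le_div_of_nonneg_right (by linarith) (by positivity)
      · exact div_le_div_of_nonneg_right ((le_abs_self _).trans e2) himp.le
    have hxe : x = ∑ i : Fin 3, (![1 - α - β, α, β] i) • (![p, p + u, p + v] i) := by
      rw [Fin.sum_univ_three]
      simp only [Matrix.cons_val_zero, Matrix.cons_val_one, Matrix.cons_val_two,
        Matrix.head_cons, Matrix.tail_cons]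
      rw [← sub_eq_zero, ← sub_eq_zero.2 hx]
      module
    rw [hxe]
    refine (convex_convexHull ℝ _).sum_mem (fun i _ => ?_) ?_ (fun i _ => subset_convexHull ℝ _ ?_)
    · fin_cases i
      · simp; linarith
      · exact hα0.le
      · exact hβ0.le
    · rw [Fin.sum_univ_three]; simp; ring
    · fin_cases i <;> simp

open MeasureTheory InnerProductGeometry in
/-- Nonoverlapping triangles with a common corner have angle sum at most `2π`. -/
theorem sum_angle_le_two_pi_plane {ι : Type*} (s : Finset ι) (p : Plane2) (u v : ι → Plane2)
    (h0 : ∀ i ∈ s, 0 < angle (u i) (v i)) (hpi : ∀ i ∈ s, angle (u i) (v i) < Real.pi)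
    (hu : ∀ i ∈ s, u i ≠ 0) (hv : ∀ i ∈ s, v i ≠ 0)
    (hd : ∀ i ∈ s, ∀ j ∈ s, i ≠ j → Disjoint (interior (convexHull ℝ {p, p + u i, p + v i}))
      (interior (convexHull ℝ {p, p + u j, p + v j}))) :
    ∑ i ∈ s, angle (u i) (v i) ≤ 2 * Real.pi := by
  have hex : ∀ i : ι, ∃ R : ℝ, 0 < R ∧ (i ∈ s → ∀ r, 0 < r → r < R →
      ∃ S ⊆ Metric.ball (0 : Plane2) r, MeasurableSet S ∧
      ENNReal.ofReal (angle (u i) (v i) * r ^ 2 / 2) ≤ volume S ∧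
      ∀ w ∈ S, p + w ∈ interior (convexHull ℝ {p, p + u i, p + v i})) := by
    intro i
    by_cases hi : i ∈ s
    · obtain ⟨R, hR, h⟩ := exists_sector p (h0 i hi) (hpi i hi) (hu i hi) (hv i hi)
      exact ⟨R, hR, fun _ => h⟩
    · exact ⟨1, one_pos, fun h => absurd h hi⟩
  choose R hR hS using hex
  -- A common radius puts all sectors into one disc, of area `π * r ^ 2`.
  obtain ⟨r, hr, hrR⟩ : ∃ r, 0 < r ∧ ∀ i ∈ s, r < R i := by
    have : ∀ᶠ r in nhdsWithin (0 : ℝ) (Set.Ioi 0), ∀ i ∈ s, r < R i := by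
      rw [Filter.eventually_all_finset]
      exact fun i _ => nhdsWithin_le_nhds (gt_mem_nhds (hR i))
    obtain ⟨r, h1, h2⟩ := (this.and self_mem_nhdsWithin).exists
    exact ⟨r, h2, h1⟩
  choose! S hSb hSm hSv hSi using fun i hi => hS i hi r hr (hrR i hi)
  have hdisj : (s : Set ι).PairwiseDisjoint S := by
    intro i hi j hj hij
    rw [Function.onFun, Set.disjoint_left]
    intro w hwi hwj
    exact Set.disjoint_left.1 (hd i hi j hj hij) (hSi i hi w hwi) (hSi j hj w hwj)
  have hvol : volume (⋃ i ∈ s, S i) ≤ volume (Metric.ball (0 : Plane2) r) :=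
    measure_mono (Set.iUnion₂_subset hSb)
  rw [measure_biUnion_finset hdisj hSm, EuclideanSpace.volume_ball_fin_two,
    ← ENNReal.ofReal_pow hr.le, ← ENNReal.ofReal_mul (by positivity)] at hvol
  have h1 := (Finset.sum_le_sum hSv).trans hvol
  rw [← ENNReal.ofReal_sum_of_nonneg fun i hi => by
      have := (h0 i hi).le
      positivity,
    ENNReal.ofReal_le_ofReal_iff (by positivity), ← Finset.sum_div, ← Finset.sum_mul] at h1
  have h2 : 0 < r ^ 2 := by positivity
  have h3 : (∑ i ∈ s, angle (u i) (v i)) * r ^ 2 ≤ (2 * Real.pi) * r ^ 2 := by linarith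
  exact le_of_mul_le_mul_right h3 h2

open InnerProductGeometry in
theorem angle_eq_of_norm_eq {V W : Type*} [NormedAddCommGroup V] [InnerProductSpace ℝ V]
    [NormedAddCommGroup W] [InnerProductSpace ℝ W] {u v : V} {u' v' : W} (h1 : ‖u‖ = ‖u'‖)
    (h2 : ‖v‖ = ‖v'‖) (h3 : ‖u - v‖ = ‖u' - v'‖) : angle u v = angle u' v' := by
  unfold angle
  rw [real_inner_eq_norm_mul_self_add_norm_mul_self_sub_norm_sub_mul_self_div_two,
    real_inner_eq_norm_mul_self_add_norm_mul_self_sub_norm_sub_mul_self_div_two, h1, h2, h3]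

open EuclideanGeometry in
/-- Nonoverlapping congruent placements of triangles in the plane, in which a common corner of the
triangles goes to the same point, have angle sum at most `2π` at this corner. -/
theorem sum_angle_le_two_pi {ι : Type*} (s : Finset ι) (x : Space3) (y z : ι → Space3)
    (A : ι → (Space3 →ᵃ[ℝ] Plane2)) (p : Plane2) (hp : ∀ i ∈ s, A i x = p)
    (h0 : ∀ i ∈ s, ¬ Collinear ℝ {y i, x, z i})
    (hiso : ∀ i ∈ s, ∀ a ∈ convexHull ℝ {x, y i, z i}, ∀ b ∈ convexHull ℝ {x, y i, z i},
      dist (A i a) (A i b) = dist a b)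
    (hd : ∀ i ∈ s, ∀ j ∈ s, i ≠ j → Disjoint (interior (A i '' convexHull ℝ {x, y i, z i}))
      (interior (A j '' convexHull ℝ {x, y j, z j}))) :
    ∑ i ∈ s, ∠ (y i) x (z i) ≤ 2 * Real.pi := by
  have hx : ∀ i, x ∈ convexHull ℝ {x, y i, z i} := fun i => subset_convexHull ℝ _ (by simp)
  have hy : ∀ i, y i ∈ convexHull ℝ {x, y i, z i} := fun i => subset_convexHull ℝ _ (by simp)
  have hz : ∀ i, z i ∈ convexHull ℝ {x, y i, z i} := fun i => subset_convexHull ℝ _ (by simp)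
  have hang : ∀ i ∈ s, ∠ (y i) x (z i) =
      InnerProductGeometry.angle (A i (y i) - p) (A i (z i) - p) := by
    intro i hi
    rw [EuclideanGeometry.angle]
    have e1 := hiso i hi _ (hy i) _ (hx i)
    have e2 := hiso i hi _ (hz i) _ (hx i)
    have e3 := hiso i hi _ (hy i) _ (hz i)
    rw [dist_eq_norm, dist_eq_norm] at e1 e2 e3
    rw [hp i hi] at e1 e2
    refine angle_eq_of_norm_eq e1.symm e2.symm ?_
    rw [vsub_eq_sub, vsub_eq_sub, sub_sub_sub_cancel_right, sub_sub_sub_cancel_right, e3]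
  have hne : ∀ i ∈ s, ∀ a ∈ convexHull ℝ {x, y i, z i}, a ≠ x → A i a - p ≠ 0 := by
    intro i hi a ha hax h
    have := hiso i hi a ha x (hx i)
    rw [hp i hi, dist_eq_norm, h, norm_zero] at this
    exact hax (dist_eq_zero.1 this.symm)
  have himg : ∀ i ∈ s, A i '' convexHull ℝ {x, y i, z i} =
      convexHull ℝ {p, p + (A i (y i) - p), p + (A i (z i) - p)} := by
    intro i hi
    rw [AffineMap.image_convexHull, Set.image_insert_eq, Set.image_pair, hp i hi]
    simp
  rw [Finset.sum_congr rfl hang]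
  refine sum_angle_le_two_pi_plane s p _ _ (fun i hi => ?_) (fun i hi => ?_) (fun i hi => ?_)
    (fun i hi => ?_) (fun i hi j hj hij => ?_)
  · rw [← hang i hi]; exact angle_pos_of_not_collinear (h0 i hi)
  · rw [← hang i hi]; exact angle_lt_pi_of_not_collinear (h0 i hi)
  · refine hne i hi _ (hy i) fun h => h0 i hi ?_
    rw [h]; simp [collinear_pair]
  · refine hne i hi _ (hz i) fun h => h0 i hi ?_
    rw [h]; simp [collinear_pair]
  · rw [← himg i hi, ← himg j hj]
    exact hd i hi j hj hij

/-! ### Angle conditions and the shape of flat hats. -/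

open EuclideanGeometry InnerProductGeometry in
/-- The angle conditions on a stacked hat: at each of `d`, `e`, `f`, the angles of the brim and band
triangles together with that of either crown triangle exceed a full turn. -/
structure HatAngles (a b c d e f g : Space3) : Prop where
  d_e : 2 * Real.pi < ∠ a d b + ∠ a d c + ∠ b d e + ∠ c d f + ∠ e d g
  d_f : 2 * Real.pi < ∠ a d b + ∠ a d c + ∠ b d e + ∠ c d f + ∠ f d g
  e_d : 2 * Real.pi < ∠ b e c + ∠ b e d + ∠ c e f + ∠ d e g
  e_f : 2 * Real.pi < ∠ b e c + ∠ b e d + ∠ c e f + ∠ f e g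
  f_d : 2 * Real.pi < ∠ c f d + ∠ c f e + ∠ d f g
  f_e : 2 * Real.pi < ∠ c f d + ∠ c f e + ∠ e f g

/-- Linear independence of three vectors, in terms of coefficients. -/
def LinIndep3 (a b c : Space3) : Prop :=
  ∀ x y z : ℝ, x • a + y • b + z • c = 0 → x = 0 ∧ y = 0 ∧ z = 0

/-- `d` is a convex combination of `a`, `b`, `c` with positive coefficients `x`, `y`, `z`. -/
structure IsInner (a b c d : Space3) (x y z : ℝ) : Prop where
  x_pos : 0 < x
  y_pos : 0 < y
  z_pos : 0 < z
  sum_eq : x + y + z = 1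
  eq : d = x • a + y • b + z • c

namespace InnerProductGeometry
variable {V : Type*} [NormedAddCommGroup V] [InnerProductSpace ℝ V]

theorem angle_add_angle_of_combination {x y z : V} {k l : ℝ} (hk : 0 ≤ k) (hl : 0 ≤ l)
    (hy : y ≠ 0) (h : y = k • x + l • z) : angle x z = angle x y + angle y z := by
  refine angle_eq_angle_add_add_angle_add_of_mem_span hy ?_
  rw [Submodule.mem_span_pair]
  exact ⟨⟨k, hk⟩, ⟨l, hl⟩, by rw [h]; rfl⟩

theorem angle_sum_eq_two_pi {u v w : V} {α β γ : ℝ} (hα : 0 < α) (hβ : 0 < β) (hγ : 0 < γ)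
    (hw : w ≠ 0) (h : α • u + β • v + γ • w = 0) :
    angle u v + angle v w + angle w u = 2 * Real.pi := by
  have h1 : -w = (γ⁻¹ * α) • u + (γ⁻¹ * β) • v := by
    rw [mul_smul, mul_smul, ← smul_add, eq_neg_of_add_eq_zero_left h, smul_neg, smul_smul,
      inv_mul_cancel₀ hγ.ne', one_smul]
  have h2 := angle_add_angle_of_combination (by positivity) (by positivity) (neg_ne_zero.2 hw) h1
  rw [angle_neg_right, angle_neg_left, angle_comm u w, angle_comm w v] at h2
  linarith

theorem angle_lt_of_cos_lt {u v u' v' : V}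
    (h : Real.cos (angle u' v') < Real.cos (angle u v)) : angle u v < angle u' v' :=
  (Real.strictAntiOn_cos.lt_iff_gt ⟨angle_nonneg _ _, angle_le_pi _ _⟩
    ⟨angle_nonneg _ _, angle_le_pi _ _⟩).1 h

theorem angle_lt_of_inner {u v u' v' : V} (hu : u ≠ 0) (hv : v ≠ 0)
    (h : 0 < inner ℝ u v) (h' : inner ℝ u' v' ≤ 0) : angle u v < angle u' v' := by
  refine angle_lt_of_cos_lt ?_
  rw [cos_angle, cos_angle]
  exact (div_nonpos_of_nonpos_of_nonneg h' (by positivity)).trans_lt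
    (div_pos h (by positivity))

end InnerProductGeometry

section
variable {a b c d : Space3} {x y z : ℝ}

theorem IsInner.linIndep3 (hd : IsInner a b c d x y z) (h : LinIndep3 a b c) : LinIndep3 b c d := by
  intro p q r hr
  rw [hd.eq] at hr
  obtain ⟨h1, h2, h3⟩ := h (r * x) (p + r * y) (q + r * z) (by rw [← hr]; module)
  have : r = 0 := (mul_eq_zero.1 h1).resolve_right hd.x_pos.ne'
  subst this
  simpa using And.intro h2 h3

theorem IsInner.ne_left (hd : IsInner a b c d x y z) (h : LinIndep3 a b c) : a ≠ d := by
  intro he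
  have := (h (x - 1) y z (by
    have := hd.eq
    rw [← he] at this
    rw [sub_smul, one_smul]; nth_rewrite 2 [this]; module)).2.1
  exact hd.y_pos.ne' this

theorem IsInner.rotate (hd : IsInner a b c d x y z) : IsInner b c a d y z x :=
  ⟨hd.y_pos, hd.z_pos, hd.x_pos, by linarith [hd.sum_eq], by rw [hd.eq]; abel⟩

theorem LinIndep3.rotate (h : LinIndep3 a b c) : LinIndep3 b c a := by
  intro p q r hr
  obtain ⟨h1, h2, h3⟩ := h r p q (by rw [← hr]; abel)
  exact ⟨h2, h3, h1⟩

theorem LinIndep3.swap (h : LinIndep3 a b c) : LinIndep3 a c b := by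
  intro p q r hr
  obtain ⟨h1, h2, h3⟩ := h p r q (by rw [← hr]; abel)
  exact ⟨h1, h3, h2⟩

theorem IsInner.smul_ne (hd : IsInner a b c d x y z) (h : LinIndep3 a b c) (t : ℝ) (ht : t ≠ 0) :
    t • d ≠ a := by
  intro he
  rw [hd.eq] at he
  have := (h (t * x - 1) (t * y) (t * z) (by
    rw [sub_smul, one_smul]; nth_rewrite 2 [← he]; module)).2.1
  exact mul_ne_zero ht hd.y_pos.ne' this

open EuclideanGeometry in
/-- The angles around an interior point of a triangle. -/
theorem IsInner.angle_sum (hd : IsInner a b c d x y z) (h : LinIndep3 a b c) :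
    ∠ a d b + ∠ b d c + ∠ c d a = 2 * Real.pi := by
  refine InnerProductGeometry.angle_sum_eq_two_pi hd.x_pos hd.y_pos hd.z_pos
    (vsub_ne_zero.2 (hd.rotate.rotate.ne_left h.rotate.rotate)) ?_
  simp only [vsub_eq_sub]
  have h1 := hd.sum_eq
  have h2 : x • (a - d) + y • (b - d) + z • (c - d) =
      (x • a + y • b + z • c) - (x + y + z) • d := by module
  rw [h2, h1, ← hd.eq, one_smul, sub_self]

open EuclideanGeometry in
/-- The ray from a corner of a triangle through an interior point splits the angle. -/
theorem IsInner.angle_add (hd : IsInner a b c d x y z) (h : LinIndep3 a b c) :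
    ∠ a c b = ∠ a c d + ∠ d c b := by
  refine InnerProductGeometry.angle_add_angle_of_combination hd.x_pos.le hd.y_pos.le
    (vsub_ne_zero.2 (hd.rotate.rotate.ne_left h.rotate.rotate).symm) ?_
  simp only [vsub_eq_sub]
  have h1 : z = 1 - x - y := by linarith [hd.sum_eq]
  rw [hd.eq, h1]
  module

end

open EuclideanGeometry in
/-- A flat hat with a suitable crown satisfies the angle conditions. -/
theorem hatAngles_of_flat {a b c d e f g : Space3} {p₁ p₂ p₃ q₁ q₂ q₃ r₁ r₂ r₃ : ℝ}
    (h : LinIndep3 a b c) (hd : IsInner a b c d p₁ p₂ p₃) (he : IsInner b c d e q₁ q₂ q₃)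
    (hf : IsInner c d e f r₁ r₂ r₃)
    (d_e : ∠ e d f < ∠ e d g) (d_f : ∠ e d f < ∠ f d g) (e_d : ∠ d e f < ∠ d e g)
    (e_f : ∠ d e f < ∠ f e g) (f_d : ∠ d f e < ∠ d f g) (f_e : ∠ d f e < ∠ e f g) :
    HatAngles a b c d e f g := by
  have h1 := hd.linIndep3 h
  have h2 := he.linIndep3 h1
  -- In the flat position the full turn around each of d, e, f consists of its brim and band angles
  -- and one angle of the triangle def, after splitting along the rays to the inner points.
  -- Replacing that last angle by a larger crown angle exceeds 2π.
  have sd := hd.angle_sum h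
  have se := he.angle_sum h1
  have sf := hf.angle_sum h2
  have ad := he.angle_add h1
  have ad' := hf.rotate.rotate.angle_add h2.rotate.rotate
  have ae := hf.angle_add h2
  rw [angle_comm c d a] at sd
  rw [angle_comm d e b] at se
  rw [angle_comm e f c] at sf
  rw [angle_comm e d c] at ad
  rw [angle_comm e d c, angle_comm f d c] at ad'
  rw [angle_comm f e d] at ae
  constructor <;> linarith

open InnerProductGeometry Filter Topology in
theorem eventually_lt_angle {y p : Space3} (k : Space3) (hy : y ≠ 0) (hp : p ≠ 0) {θ : ℝ}
    (hθ : θ < angle y p) : ∀ᶠ s in 𝓝[>] (0 : ℝ), θ < angle y (p + s • k) := by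
  have h1 : ContinuousAt (fun s : ℝ => angle y (p + s • k)) 0 := by
    have h2 : ContinuousAt (fun s : ℝ => (y, p + s • k)) 0 := by fun_prop
    have h3 : p + (0 : ℝ) • k ≠ 0 := by rwa [zero_smul, add_zero]
    have h4 := continuousAt_angle (x := (y, p + (0 : ℝ) • k)) hy h3
    exact ContinuousAt.comp (f := fun s : ℝ => (y, p + s • k))
      (g := fun q : Space3 × Space3 => angle q.1 q.2) h4 h2
  have h3 : Tendsto (fun s : ℝ => angle y (p + s • k)) (𝓝[>] 0) (𝓝 (angle y p)) := by
    have := h1.tendsto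
    rw [zero_smul, add_zero] at this
    exact this.mono_left nhdsWithin_le_nhds
  exact h3.eventually (lt_mem_nhds hθ)

open Filter Topology in
theorem eventually_mul_lt (x : ℝ) {y : ℝ} (hy : 0 < y) : ∀ᶠ s in 𝓝[>] (0 : ℝ), s * x < y := by
  have h1 : Tendsto (fun s : ℝ => s * x) (𝓝[>] 0) (𝓝 0) := by
    have h2 : Tendsto (fun s : ℝ => s * x) (𝓝 0) (𝓝 (0 * x)) :=
      (continuous_id.mul continuous_const).tendsto 0
    rw [zero_mul] at h2
    exact h2.mono_left nhdsWithin_le_nhds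
  exact h1.eventually (gt_mem_nhds hy)

open InnerProductGeometry in
/-- Angles of a crown base `0, L • m - w, L • m + w` and of the triangles of a long spike in the
direction `p` over it. -/
structure IsCrownShape (p m w : Space3) (L : ℝ) : Prop where
  u_ne : L • m - w ≠ 0
  v_ne : L • m + w ≠ 0
  w_ne : w ≠ 0
  D1 : angle (L • m - w) (L • m + w) < angle (L • m - w) p
  D2 : angle (L • m - w) (L • m + w) < angle (L • m + w) p
  E1 : angle (-(L • m - w)) w < angle (-(L • m - w)) p
  E2 : angle (-(L • m - w)) w < angle w p
  F1 : angle (-(L • m + w)) (-w) < angle (-(L • m + w)) p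
  F2 : angle (-(L • m + w)) (-w) < angle (-w) p

-- The base is a long isosceles triangle with axis `m` and half-side `w`, where `w` has the length
-- of `m` and is perpendicular to both `m` and `p`. For large `L` the angle at the tip tends to 0,
-- while the angles of its legs with `p` tend to the angle of `m` and `p`, positive because `‖m‖ <
-- ‖p‖`. At the other two corners the base angle is acute, whereas `p` makes an obtuse angle with
-- the leg and a right angle with the short side. The further bounds on `L` serve to place the base
-- inside the triangle `b c p`.
open InnerProductGeometry Filter in
theorem exists_crown_shape {b c p m : Space3} {β γ : ℝ} (hI : LinIndep3 b c p) (hβ : 0 < β)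
    (hγ : 0 < γ) (hm : m = β • (b - p) + γ • (c - p)) (hcm : 0 < inner ℝ (c - p) m)
    (hbp : inner ℝ (b - p) p = inner ℝ (b - p) m) (hcp : inner ℝ (c - p) p = inner ℝ (c - p) m)
    (hlt : ‖m‖ < ‖p‖) :
    ∃ (w : Space3) (L X Y : ℝ), 0 < L ∧ 0 < X ∧ 0 < Y ∧ X < L * Y ∧ 1 < L * (γ * Y) ∧
      c - p = X • m + Y • w ∧ IsCrownShape p m w L := by
  have hm0 : m ≠ 0 := by rintro rfl; simp at hcm
  set μ := ‖m‖ with hμ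
  have hμ0 : 0 < μ := norm_pos_iff.2 hm0
  have hmm : inner ℝ m m = μ ^ 2 := real_inner_self_eq_norm_sq m
  have hind : ∀ x y : ℝ, x • (b - p) + y • (c - p) = 0 → x = 0 ∧ y = 0 := by
    intro x y h
    obtain ⟨h1, h2, -⟩ := hI x y (-x - y) (by rw [← h]; module)
    exact ⟨h1, h2⟩
  set X := inner ℝ (c - p) m / μ ^ 2 with hX
  have hX0 : 0 < X := by positivity
  have hXm : X * μ ^ 2 = inner ℝ (c - p) m := by rw [hX]; field_simp
  set w' := (c - p) - X • m with hw'
  have hw'm : inner ℝ w' m = 0 := by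
    rw [hw', inner_sub_left, real_inner_smul_left, hmm, hXm, sub_self]
  have hw'0 : w' ≠ 0 := by
    intro h
    have h1 := hind (-(X * β)) (1 - X * γ) (by rw [← h, hw', hm]; module)
    have h2 : X * β = 0 := by linarith [h1.1]
    exact (mul_pos hX0 hβ).ne' h2
  set Y := ‖w'‖ / μ with hY
  have hY0 : 0 < Y := div_pos (norm_pos_iff.2 hw'0) hμ0
  set w := Y⁻¹ • w' with hw
  have hcY : c - p = X • m + Y • w := by
    rw [hw, smul_smul, mul_inv_cancel₀ hY0.ne', hw']; module
  have hwn : ‖w‖ = μ := by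
    rw [hw, norm_smul, norm_inv, Real.norm_of_nonneg hY0.le, hY]
    have := norm_pos_iff.2 hw'0
    field_simp
  have hww : inner ℝ w w = μ ^ 2 := by rw [real_inner_self_eq_norm_sq, hwn]
  have hwm : inner ℝ w m = 0 := by rw [hw, real_inner_smul_left, hw'm, mul_zero]
  have hmw : inner ℝ m w = 0 := by rw [real_inner_comm, hwm]
  have hmp : inner ℝ m p = μ ^ 2 := by
    have : inner ℝ m p = inner ℝ m m := by
      conv_lhs => rw [hm]
      conv_rhs => rw [hm]
      rw [inner_add_left, inner_add_left, real_inner_smul_left, real_inner_smul_left, hbp, hcp,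
        real_inner_smul_left, real_inner_smul_left, ← hm]
    rw [this, hmm]
  have hwp : inner ℝ w p = 0 := by
    rw [hw, hw', real_inner_smul_left, inner_sub_left, real_inner_smul_left, hcp, hmp, ← hXm]
    ring
  have hw0 : w ≠ 0 := by rw [← norm_pos_iff, hwn]; exact hμ0
  have hp0 : 0 < ‖p‖ := hμ0.trans hlt
  have hp0' : p ≠ 0 := norm_pos_iff.1 hp0
  clear_value μ X Y w
  -- the shape of the crown base
  obtain ⟨L, hL1, hL2, hL3, hL4⟩ : ∃ L : ℝ, 1 < L ∧ X / Y < L ∧ 1 / (γ * Y) < L ∧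
      ‖p‖ / (‖p‖ - μ) < L := by
    have := ((eventually_gt_atTop (1 : ℝ)).and (eventually_gt_atTop (X / Y))).and
      ((eventually_gt_atTop (1 / (γ * Y))).and (eventually_gt_atTop (‖p‖ / (‖p‖ - μ))))
    obtain ⟨L, ⟨h1, h2⟩, h3, h4⟩ := this.exists
    exact ⟨L, h1, h2, h3, h4⟩
  rw [div_lt_iff₀ hY0] at hL2
  rw [div_lt_iff₀ (by positivity)] at hL3
  rw [div_lt_iff₀ (by linarith)] at hL4
  have hL0 : 0 < L := by linarith
  set u := L • m - w with hu
  set v := L • m + w with hv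
  have huu : inner ℝ u u = (L ^ 2 + 1) * μ ^ 2 := by
    rw [hu]
    simp only [inner_sub_left, inner_sub_right, real_inner_smul_left, real_inner_smul_right, hmm,
      hww, hmw, hwm]
    ring
  have hvv : inner ℝ v v = (L ^ 2 + 1) * μ ^ 2 := by
    rw [hv]
    simp only [inner_add_left, inner_add_right, real_inner_smul_left, real_inner_smul_right, hmm,
      hww, hmw, hwm]
    ring
  have huv : inner ℝ u v = (L ^ 2 - 1) * μ ^ 2 := by
    rw [hu, hv]
    simp only [inner_add_right, inner_sub_left, real_inner_smul_left, real_inner_smul_right, hmm,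
      hww, hmw, hwm]
    ring
  have hup : inner ℝ u p = L * μ ^ 2 := by
    rw [hu, inner_sub_left, real_inner_smul_left, hmp, hwp, sub_zero]
  have hvp : inner ℝ v p = L * μ ^ 2 := by
    rw [hv, inner_add_left, real_inner_smul_left, hmp, hwp, add_zero]
  have huw : inner ℝ u w = -μ ^ 2 := by
    rw [hu, inner_sub_left, real_inner_smul_left, hmw, hww]; ring
  have hvw : inner ℝ v w = μ ^ 2 := by
    rw [hv, inner_add_left, real_inner_smul_left, hmw, hww]; ring
  have hpos : 0 < (L ^ 2 + 1) * μ ^ 2 := by positivity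
  have hu0 : u ≠ 0 := by rintro h; rw [h, inner_zero_left] at huu; linarith
  have hv0 : v ≠ 0 := by rintro h; rw [h, inner_zero_left] at hvv; linarith
  have hNuv : ‖u‖ = ‖v‖ := by
    rw [← pow_left_inj₀ (norm_nonneg _) (norm_nonneg _) two_ne_zero,
      ← real_inner_self_eq_norm_sq, ← real_inner_self_eq_norm_sq, huu, hvv]
  have hNu : 0 < ‖u‖ := norm_pos_iff.2 hu0
  have hNle : ‖u‖ ≤ (L + 1) * μ := by
    refine (norm_sub_le _ _).trans ?_
    rw [norm_smul, Real.norm_of_nonneg hL0.le, ← hμ, hwn]; linarith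
  have hNsq : ‖u‖ * ‖u‖ = (L ^ 2 + 1) * μ ^ 2 := by
    rw [← huu, real_inner_self_eq_norm_sq]; ring
  -- After clearing denominators this follows from `‖u‖ ≤ (L + 1) * μ` and the last bound on `L`,
  -- which says `L * μ < (L - 1) * ‖p‖`.
  have hcosd : L * μ ^ 2 / (‖u‖ * ‖p‖) < (L ^ 2 - 1) * μ ^ 2 / (‖u‖ * ‖u‖) := by
    rw [div_lt_div_iff₀ (by positivity) (by positivity)]
    have h1 : L * ‖u‖ < (L ^ 2 - 1) * ‖p‖ := by
      have h2 : L * μ < (L - 1) * ‖p‖ := by linarith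
      have h3 : L * ‖u‖ ≤ L * ((L + 1) * μ) := mul_le_mul_of_nonneg_left hNle hL0.le
      have h4 := mul_lt_mul_of_pos_left h2 (show 0 < L + 1 by linarith)
      nlinarith
    have h2 := mul_lt_mul_of_pos_right h1 (show 0 < μ ^ 2 * ‖u‖ by positivity)
    linarith
  have D1 : angle u v < angle u p := angle_lt_of_cos_lt (by
    rw [cos_angle, cos_angle, huv, hup, ← hNuv]; exact hcosd)
  have D2 : angle u v < angle v p := angle_lt_of_cos_lt (by
    rw [cos_angle, cos_angle, huv, hvp, ← hNuv]; exact hcosd)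
  have hμ2 : 0 < μ ^ 2 := by positivity
  have hLμ : 0 < L * μ ^ 2 := by positivity
  have E1 : angle (-u) w < angle (-u) p := angle_lt_of_inner (neg_ne_zero.2 hu0) hw0
    (by rw [inner_neg_left, huw]; linarith) (by rw [inner_neg_left, hup]; linarith)
  have E2 : angle (-u) w < angle w p := angle_lt_of_inner (neg_ne_zero.2 hu0) hw0
    (by rw [inner_neg_left, huw]; linarith) hwp.le
  have F1 : angle (-v) (-w) < angle (-v) p := angle_lt_of_inner (neg_ne_zero.2 hv0)
    (neg_ne_zero.2 hw0) (by rw [inner_neg_neg, hvw]; linarith)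
    (by rw [inner_neg_left, hvp]; linarith)
  have F2 : angle (-v) (-w) < angle (-w) p := angle_lt_of_inner (neg_ne_zero.2 hv0)
    (neg_ne_zero.2 hw0) (by rw [inner_neg_neg, hvw]; linarith)
    (by rw [inner_neg_left, hwp, neg_zero])
  exact ⟨w, L, X, Y, hL0, hX0, hY0, hL2, hL3, hcY, hu0, hv0, hw0, D1, D2, E1, E2, F1, F2⟩

open scoped EuclideanGeometry in
open InnerProductGeometry Filter Topology in
/-- Existence of a flat hat over a triangle `abc`: `p` is a point of the triangle, `m` the component
of `p` in the direction of the plane. -/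
theorem exists_flat_hat {b c p m : Space3} {β γ : ℝ} (hI : LinIndep3 b c p) (hβ : 0 < β)
    (hγ : 0 < γ) (hm : m = β • (b - p) + γ • (c - p)) (hcm : 0 < inner ℝ (c - p) m)
    (hbp : inner ℝ (b - p) p = inner ℝ (b - p) m) (hcp : inner ℝ (c - p) p = inner ℝ (c - p) m)
    (hlt : ‖m‖ < ‖p‖) :
    ∃ (e f : Space3) (q₁ q₂ q₃ r₁ r₂ r₃ : ℝ), IsInner b c p e q₁ q₂ q₃ ∧
      IsInner c p e f r₁ r₂ r₃ ∧
      (∠ e p f < ∠ e p ((2 / 3 : ℝ) • (p + e + f)) ∧ ∠ e p f < ∠ f p ((2 / 3 : ℝ) • (p + e + f))) ∧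
      (∠ p e f < ∠ p e ((2 / 3 : ℝ) • (p + e + f)) ∧ ∠ p e f < ∠ f e ((2 / 3 : ℝ) • (p + e + f))) ∧
      (∠ p f e < ∠ p f ((2 / 3 : ℝ) • (p + e + f)) ∧
        ∠ p f e < ∠ e f ((2 / 3 : ℝ) • (p + e + f))) := by
  have hp0' : p ≠ 0 := norm_pos_iff.1 ((norm_nonneg m).trans_lt hlt)
  obtain ⟨w, L, X, Y, hL0, hX0, hY0, hL2, hL3, hcY, hu0, hv0, hw0, D1, D2, E1, E2, F1, F2⟩ :=
    exists_crown_shape hI hβ hγ hm hcm hbp hcp hlt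
  set u := L • m - w with hu
  set v := L • m + w with hv
  -- Seen from `p`, the spike apex over the base scaled by `s` is `p + s • kd`. As `s` tends to 0
  -- all spike edges take the direction `p`, so the strict inequalities of the crown shape hold for
  -- small `s`.
  set kd := (4 * L / 3) • m with hkd
  obtain ⟨s, ⟨⟨⟨⟨⟨⟨⟨⟨hs1, hs2⟩, hs3⟩, hs4⟩, hs5⟩, hs6⟩, hs7⟩, hs8⟩, hs0⟩⟩ :=
    (((((((((eventually_lt_angle kd hu0 hp0' D1).and (eventually_lt_angle kd hv0 hp0' D2)).and
      (eventually_lt_angle (kd - u) (neg_ne_zero.2 hu0) hp0' E1)).and (eventually_lt_angle (kd - u) hw0 hp0' E2)).and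
      (eventually_lt_angle (kd - v) (neg_ne_zero.2 hv0) hp0' F1)).and
      (eventually_lt_angle (kd - v) (neg_ne_zero.2 hw0) hp0' F2)).and
      (eventually_mul_lt (β * (L + X / Y) + (L * γ - (1 - X * γ) / Y)) one_pos)).and
      (eventually_mul_lt L hX0)).and self_mem_nhdsWithin).exists
  have hs0 : 0 < s := hs0
  set D := L * Y + X with hD
  have hD0 : 0 < D := by positivity
  have hg : (2 / 3 : ℝ) • (p + (p + s • u) + (p + s • v)) = (2 : ℝ) • p + s • kd := by
    rw [hkd, hu, hv]; module
  -- The barycentric coordinates come from writing `u` in terms of `b - p` and `c - p`, and `v` in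
  -- terms of `c - p` and `u`. The two extra smallness conditions on `s` make the `p`-coordinates of
  -- the two points positive.
  refine ⟨p + s • u, p + s • v, s * (β * (L + X / Y)), s * (L * γ - (1 - X * γ) / Y),
    1 - s * (β * (L + X / Y) + (L * γ - (1 - X * γ) / Y)), s * (2 * L / D),
    2 * X / D - s * (2 * L / D), (L * Y - X) / D, ⟨?_, ?_, ?_, ?_, ?_⟩, ⟨?_, ?_, ?_, ?_, ?_⟩,
    ⟨?_, ?_⟩, ⟨?_, ?_⟩, ⟨?_, ?_⟩⟩
  · positivity
  · refine mul_pos hs0 ?_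
    rw [sub_pos, div_lt_iff₀ hY0]
    nlinarith [mul_pos hX0 hγ]
  · linarith
  · ring
  · have hwe : w = Y⁻¹ • ((c - p) - X • m) := by
      rw [hcY, add_sub_cancel_left, smul_smul, inv_mul_cancel₀ hY0.ne', one_smul]
    rw [hu, hwe, hm]
    match_scalars <;> field_simp <;> ring
  · positivity
  · rw [sub_pos, ← mul_div_assoc]
    apply div_lt_div_of_pos_right _ hD0
    linarith
  · exact div_pos (by linarith) hD0
  · rw [hD]; field_simp; ring
  · have hce : c = p + (X • m + Y • w) := by rw [← hcY]; abel
    rw [hce, hv, hu]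
    match_scalars <;> field_simp <;> rw [hD] <;> ring
  all_goals
    rw [hg]
    simp only [EuclideanGeometry.angle, vsub_eq_sub]
  · rw [show p + s • u - p = s • u by abel, show p + s • v - p = s • v by abel,
      show (2 : ℝ) • p + s • kd - p = p + s • kd by module,
      angle_smul_left_of_pos _ _ hs0, angle_smul_right_of_pos _ _ hs0,
      angle_smul_left_of_pos _ _ hs0]
    exact hs1
  · rw [show p + s • u - p = s • u by abel, show p + s • v - p = s • v by abel,
      show (2 : ℝ) • p + s • kd - p = p + s • kd by module,
      angle_smul_left_of_pos _ _ hs0, angle_smul_right_of_pos _ _ hs0,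
      angle_smul_left_of_pos _ _ hs0]
    exact hs2
  · rw [show p - (p + s • u) = s • (-u) by module,
      show p + s • v - (p + s • u) = (s * 2) • w by rw [hu, hv]; module,
      show (2 : ℝ) • p + s • kd - (p + s • u) = p + s • (kd - u) by module,
      angle_smul_left_of_pos _ _ hs0, angle_smul_right_of_pos _ _ (by positivity),
      angle_smul_left_of_pos _ _ hs0]
    exact hs3
  · rw [show p - (p + s • u) = s • (-u) by module,
      show p + s • v - (p + s • u) = (s * 2) • w by rw [hu, hv]; module,
      show (2 : ℝ) • p + s • kd - (p + s • u) = p + s • (kd - u) by module,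
      angle_smul_left_of_pos _ _ hs0, angle_smul_right_of_pos _ _ (by positivity),
      angle_smul_left_of_pos _ _ (by positivity)]
    exact hs4
  · rw [show p - (p + s • v) = s • (-v) by module,
      show p + s • u - (p + s • v) = (s * 2) • (-w) by rw [hu, hv]; module,
      show (2 : ℝ) • p + s • kd - (p + s • v) = p + s • (kd - v) by module,
      angle_smul_left_of_pos _ _ hs0, angle_smul_right_of_pos _ _ (by positivity),
      angle_smul_left_of_pos _ _ hs0]
    exact hs5
  · rw [show p - (p + s • v) = s • (-v) by module,
      show p + s • u - (p + s • v) = (s * 2) • (-w) by rw [hu, hv]; module,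
      show (2 : ℝ) • p + s • kd - (p + s • v) = p + s • (kd - v) by module,
      angle_smul_left_of_pos _ _ hs0, angle_smul_right_of_pos _ _ (by positivity),
      angle_smul_left_of_pos _ _ (by positivity)]
    exact hs6

/-! ### Radial perturbations, and a hat over every triangle. -/

/-- Flat positions `p`, `e`, `f` of the vertices of a hat over `abc`, all of whose small radial
perturbations satisfy the angle conditions. -/
def HasHat (a b c : Space3) : Prop :=
  ∃ (p e f : Space3) (p₁ p₂ p₃ q₁ q₂ q₃ r₁ r₂ r₃ η : ℝ), IsInner a b c p p₁ p₂ p₃ ∧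
    IsInner b c p e q₁ q₂ q₃ ∧ IsInner c p e f r₁ r₂ r₃ ∧ 0 < η ∧
    ∀ t₁ t₂ t₃ t₄ : ℝ, |t₁ - 1| < η → |t₂ - 1| < η → |t₃ - 1| < η → |t₄ - 2| < η →
      HatAngles a b c (t₁ • p) (t₂ • e) (t₃ • f) (t₄ • (3⁻¹ : ℝ) • (p + e + f))

open scoped EuclideanGeometry in
theorem ContinuousAt.euclideanAngle {T : Type*} [TopologicalSpace T] {f g h : T → Space3} {t : T}
    (hf : ContinuousAt f t) (hg : ContinuousAt g t) (hh : ContinuousAt h t) (h1 : f t ≠ g t)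
    (h2 : h t ≠ g t) : ContinuousAt (fun s => ∠ (f s) (g s) (h s)) t :=
  ContinuousAt.comp (f := fun s => (f s, g s, h s))
    (g := fun q : Space3 × Space3 × Space3 => ∠ q.1 q.2.1 q.2.2)
    (EuclideanGeometry.continuousAt_angle (x := (f t, g t, h t)) h1 h2)
    (hf.prodMk (hg.prodMk hh))

open scoped EuclideanGeometry in
open Filter Topology in
theorem hatAngles_eventually {T : Type*} [TopologicalSpace T] {a b c : Space3}
    {d e f g : T → Space3} {t : T} (h : HatAngles a b c (d t) (e t) (f t) (g t))
    (hd : ContinuousAt d t) (he : ContinuousAt e t) (hf : ContinuousAt f t) (hg : ContinuousAt g t)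
    (ad : a ≠ d t) (bd : b ≠ d t) (cd : c ≠ d t) (be : b ≠ e t) (ce : c ≠ e t) (de : d t ≠ e t)
    (cf : c ≠ f t) (df : d t ≠ f t) (ef : e t ≠ f t) (gd : g t ≠ d t) (ge : g t ≠ e t)
    (gf : g t ≠ f t) : ∀ᶠ s in 𝓝 t, HatAngles a b c (d s) (e s) (f s) (g s) := by
  have ha : ContinuousAt (fun _ : T => a) t := continuousAt_const
  have hb : ContinuousAt (fun _ : T => b) t := continuousAt_const
  have hc : ContinuousAt (fun _ : T => c) t := continuousAt_const
  have d0 := (((ha.euclideanAngle hd hb ad bd).add (ha.euclideanAngle hd hc ad cd)).add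
    (hb.euclideanAngle hd he bd de.symm)).add (hc.euclideanAngle hd hf cd df.symm)
  have e0 := ((hb.euclideanAngle he hc be ce).add (hb.euclideanAngle he hd be de)).add
    (hc.euclideanAngle he hf ce ef.symm)
  have f0 := (hc.euclideanAngle hf hd cf df).add (hc.euclideanAngle hf he cf ef)
  filter_upwards [(d0.add (he.euclideanAngle hd hg de.symm gd)).eventually (lt_mem_nhds h.d_e),
    (d0.add (hf.euclideanAngle hd hg df.symm gd)).eventually (lt_mem_nhds h.d_f),
    (e0.add (hd.euclideanAngle he hg de ge)).eventually (lt_mem_nhds h.e_d),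
    (e0.add (hf.euclideanAngle he hg ef.symm ge)).eventually (lt_mem_nhds h.e_f),
    (f0.add (hd.euclideanAngle hf hg df gf)).eventually (lt_mem_nhds h.f_d),
    (f0.add (he.euclideanAngle hf hg ef gf)).eventually (lt_mem_nhds h.f_e)]
    with s h1 h2 h3 h4 h5 h6
  exact ⟨h1, h2, h3, h4, h5, h6⟩

-- Strict angle inequalities persist nearby because the vertices involved are distinct in the flat
-- position. The apex there is twice the centroid of `p, e, f`, which is why its scaling parameter
-- stays near 2 and the others near 1.
open scoped EuclideanGeometry in
theorem hasHat_of_flat {a b c p e f : Space3} {p₁ p₂ p₃ q₁ q₂ q₃ r₁ r₂ r₃ : ℝ}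
    (hI : LinIndep3 a b c) (hp : IsInner a b c p p₁ p₂ p₃) (he : IsInner b c p e q₁ q₂ q₃)
    (hf : IsInner c p e f r₁ r₂ r₃)
    (h : HatAngles a b c p e f ((2 / 3 : ℝ) • (p + e + f))) : HasHat a b c := by
  have h1 := hp.linIndep3 hI
  have h2 := he.linIndep3 h1
  have h3 := hf.linIndep3 h2
  refine ⟨p, e, f, p₁, p₂, p₃, q₁, q₂, q₃, r₁, r₂, r₃, ?_⟩
  have hg : IsInner p e f ((3⁻¹ : ℝ) • (p + e + f)) 3⁻¹ 3⁻¹ 3⁻¹ :=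
    ⟨by norm_num, by norm_num, by norm_num, by norm_num, by module⟩
  have ev := hatAngles_eventually (T := ℝ × ℝ × ℝ × ℝ) (a := a) (b := b) (c := c)
    (d := fun t => t.1 • p) (e := fun t => t.2.1 • e) (f := fun t => t.2.2.1 • f)
    (g := fun t => t.2.2.2 • (3⁻¹ : ℝ) • (p + e + f)) (t := (1, 1, 1, 2)) (by
      simp only [one_smul]
      convert h using 1
      module) (by fun_prop) (by fun_prop) (by fun_prop) (by fun_prop)
    (by simpa using hp.ne_left hI) (by simpa using hp.rotate.ne_left hI.rotate)
    (by simpa using hp.rotate.rotate.ne_left hI.rotate.rotate)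
    (by simpa using he.ne_left h1) (by simpa using he.rotate.ne_left h1.rotate)
    (by simpa using he.rotate.rotate.ne_left h1.rotate.rotate)
    (by simpa using hf.ne_left h2) (by simpa using hf.rotate.ne_left h2.rotate)
    (by simpa using hf.rotate.rotate.ne_left h2.rotate.rotate)
    (by simpa only [one_smul] using hg.smul_ne h3 2 two_ne_zero)
    (by simpa only [one_smul] using hg.rotate.smul_ne h3.rotate 2 two_ne_zero)
    (by simpa only [one_smul] using hg.rotate.rotate.smul_ne h3.rotate.rotate 2 two_ne_zero)
  obtain ⟨η, hη, hball⟩ := Metric.eventually_nhds_iff.1 ev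
  refine ⟨η, hp, he, hf, hη, fun t₁ t₂ t₃ t₄ k1 k2 k3 k4 => ?_⟩
  exact hball (y := (t₁, t₂, t₃, t₄)) (by
    simp only [Prod.dist_eq, Real.dist_eq]
    exact max_lt k1 (max_lt k2 (max_lt k3 k4)))

/-- A hat exists over `abc` once the coordinate of `a` of the foot of the perpendicular from the
origin is largest. -/
theorem hasHat_of_max {a b c n : Space3} (hI : LinIndep3 a b c) (ha : inner ℝ n a = 1)
    (hb : inner ℝ n b = 1) (hc : inner ℝ n c = 1) {x y z : ℝ}
    (hx : (‖n‖ ^ 2)⁻¹ • n = x • a + y • b + z • c) (hy : y ≤ x) (hz : z ≤ x) :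
    HasHat a b c ∨ HasHat a c b := by
  have hn0 : n ≠ 0 := by rintro rfl; simp at ha
  have hn : 0 < ‖n‖ ^ 2 := by have := norm_pos_iff.2 hn0; positivity
  set x₀ := (‖n‖ ^ 2)⁻¹ • n with hx₀
  have hsum : x + y + z = 1 := by
    have h1 : inner ℝ n x₀ = 1 := by
      rw [hx₀, real_inner_smul_right, real_inner_self_eq_norm_sq, inv_mul_cancel₀ hn.ne']
    rw [hx, inner_add_right, inner_add_right, real_inner_smul_right, real_inner_smul_right,
      real_inner_smul_right, ha, hb, hc] at h1
    linarith
  have hx0 : 0 < x := by linarith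
  -- Making the weights of `b` and `c` larger than that of `a` turns `y ≤ x`, `z ≤ x` and `0 < x`
  -- into strict positivity of the coefficients of `m` below: they are `x` times the weight ratio
  -- 3/2, minus `y` or `z`. At the centroid they could vanish.
  set p : Space3 := (1 / 4 : ℝ) • a + (3 / 8 : ℝ) • b + (3 / 8 : ℝ) • c with hp
  have hpI : IsInner a b c p (1 / 4) (3 / 8) (3 / 8) :=
    ⟨by norm_num, by norm_num, by norm_num, by norm_num, rfl⟩
  have hpI' : IsInner a c b p (1 / 4) (3 / 8) (3 / 8) :=
    ⟨by norm_num, by norm_num, by norm_num, by norm_num, by rw [hp]; abel⟩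
  have hnp : inner ℝ n p = 1 := by
    rw [hp, inner_add_right, inner_add_right, real_inner_smul_right, real_inner_smul_right,
      real_inner_smul_right, ha, hb, hc]; norm_num
  set m := p - x₀ with hm
  have hperp : ∀ v : Space3, inner ℝ n v = 1 → inner ℝ (v - p) p = inner ℝ (v - p) m := by
    intro v hv
    have h0 : inner ℝ (v - p) n = 0 := by
      rw [real_inner_comm, inner_sub_right, hv, hnp, sub_self]
    rw [hm, inner_sub_right, hx₀, real_inner_smul_right, h0, mul_zero, sub_zero]
  have hlt : ‖m‖ < ‖p‖ := by
    have h1 : ‖m‖ ^ 2 = ‖p‖ ^ 2 - (‖n‖ ^ 2)⁻¹ := by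
      rw [hm, norm_sub_sq_real, hx₀, real_inner_smul_right, real_inner_comm, hnp, norm_smul,
        mul_pow, norm_inv, norm_pow, norm_norm]
      field_simp
      ring
    have h2 : 0 < (‖n‖ ^ 2)⁻¹ := inv_pos.2 hn
    exact lt_of_pow_lt_pow_left₀ 2 (norm_nonneg _) (by linarith)
  set β := 3 / 2 * x - y with hβ
  set γ := 3 / 2 * x - z with hγ
  have hβ0 : 0 < β := by linarith
  have hγ0 : 0 < γ := by linarith
  have hmβ : m = β • (b - p) + γ • (c - p) := by
    rw [hm, hx, hp, hβ, hγ]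
    match_scalars <;> linarith
  have hm0 : m ≠ 0 := by
    intro h
    obtain ⟨h1, -, -⟩ := (hpI.linIndep3 hI) β γ (-β - γ) (by rw [← h, hmβ]; module)
    exact hβ0.ne' h1
  have hmm : 0 < β * inner ℝ (b - p) m + γ * inner ℝ (c - p) m := by
    have : inner ℝ m m = β * inner ℝ (b - p) m + γ * inner ℝ (c - p) m := by
      conv_lhs => rw [hmβ]
      rw [inner_add_left, real_inner_smul_left, real_inner_smul_left, ← hmβ]
    rw [← this]; exact real_inner_self_pos.2 hm0
  by_cases hcm : 0 < inner ℝ (c - p) m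
  · left
    obtain ⟨e, f, q₁, q₂, q₃, r₁, r₂, r₃, he, hf, ⟨k1, k2⟩, ⟨k3, k4⟩, k5, k6⟩ :=
      exists_flat_hat (hpI.linIndep3 hI) hβ0 hγ0 hmβ hcm (hperp b hb) (hperp c hc) hlt
    exact hasHat_of_flat hI hpI he hf (hatAngles_of_flat hI hpI he hf k1 k2 k3 k4 k5 k6)
  · right
    have hbm : 0 < inner ℝ (b - p) m := by
      by_contra hbm
      nlinarith [mul_nonneg hβ0.le (neg_nonneg.2 (not_lt.1 hbm)),
        mul_nonneg hγ0.le (neg_nonneg.2 (not_lt.1 hcm))]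
    obtain ⟨e, f, q₁, q₂, q₃, r₁, r₂, r₃, he, hf, ⟨k1, k2⟩, ⟨k3, k4⟩, k5, k6⟩ :=
      exists_flat_hat (hpI'.linIndep3 hI.swap) hγ0 hβ0 ((add_comm _ _).trans hmβ.symm).symm hbm
        (hperp c hc) (hperp b hb) hlt
    exact hasHat_of_flat hI.swap hpI' he hf
      (hatAngles_of_flat hI.swap hpI' he hf k1 k2 k3 k4 k5 k6)

open Classical in
/-- Over every triangle whose plane misses the origin there is a hat, for a suitable labelling. -/
theorem exists_hasHat {F : Finset Space3} (hF : F.card = 3)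
    (hI : ∀ c : Space3 → ℝ, ∑ v ∈ F, c v • v = 0 → ∀ v ∈ F, c v = 0) :
    ∃ a b c, F = {a, b, c} ∧ LinIndep3 a b c ∧ HasHat a b c := by
  obtain ⟨a, b, c, hab, hac, hbc, rfl⟩ := Finset.card_eq_three.1 hF
  have hI3 : LinIndep3 a b c := by
    intro x y z h
    have e : ∀ w : Space3 → ℝ, ∑ v ∈ ({a, b, c} : Finset Space3), w v • v =
        w a • a + w b • b + w c • c := fun w => by
      rw [Finset.sum_insert (by simp [hab, hac]), Finset.sum_pair hbc, add_assoc]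
    have := hI (fun v => if v = a then x else if v = b then y else z) (by
      rw [e]; simpa [hab.symm, hac.symm, hbc.symm] using h)
    have h1 := this a (by simp)
    have h2 := this b (by simp)
    have h3 := this c (by simp)
    simp only [hab.symm, hac.symm, hbc.symm, if_true, if_false] at h1 h2 h3
    exact ⟨h1, h2, h3⟩
  have hli : LinearIndependent ℝ ![a, b, c] := by
    rw [Fintype.linearIndependent_iff]
    intro g hg
    rw [Fin.sum_univ_three] at hg
    obtain ⟨h1, h2, h3⟩ := hI3 _ _ _ hg
    intro i; fin_cases i <;> assumption
  let B := basisOfLinearIndependentOfCardEqFinrank hli (by simp)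
  have hB : ∀ i, B i = ![a, b, c] i := fun i => by simp [B]
  let l : Space3 →L[ℝ] ℝ := LinearMap.toContinuousLinearMap (B.constr ℝ fun _ => (1 : ℝ))
  let n : Space3 := (InnerProductSpace.toDual ℝ Space3).symm l
  have hn : ∀ i, inner ℝ n (![a, b, c] i) = 1 := fun i => by
    rw [InnerProductSpace.toDual_symm_apply, ← hB]
    simp [l, B.constr_basis]
  have na : inner ℝ n a = 1 := hn 0
  have nb : inner ℝ n b = 1 := hn 1
  have nc : inner ℝ n c = 1 := hn 2
  obtain ⟨x, y, z, hx⟩ : ∃ x y z : ℝ, (‖n‖ ^ 2)⁻¹ • n = x • a + y • b + z • c := by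
    have := B.sum_repr ((‖n‖ ^ 2)⁻¹ • n)
    rw [Fin.sum_univ_three, hB, hB, hB] at this
    exact ⟨_, _, _, this.symm⟩
  -- The labels are permuted so that the largest coordinate of the foot of the perpendicular belongs
  -- to the first corner.
  rcases le_total y x with h1 | h1
  · rcases le_total z x with h2 | h2
    · rcases hasHat_of_max hI3 na nb nc hx h1 h2 with h | h
      · exact ⟨a, b, c, rfl, hI3, h⟩
      · exact ⟨a, c, b, by rw [Finset.pair_comm b c], hI3.swap, h⟩
    · have hr : ({a, b, c} : Finset Space3) = {c, a, b} := by
        ext; simp only [Finset.mem_insert, Finset.mem_singleton]; tauto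
      rcases hasHat_of_max hI3.rotate.rotate nc na nb (x := z) (y := x) (z := y)
        (by rw [hx]; abel) h2 (h1.trans h2) with h | h
      · exact ⟨c, a, b, hr, hI3.rotate.rotate, h⟩
      · exact ⟨c, b, a, by rw [hr, Finset.pair_comm a b], hI3.rotate.rotate.swap, h⟩
  · rcases le_total z y with h2 | h2
    · have hr : ({a, b, c} : Finset Space3) = {b, c, a} := by
        ext; simp only [Finset.mem_insert, Finset.mem_singleton]; tauto
      rcases hasHat_of_max hI3.rotate nb nc na (x := y) (y := z) (z := x)
        (by rw [hx]; abel) h2 h1 with h | h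
      · exact ⟨b, c, a, hr, hI3.rotate, h⟩
      · exact ⟨b, a, c, by rw [hr, Finset.pair_comm c a], hI3.rotate.swap, h⟩
    · have hr : ({a, b, c} : Finset Space3) = {c, a, b} := by
        ext; simp only [Finset.mem_insert, Finset.mem_singleton]; tauto
      rcases hasHat_of_max hI3.rotate.rotate nc na nb (x := z) (y := x) (z := y)
        (by rw [hx]; abel) (h1.trans h2) h2 with h | h
      · exact ⟨c, a, b, hr, hI3.rotate.rotate, h⟩
      · exact ⟨c, b, a, by rw [hr, Finset.pair_comm a b], hI3.rotate.rotate.swap, h⟩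

/-! ### Attaching hats to the faces of a star-shaped solid. -/

namespace TriSolid

/-- The nine triangles of a stacked hat, on the vertices `a, b, c, d, e, f, g = 0, …, 6`. -/
def hatIndex : Fin 9 → Finset (Fin 7) :=
  ![{0, 1, 3}, {1, 2, 4}, {0, 2, 3}, {1, 3, 4}, {2, 3, 5}, {2, 4, 5}, {3, 4, 6}, {4, 5, 6},
    {3, 5, 6}]

open Classical in
/-- The `i`-th triangle of the hat with vertices `π`. -/
noncomputable def hatFace (π : Fin 7 → Space3) (i : Fin 9) : Finset Space3 :=
  (hatIndex i).image π

/-- `π` lists the vertices of a hat over `F` that satisfies the angle conditions and lies in the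
cone over `F`. -/
structure IsHat (F : Finset Space3) (π : Fin 7 → Space3) : Prop where
  inj : Function.Injective π
  base : ∀ x, x ∈ F ↔ x = π 0 ∨ x = π 1 ∨ x = π 2
  cone : ∀ i, 3 ≤ i → ∃ μ, IsConePoint F (π i) μ
  angles : HatAngles (π 0) (π 1) (π 2) (π 3) (π 4) (π 5) (π 6)

open Classical in
theorem mem_faces_glue_triple {P : TriSolid} {a b c d : Space3} (hab : a ≠ b) (hac : a ≠ c)
    (hbc : b ≠ c) (hd : d ∉ ({a, b, c} : Finset Space3)) (h : Finset Space3) :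
    h ∈ (P.glue {a, b, c} d).faces ↔ (h ∈ P.faces ∧ h ≠ {a, b, c}) ∨
      h = {a, b, d} ∨ h = {b, c, d} ∨ h = {a, c, d} := by
  rw [mem_faces_glue (Finset.card_eq_three.2 ⟨a, b, c, hab, hac, hbc, rfl⟩) hd]
  have e1 : insert d (({a, b, c} : Finset Space3).erase a) = {b, c, d} := by
    ext x
    simp only [Finset.mem_insert, Finset.mem_erase, Finset.mem_singleton]
    constructor
    · tauto
    · rintro (rfl | rfl | rfl)
      · exact Or.inr ⟨hab.symm, by simp⟩
      · exact Or.inr ⟨hac.symm, by simp⟩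
      · exact Or.inl rfl
  have e2 : insert d (({a, b, c} : Finset Space3).erase b) = {a, c, d} := by
    ext x
    simp only [Finset.mem_insert, Finset.mem_erase, Finset.mem_singleton]
    constructor
    · tauto
    · rintro (rfl | rfl | rfl)
      · exact Or.inr ⟨hab, by simp⟩
      · exact Or.inr ⟨hbc.symm, by simp⟩
      · exact Or.inl rfl
  have e3 : insert d (({a, b, c} : Finset Space3).erase c) = {a, b, d} := by
    ext x
    simp only [Finset.mem_insert, Finset.mem_erase, Finset.mem_singleton]
    constructor
    · tauto
    · rintro (rfl | rfl | rfl)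
      · exact Or.inr ⟨hac, by simp⟩
      · exact Or.inr ⟨hbc, by simp⟩
      · exact Or.inl rfl
  simp only [Finset.mem_insert, Finset.mem_singleton, exists_eq_or_imp, exists_eq_left, e1, e2, e3]
  tauto

open Classical in
theorem isConePoint_triple {a b c v : Space3} (hab : a ≠ b) (hac : a ≠ c) (hbc : b ≠ c)
    {x y z : ℝ} (hx : 0 < x) (hy : 0 < y) (hz : 0 < z) (hv : v = x • a + y • b + z • c) :
    ∃ μ, IsConePoint {a, b, c} v μ ∧ ∑ u ∈ ({a, b, c} : Finset Space3), μ u = x + y + z := by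
  refine ⟨fun u => if u = a then x else if u = b then y else if u = c then z else 0,
    ⟨fun u hu => ?_, fun u hu => ?_, ?_⟩, ?_⟩
  · simp only [Finset.mem_insert, Finset.mem_singleton] at hu
    split_ifs <;> first | assumption | tauto
  · simp only [Finset.mem_insert, Finset.mem_singleton, not_or] at hu
    simp [hu]
  · rw [Finset.sum_insert (by simp [hab, hac]), Finset.sum_pair hbc, hv]
    simp [hab.symm, hac.symm, hbc.symm, add_assoc]
  · rw [Finset.sum_insert (by simp [hab, hac]), Finset.sum_pair hbc]
    simp [hab.symm, hac.symm, hbc.symm, add_assoc]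

theorem _root_.LinIndep3.ne {a b c : Space3} (h : LinIndep3 a b c) : a ≠ b := by
  rintro rfl
  have := h 1 (-1) 0 (by module)
  norm_num at this

theorem _root_.LinIndep3.smul {a b c : Space3} (h : LinIndep3 a b c) {r s t : ℝ} (hr : r ≠ 0)
    (hs : s ≠ 0) (ht : t ≠ 0) : LinIndep3 (r • a) (s • b) (t • c) := by
  intro x y z h0
  obtain ⟨h1, h2, h3⟩ := h (x * r) (y * s) (z * t) (by rw [← h0]; module)
  exact ⟨(mul_eq_zero.1 h1).resolve_right hr, (mul_eq_zero.1 h2).resolve_right hs,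
    (mul_eq_zero.1 h3).resolve_right ht⟩

open Classical in
/-- A radial perturbation of an interior point of a triangle whose corners are perturbed less. -/
theorem isConePoint_of_isInner {a b c v : Space3} {x y z : ℝ} (hI : LinIndep3 a b c)
    (hv : IsInner a b c v x y z) {r s t u : ℝ} (hr : 0 < r) (hs : 0 < s) (ht : 0 < t)
    (hru : r < u) (hsu : s < u) (htu : t < u) :
    ∃ μ, IsConePoint {r • a, s • b, t • c} (u • v) μ ∧
      1 < ∑ w ∈ ({r • a, s • b, t • c} : Finset Space3), μ w := by
  have hu : 0 < u := hr.trans hru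
  have hI' := hI.smul hr.ne' hs.ne' ht.ne'
  obtain ⟨μ, h1, h2⟩ := isConePoint_triple hI'.ne hI'.swap.ne hI'.rotate.ne
    (x := u * x / r) (y := u * y / s) (z := u * z / t) (v := u • v)
    (by have := hv.x_pos; positivity) (by have := hv.y_pos; positivity)
    (by have := hv.z_pos; positivity) (by
      rw [hv.eq]; match_scalars <;> field_simp)
  refine ⟨μ, h1, ?_⟩
  have k1 : x < u * x / r := by
    rw [lt_div_iff₀ hr, mul_comm]; exact mul_lt_mul_of_pos_right hru hv.x_pos
  have k2 : y < u * y / s := by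
    rw [lt_div_iff₀ hs, mul_comm]; exact mul_lt_mul_of_pos_right hsu hv.y_pos
  have k3 : z < u * z / t := by
    rw [lt_div_iff₀ ht, mul_comm]; exact mul_lt_mul_of_pos_right htu hv.z_pos
  have := hv.sum_eq
  rw [h2]; linarith

open Classical in
theorem hatFaces_mem_iff (π : Fin 7 → Space3) (h : Finset Space3) :
    (∃ i, h = hatFace π i) ↔
      h = {π 0, π 1, π 3} ∨ h = {π 1, π 2, π 4} ∨ h = {π 0, π 2, π 3} ∨ h = {π 1, π 3, π 4} ∨
      h = {π 2, π 3, π 5} ∨ h = {π 2, π 4, π 5} ∨ h = {π 3, π 4, π 6} ∨ h = {π 4, π 5, π 6} ∨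
      h = {π 3, π 5, π 6} := by
  have e : ∀ x y z : Fin 7, ({x, y, z} : Finset (Fin 7)).image π = {π x, π y, π z} := by
    intro x y z; simp [Finset.image_insert]
  constructor
  · rintro ⟨i, rfl⟩
    fin_cases i <;> simp [hatFace, hatIndex, e]
  · intro hh
    rcases hh with h | h | h | h | h | h | h | h | h
    · exact ⟨0, h.trans (e _ _ _).symm⟩
    · exact ⟨1, h.trans (e _ _ _).symm⟩
    · exact ⟨2, h.trans (e _ _ _).symm⟩
    · exact ⟨3, h.trans (e _ _ _).symm⟩
    · exact ⟨4, h.trans (e _ _ _).symm⟩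
    · exact ⟨5, h.trans (e _ _ _).symm⟩
    · exact ⟨6, h.trans (e _ _ _).symm⟩
    · exact ⟨7, h.trans (e _ _ _).symm⟩
    · exact ⟨8, h.trans (e _ _ _).symm⟩

open Classical in
theorem triple_ne {π : Fin 7 → Space3} (hinj : Function.Injective π) (x y z x' y' z' : Fin 7)
    (h : ({x, y, z} : Finset (Fin 7)) ≠ {x', y', z'}) :
    ({π x, π y, π z} : Finset Space3) ≠ {π x', π y', π z'} := by
  intro he
  apply h
  apply Finset.image_injective hinj
  simpa [Finset.image_insert] using he

-- Each later gluing removes a triangle that was just created. Old faces differ from it since it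
-- contains a fresh vertex, and the surviving new triangles differ from it by injectivity of `π`.
open Classical in
theorem mem_faces_hat {P : TriSolid} {π : Fin 7 → Space3} (hinj : Function.Injective π)
    (hfresh : ∀ i, 3 ≤ i → ∀ h ∈ P.faces, π i ∉ h) (h : Finset Space3) :
    h ∈ ((((P.glue {π 0, π 1, π 2} (π 3)).glue {π 1, π 2, π 3} (π 4)).glue
      {π 2, π 3, π 4} (π 5)).glue {π 3, π 4, π 5} (π 6)).faces ↔
      (h ∈ P.faces ∧ h ≠ {π 0, π 1, π 2}) ∨ ∃ i, h = hatFace π i := by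
  have ne : ∀ i j : Fin 7, i ≠ j → π i ≠ π j := fun i j => hinj.ne
  have nm : ∀ x y z t : Fin 7, t ≠ x → t ≠ y → t ≠ z →
      π t ∉ ({π x, π y, π z} : Finset Space3) := by
    intro x y z t h1 h2 h3
    simp [hinj.eq_iff, h1, h2, h3]
  rw [hatFaces_mem_iff,
    mem_faces_glue_triple (ne 3 4 (by decide)) (ne 3 5 (by decide)) (ne 4 5 (by decide))
      (nm 3 4 5 6 (by decide) (by decide) (by decide)),
    mem_faces_glue_triple (ne 2 3 (by decide)) (ne 2 4 (by decide)) (ne 3 4 (by decide))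
      (nm 2 3 4 5 (by decide) (by decide) (by decide)),
    mem_faces_glue_triple (ne 1 2 (by decide)) (ne 1 3 (by decide)) (ne 2 3 (by decide))
      (nm 1 2 3 4 (by decide) (by decide) (by decide)),
    mem_faces_glue_triple (ne 0 1 (by decide)) (ne 0 2 (by decide)) (ne 1 2 (by decide))
      (nm 0 1 2 3 (by decide) (by decide) (by decide))]
  have fd := hfresh 3 le_rfl h
  have n1 : h ∈ P.faces → h ≠ {π 1, π 2, π 3} ∧ h ≠ {π 2, π 3, π 4} ∧ h ≠ {π 3, π 4, π 5} := by
    intro hh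
    refine ⟨?_, ?_, ?_⟩ <;> rintro rfl <;> exact fd hh (by simp)
  have k1 := triple_ne hinj 0 1 3 1 2 3 (by decide)
  have k2 := triple_ne hinj 0 1 3 2 3 4 (by decide)
  have k3 := triple_ne hinj 0 1 3 3 4 5 (by decide)
  have k4 := triple_ne hinj 0 2 3 1 2 3 (by decide)
  have k5 := triple_ne hinj 0 2 3 2 3 4 (by decide)
  have k6 := triple_ne hinj 0 2 3 3 4 5 (by decide)
  have k7 := triple_ne hinj 1 2 4 2 3 4 (by decide)
  have k8 := triple_ne hinj 1 2 4 3 4 5 (by decide)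
  have k9 := triple_ne hinj 1 3 4 2 3 4 (by decide)
  have k10 := triple_ne hinj 1 3 4 3 4 5 (by decide)
  have k11 := triple_ne hinj 2 3 5 3 4 5 (by decide)
  have k12 := triple_ne hinj 2 4 5 3 4 5 (by decide)
  constructor
  · rintro (⟨⟨⟨⟨hh, h0⟩ | h1 | h1 | h1, h2⟩ | h3 | h3 | h3, h4⟩ | h5 | h5 | h5, h6⟩ | h7 | h7 | h7)
    all_goals first | contradiction | (simp only [*, ne_eq, not_false_eq_true, and_self, true_or, or_true])
  · rintro (⟨hh, hne⟩ | rfl | rfl | rfl | rfl | rfl | rfl | hh)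
    · obtain ⟨n2, n3, n4⟩ := n1 hh
      exact Or.inl ⟨Or.inl ⟨Or.inl ⟨Or.inl ⟨hh, hne⟩, n2⟩, n3⟩, n4⟩
    · exact Or.inl ⟨Or.inl ⟨Or.inl ⟨Or.inr (Or.inl rfl), k1⟩, k2⟩, k3⟩
    · exact Or.inl ⟨Or.inl ⟨Or.inr (Or.inl rfl), k7⟩, k8⟩
    · exact Or.inl ⟨Or.inl ⟨Or.inl ⟨Or.inr (Or.inr (Or.inr rfl)), k4⟩, k5⟩, k6⟩
    · exact Or.inl ⟨Or.inl ⟨Or.inr (Or.inr (Or.inr rfl)), k9⟩, k10⟩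
    · exact Or.inl ⟨Or.inr (Or.inl rfl), k11⟩
    · exact Or.inl ⟨Or.inr (Or.inr (Or.inr rfl)), k12⟩
    · exact Or.inr hh

open Classical in
/-- A face of a star-shaped stacked polyhedron can be replaced by a hat. -/
theorem exists_attachHat {P : TriSolid} (hP : P.IsStarStacked) {F : Finset Space3}
    (hF : F ∈ P.faces) : ∃ (P' : TriSolid) (π : Fin 7 → Space3), P.AttachHat F P' ∧
      P'.IsStarStacked ∧ IsHat F π ∧
      ∀ h, h ∈ P'.faces ↔ (h ∈ P.faces ∧ h ≠ F) ∨ ∃ i, h = hatFace π i := by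
  obtain ⟨a, b, c, rfl, hI, p, e₀, f₀, p₁, p₂, p₃, q₁, q₂, q₃, r₁, r₂, r₃, η, hp, he, hf, hη,
    hang⟩ := exists_hasHat (hP.star.card_face F hF) (hP.star.linearIndependent hF)
  have hI1 := hp.linIndep3 hI
  have hI2 := he.linIndep3 hI1
  have hI3 := hf.linIndep3 hI2
  set g₀ : Space3 := (3⁻¹ : ℝ) • (p + e₀ + f₀) with hg₀
  have hg : IsInner p e₀ f₀ g₀ 3⁻¹ 3⁻¹ 3⁻¹ :=
    ⟨by norm_num, by norm_num, by norm_num, by norm_num, by rw [hg₀]; module⟩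
  -- The scalings will satisfy `1 < t₁ < t₂ < t₃ < 1 + δ` and `2 < t₄ < 2 + δ`. Each apex is scaled
  -- more than the corners of its triangle, so it lies beyond that triangle; `δ ≤ 1` gives `t₃ <
  -- t₄`, `δ ≤ η` gives the angle conditions, and each interval leaves room to avoid the face
  -- planes.
  set δ := min η 1 with hδ
  have hδ0 : 0 < δ := lt_min hη one_pos
  have hδη : δ ≤ η := min_le_left _ _
  have hδ1 : δ ≤ 1 := min_le_right _ _
  -- first apex
  obtain ⟨t₁, h1, h1', off1⟩ := exists_off_planes hP.star p (show (1 : ℝ) < 1 + δ by linarith)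
  obtain ⟨μ₁, c1, s1⟩ := isConePoint_of_isInner hI hp one_pos one_pos one_pos h1 h1 h1
  simp only [one_smul] at c1 s1
  set d := t₁ • p with hd
  have P1 := hP.glue hF c1 s1 off1
  have g1 := hP.star.canGlue hF c1 s1
  have hab := hI.ne
  have hac := hI.swap.ne
  have hbc := hI.rotate.ne
  have m1 := mem_faces_glue_triple (P := P) hab hac hbc g1.2.1
  set Q1 := P.glue {a, b, c} d with hQ1
  -- second apex
  obtain ⟨t₂, h2, h2', off2⟩ := exists_off_planes P1.star e₀ h1'
  have t1p : 0 < t₁ := by linarith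
  obtain ⟨μ₂, c2, s2⟩ := isConePoint_of_isInner hI1 he one_pos one_pos t1p
    (h1.trans h2) (h1.trans h2) h2
  simp only [one_smul] at c2 s2
  set e := t₂ • e₀ with hee
  have f1 : ({b, c, d} : Finset Space3) ∈ Q1.faces := (m1 _).2 (Or.inr (Or.inr (Or.inl rfl)))
  have P2 := P1.glue f1 c2 s2 off2
  have g2 := P1.star.canGlue f1 c2 s2
  have hI1' := hI1.smul one_ne_zero one_ne_zero t1p.ne'
  simp only [one_smul] at hI1'
  have hbd : b ≠ d := hI1'.swap.ne
  have hcd : c ≠ d := hI1'.rotate.ne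
  have m2 := mem_faces_glue_triple (P := Q1) hbc hbd hcd g2.2.1
  set Q2 := Q1.glue {b, c, d} e with hQ2
  -- third apex
  obtain ⟨t₃, h3, h3', off3⟩ := exists_off_planes P2.star f₀ h2'
  have t2p : 0 < t₂ := by linarith
  obtain ⟨μ₃, c3, s3⟩ := isConePoint_of_isInner hI2 hf one_pos t1p t2p
    (h1.trans (h2.trans h3)) (h2.trans h3) h3
  simp only [one_smul] at c3 s3
  set f := t₃ • f₀ with hff
  have f2 : ({c, d, e} : Finset Space3) ∈ Q2.faces := (m2 _).2 (Or.inr (Or.inr (Or.inl rfl)))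
  have P3 := P2.glue f2 c3 s3 off3
  have g3 := P2.star.canGlue f2 c3 s3
  have hI2' := hI2.smul one_ne_zero t1p.ne' t2p.ne'
  simp only [one_smul] at hI2'
  have hce : c ≠ e := hI2'.swap.ne
  have hde : d ≠ e := hI2'.rotate.ne
  have m3 := mem_faces_glue_triple (P := Q2) hcd hce hde g3.2.1
  set Q3 := Q2.glue {c, d, e} f with hQ3
  -- fourth apex
  obtain ⟨t₄, h4, h4', off4⟩ := exists_off_planes P3.star g₀ (show (2 : ℝ) < 2 + δ by linarith)
  have t3p : 0 < t₃ := by linarith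
  obtain ⟨μ₄, c4, s4⟩ := isConePoint_of_isInner hI3 hg t1p t2p t3p
    (by linarith) (by linarith) (show t₃ < t₄ by linarith)
  set g := t₄ • g₀ with hgg
  have f3 : ({d, e, f} : Finset Space3) ∈ Q3.faces := (m3 _).2 (Or.inr (Or.inr (Or.inl rfl)))
  have P4 := P3.glue f3 c4 s4 off4
  have g4 := P3.star.canGlue f3 c4 s4
  have hI3' := hI3.smul t1p.ne' t2p.ne' t3p.ne'
  have hdf : d ≠ f := hI3'.swap.ne
  have hef : e ≠ f := hI3'.rotate.ne
  have m4 := mem_faces_glue_triple (P := Q3) hde hdf hef g4.2.1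
  have t4p : 0 < t₄ := by linarith
  -- all apexes lie in the cone over `abc`
  obtain ⟨d₁, d₂, d₃, d₁p, d₂p, d₃p, dE⟩ : ∃ x y z : ℝ, 0 < x ∧ 0 < y ∧ 0 < z ∧
      p = x • a + y • b + z • c := ⟨_, _, _, hp.x_pos, hp.y_pos, hp.z_pos, hp.eq⟩
  obtain ⟨e₁, e₂, e₃, e₁p, e₂p, e₃p, eE⟩ : ∃ x y z : ℝ, 0 < x ∧ 0 < y ∧ 0 < z ∧
      e₀ = x • a + y • b + z • c := by
    have := hp.x_pos; have := hp.y_pos; have := hp.z_pos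
    have := he.x_pos; have := he.y_pos; have := he.z_pos
    exact ⟨q₃ * p₁, q₁ + q₃ * p₂, q₂ + q₃ * p₃, by positivity, by positivity, by positivity, by
      rw [he.eq, hp.eq]; module⟩
  obtain ⟨f₁, f₂, f₃, f₁p, f₂p, f₃p, fE⟩ : ∃ x y z : ℝ, 0 < x ∧ 0 < y ∧ 0 < z ∧
      f₀ = x • a + y • b + z • c := by
    have := hf.x_pos; have := hf.y_pos; have := hf.z_pos
    exact ⟨r₂ * d₁ + r₃ * e₁, r₂ * d₂ + r₃ * e₂, r₁ + r₂ * d₃ + r₃ * e₃, by positivity,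
      by positivity, by positivity, by rw [hf.eq, eE, dE]; module⟩
  obtain ⟨g₁, g₂, g₃, g₁p, g₂p, g₃p, gE⟩ : ∃ x y z : ℝ, 0 < x ∧ 0 < y ∧ 0 < z ∧
      g₀ = x • a + y • b + z • c :=
    ⟨3⁻¹ * (d₁ + e₁ + f₁), 3⁻¹ * (d₂ + e₂ + f₂), 3⁻¹ * (d₃ + e₃ + f₃), by positivity,
      by positivity, by positivity, by rw [hg₀, fE, eE, dE]; module⟩
  have cone : ∀ (t : ℝ) (v : Space3) (x y z : ℝ), 0 < t → 0 < x → 0 < y → 0 < z →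
      v = x • a + y • b + z • c → ∃ μ, IsConePoint {a, b, c} (t • v) μ := by
    intro t v x y z ht hx hy hz hv
    obtain ⟨μ, h, -⟩ := isConePoint_triple hab hac hbc hx hy hz hv
    exact ⟨_, h.smul ht⟩
  have cd := cone t₁ p _ _ _ t1p d₁p d₂p d₃p dE
  have ce := cone t₂ e₀ _ _ _ t2p e₁p e₂p e₃p eE
  have cf := cone t₃ f₀ _ _ _ t3p f₁p f₂p f₃p fE
  have cg := cone t₄ g₀ _ _ _ t4p g₁p g₂p g₃p gE
  have fresh : ∀ v : Space3, (∃ μ, IsConePoint {a, b, c} v μ) → ∀ h ∈ P.faces, v ∉ h :=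
    fun v ⟨μ, hμ⟩ h hh => hP.star.notMem_of_isConePoint hF hμ hh
  set π : Fin 7 → Space3 := ![a, b, c, d, e, f, g] with hπ
  have hinj : Function.Injective π := by
    have nd := fresh d cd _ hF
    have ne := fresh e ce _ hF
    have nf := fresh f cf _ hF
    have ng := fresh g cg _ hF
    have ng' := g4.2.1
    simp only [Finset.mem_insert, Finset.mem_singleton, not_or] at nd ne nf ng ng'
    obtain ⟨x1, x2, x3⟩ := nd
    obtain ⟨x4, x5, x6⟩ := ne
    obtain ⟨x7, x8, x9⟩ := nf
    obtain ⟨y1, y2, y3⟩ := ng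
    obtain ⟨y4, y5, y6⟩ := ng'
    intro i j hij
    fin_cases i <;> fin_cases j <;>
      first | rfl | exact absurd hij ‹_› | exact absurd hij.symm ‹_›
  refine ⟨Q3.glue {d, e, f} g, π, ⟨a, b, c, d, e, f, g, rfl, g1, g2, g3, g4, rfl⟩, P4,
    ⟨hinj, fun x => by simp [hπ], ?_, ?_⟩, ?_⟩
  · intro i hi
    fin_cases i
    · exact absurd hi (by decide)
    · exact absurd hi (by decide)
    · exact absurd hi (by decide)
    · exact cd
    · exact ce
    · exact cf
    · exact cg
  · refine hang t₁ t₂ t₃ t₄ ?_ ?_ ?_ ?_ <;> rw [abs_lt] <;> constructor <;> linarith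
  · have hf' : ∀ i, 3 ≤ i → ∀ h ∈ P.faces, π i ∉ h := by
      intro i hi h hh
      fin_cases i
      · exact absurd hi (by decide)
      · exact absurd hi (by decide)
      · exact absurd hi (by decide)
      · exact fresh d cd h hh
      · exact fresh e ce h hh
      · exact fresh f cf h hh
      · exact fresh g cg h hh
    clear_value d e f g
    have key := mem_faces_hat (P := P) hinj hf'
    exact key

theorem exists_new_mem_hatIndex (i : Fin 9) : ∃ j, 3 ≤ j ∧ j ∈ hatIndex i := by
  revert i; decide

/-- Every hat triangle has one of the new vertices, which lies in the open cone over `G` and hence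
on no face of `Q`. -/
theorem IsHat.hatFace_ne {Q : TriSolid} (hQ : Q.IsStar) {F G : Finset Space3} (hF : F ∈ Q.faces)
    (hG : G ∈ Q.faces) {π : Fin 7 → Space3} (h : IsHat G π) (i : Fin 9) : F ≠ hatFace π i := by
  classical
  obtain ⟨j, hj, hi⟩ := exists_new_mem_hatIndex i
  obtain ⟨μ, hμ⟩ := h.cone j hj
  rintro rfl
  exact hQ.notMem_of_isConePoint hG hμ hF (Finset.mem_image_of_mem _ hi)

/-- A hat changes only its own face, so the remaining faces of `Q` are still present for later
steps. Earlier hat triangles are never the face being replaced, by `IsHat.hatFace_ne`. -/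
theorem exists_attachHats {Q : TriSolid} (hQ : Q.IsStarStacked) (S : Finset (Finset Space3))
    (hS : S ⊆ Q.faces) : ∃ (P : TriSolid) (π : Finset Space3 → Fin 7 → Space3),
      AttachHats Q S P ∧ P.IsStarStacked ∧
      (∀ h, h ∈ P.faces ↔ (h ∈ Q.faces ∧ h ∉ S) ∨ ∃ F ∈ S, ∃ i, h = hatFace (π F) i) ∧
      ∀ F ∈ S, IsHat F (π F) := by
  classical
  induction S using Finset.induction_on with
  | empty => exact ⟨Q, fun _ _ => 0, .none, hQ, by simp, by simp⟩
  | insert F S hFS ih =>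
    obtain ⟨P, π, h1, h2, h3, h4⟩ := ih ((Finset.subset_insert _ _).trans hS)
    have hFQ : F ∈ Q.faces := hS (Finset.mem_insert_self _ _)
    obtain ⟨P', π', k1, k2, k3, k4⟩ := exists_attachHat h2 ((h3 F).2 (Or.inl ⟨hFQ, hFS⟩))
    have hne : ∀ G ∈ S, G ≠ F := fun G hG => by rintro rfl; exact hFS hG
    refine ⟨P', Function.update π F π', ?_, k2, fun h => ?_, fun G hG => ?_⟩
    · convert AttachHats.more S F P P' h1 hFS k1
    · rw [k4, h3]
      constructor
      · rintro (⟨⟨ha, hb⟩ | ⟨G, hG, i, rfl⟩, hc⟩ | ⟨i, rfl⟩)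
        · exact Or.inl ⟨ha, by simp [hb, hc]⟩
        · exact Or.inr ⟨G, Finset.mem_insert_of_mem hG, i, by
            rw [Function.update_of_ne (hne G hG)]⟩
        · exact Or.inr ⟨F, Finset.mem_insert_self _ _, i, by simp⟩
      · rintro (⟨ha, hb⟩ | ⟨G, hG, i, rfl⟩)
        · rw [Finset.mem_insert, not_or] at hb
          exact Or.inl ⟨Or.inl ⟨ha, hb.2⟩, hb.1⟩
        · rcases Finset.mem_insert.1 hG with rfl | hG
          · exact Or.inr ⟨i, by simp⟩
          · rw [Function.update_of_ne (hne G hG)]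
            refine Or.inl ⟨Or.inr ⟨G, hG, i, rfl⟩, fun he => ?_⟩
            exact (h4 G hG).hatFace_ne hQ.star hFQ (hS (Finset.mem_insert_of_mem hG)) i he.symm
    · rcases Finset.mem_insert.1 hG with rfl | hG
      · simpa using k3
      · rw [Function.update_of_ne (hne G hG)]
        exact h4 G hG

/-! ### Cuts forced inside a hat. -/

/-- The interior edges of a hat. -/
def hatEdge : Fin 12 → Finset (Fin 7) :=
  ![{0, 3}, {1, 3}, {2, 3}, {1, 4}, {2, 4}, {3, 4}, {2, 5}, {3, 5}, {4, 5}, {3, 6}, {4, 6}, {5, 6}]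

/-- Sets of interior edges of a hat, each of which contains a cut edge in every unfolding. -/
def hatFans : List (List (Fin 12)) :=
  [[0, 1, 2, 5], [0, 1, 2, 7], [1, 2, 5, 7, 9], [0, 2, 5, 7, 9], [0, 1, 5, 7, 9], [3, 4, 5],
    [3, 4, 8], [4, 5, 8, 10], [3, 5, 8, 10], [6, 7], [6, 8], [7, 8, 11]]

/-- Sets of triangles of a hat, with the interior edges that separate them from the others. -/
def hatSplits : List (Finset (Fin 9) × List (Fin 12)) :=
  [({1}, [3, 4]), ({5}, [4, 6, 8]), ({1, 5}, [3, 6, 8]), ({5, 7}, [4, 6, 10, 11]),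
    ({1, 5, 7}, [3, 6, 10, 11]), ({4}, [2, 6, 7]), ({2, 4}, [0, 6, 7]), ({0, 2, 4}, [1, 6, 7]),
    ({3}, [1, 3, 5]), ({0, 3}, [0, 3, 5]), ({1, 3}, [1, 4, 5]), ({0, 1, 3}, [0, 4, 5]),
    ({0, 2, 3}, [2, 3, 5]), ({0, 1, 2, 3}, [2, 4, 5]), ({0, 2, 3, 4}, [3, 5, 6, 7]),
    ({0, 1, 2, 3, 4}, [4, 5, 6, 7]), ({1, 3, 5}, [1, 5, 6, 8]), ({0, 1, 3, 5}, [0, 5, 6, 8]),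
    ({0, 1, 2, 3, 5}, [2, 5, 6, 8]), ({4, 5}, [2, 4, 7, 8]), ({1, 4, 5}, [2, 3, 7, 8]),
    ({2, 4, 5}, [0, 4, 7, 8]), ({0, 2, 4, 5}, [1, 4, 7, 8]), ({1, 2, 4, 5}, [0, 3, 7, 8]),
    ({0, 1, 2, 4, 5}, [1, 3, 7, 8]), ({0, 1, 2, 3, 4, 5}, [5, 7, 8])]

theorem hatSplits_spec : ∀ p ∈ hatSplits, p.1.Nonempty ∧ p.1 ≠ Finset.univ ∧
    ∀ i ∈ p.1, ∀ j ∉ p.1, (hatIndex i ∩ hatIndex j).card = 2 →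
      ∃ k ∈ p.2, hatIndex i ∩ hatIndex j = hatEdge k := by
  decide +kernel

/-- Behind the finite check: identify the corners a, b, c to one outer vertex, so that a cycle of
cut edges separates the hat. The fans force at least two cuts at each of d, e, f. If the cuts were
acyclic, their only leaves would be g and the outer vertex, so they would form a path from g through
d, e, f to the outer vertex. At the first vertex after g, the only two cuts would be sides of one
crown triangle, contradicting the fan that omits this triangle. -/
theorem exists_hatSplit_bool : ∀ p q r s t u v w x y z o : Bool,
    (p || q || r || u) && (p || q || r || w) && (q || r || u || w || y) && (p || r || u || w
      || y) && (p || q || u || w || y) && (s || t || u) && (s || t || x) && (t || u || x ||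
      z) && (s || u || x || z) && (v || w) && (v || x) && (w || x || o) →
    (s && t) || (t && v && x) || (s && v && x) || (t && v && z && o) || (s && v && z && o)
      || (r && v && w) || (p && v && w) || (q && v && w) || (q && s && u) || (p && s && u)
      || (q && t && u) || (p && t && u) || (r && s && u) || (r && t && u) || (s && u && v &&
      w) || (t && u && v && w) || (q && u && v && x) || (p && u && v && x) || (r && u && v
      && x) || (r && t && w && x) || (r && s && w && x) || (p && t && w && x) || (q && t &&
      w && x) || (p && s && w && x) || (q && s && w && x) || (u && w && x) := by
  decide +kernel

theorem exists_hatSplit (c : Fin 12 → Prop) (h : ∀ l ∈ hatFans, ∃ k ∈ l, c k) :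
    ∃ p ∈ hatSplits, ∀ k ∈ p.2, c k := by
  classical
  have key := exists_hatSplit_bool (decide (c 0)) (decide (c 1)) (decide (c 2)) (decide (c 3)) (decide (c 4)) (decide (c 5)) (decide (c 6)) (decide (c 7)) (decide (c 8)) (decide (c 9)) (decide (c 10)) (decide (c 11))
  simp only [Bool.or_eq_true, Bool.and_eq_true, decide_eq_true_eq] at key
  simp only [hatFans, hatSplits, List.forall_mem_cons, List.exists_mem_cons_iff, List.not_mem_nil,
    false_and, exists_false, or_false, IsEmpty.forall_iff, implies_true, and_true] at h ⊢
  simp only [← or_assoc, ← and_assoc] at h key ⊢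
  exact key h

open Classical in
theorem IsStar.not_collinear {P : TriSolid} (hP : P.IsStar) {x y z : Space3}
    (hF : ({x, y, z} : Finset Space3) ∈ P.faces) : ¬ Collinear ℝ {y, x, z} := by
  have hxy : x ≠ y ∧ x ≠ z ∧ y ≠ z := by
    have := hP.card_face _ hF
    refine ⟨?_, ?_, ?_⟩ <;> rintro rfl
    · rw [Finset.insert_eq_of_mem (by simp)] at this
      exact absurd this (Finset.card_le_two.trans_lt (by norm_num)).ne
    · rw [Finset.insert_eq_of_mem (by simp)] at this
      exact absurd this (Finset.card_le_two.trans_lt (by norm_num)).ne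
    · rw [Finset.pair_eq_singleton] at this
      exact absurd this (Finset.card_le_two.trans_lt (by norm_num)).ne
  obtain ⟨hxy, hxz, hyz⟩ := hxy
  rw [collinear_iff_of_mem (p₀ := x) (by simp)]
  rintro ⟨v, hv⟩
  obtain ⟨r, hr⟩ := hv y (by simp)
  obtain ⟨s, hs⟩ := hv z (by simp)
  rw [vadd_eq_add] at hr hs
  have key := hP.linearIndependent hF
    (fun u => if u = x then r - s else if u = y then s else -r) (by
      rw [Finset.sum_insert (by simp [hxy, hxz]), Finset.sum_pair hyz]
      simp only [if_true, hxy.symm, hxz.symm, hyz.symm, if_false]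
      rw [hr, hs]
      module)
  have h1 := key z (by simp)
  simp only [hxz.symm, hyz.symm, if_false, neg_eq_zero] at h1
  rw [h1, zero_smul, zero_add] at hr
  exact hxy hr.symm

open Classical in
theorem hatFace_injective {π : Fin 7 → Space3} (hπ : Function.Injective π) :
    Function.Injective (hatFace π) := by
  intro i j h
  have := Finset.image_injective hπ h
  revert i j
  have : Function.Injective hatIndex := by decide
  intro i j _ h
  exact this h

open Classical in
theorem hatFace_inter {π : Fin 7 → Space3} (hπ : Function.Injective π) (i j : Fin 9) :
    hatFace π i ∩ hatFace π j = (hatIndex i ∩ hatIndex j).image π :=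
  (Finset.image_inter _ _ hπ).symm

open Classical in
theorem adj_hatFace {P : TriSolid} {cuts : Finset (Finset Space3)} {π : Fin 7 → Space3}
    (hπ : Function.Injective π) (hmem : ∀ i, hatFace π i ∈ P.faces) {i j : Fin 9} {k : Fin 12}
    (hij : i ≠ j) (hk : hatIndex i ∩ hatIndex j = hatEdge k)
    (hc : (hatEdge k).image π ∉ cuts) :
    (P.uncutGraph cuts).Adj ⟨hatFace π i, hmem i⟩ ⟨hatFace π j, hmem j⟩ := by
  have he : hatFace π i ∩ hatFace π j = (hatEdge k).image π := by rw [hatFace_inter hπ, hk]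
  refine ⟨fun h => hij (hatFace_injective hπ (congrArg Subtype.val h)), ?_, ?_⟩
  · refine Finset.mem_biUnion.2 ⟨_, hmem i, Finset.mem_powersetCard.2
      ⟨Finset.inter_subset_left, ?_⟩⟩
    change (hatFace π i ∩ hatFace π j).card = 2
    rw [he, Finset.card_image_of_injective _ hπ]
    exact (by decide : ∀ k, (hatEdge k).card = 2) k
  · change hatFace π i ∩ hatFace π j ∉ cuts
    rwa [he]

open EuclideanGeometry in
open Classical in
/-- If the triangles of a hat along a path around a vertex have angle sum above `2π`, then one of
the edges between consecutive triangles of the path is cut. -/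
theorem exists_cut_of_fan {P : TriSolid} (hP : P.IsStar) (U : P.EdgeUnfolding)
    {π : Fin 7 → Space3} (hπ : Function.Injective π) (hmem : ∀ i, hatFace π i ∈ P.faces)
    {n : ℕ} (v : Fin 7) (path : Fin (n + 1) → Fin 9) (y z : Fin (n + 1) → Fin 7)
    (e : Fin n → Fin 12) (hinj : Function.Injective path)
    (hyz : ∀ k, hatIndex (path k) = {v, y k, z k})
    (he : ∀ k, hatIndex (path k.castSucc) ∩ hatIndex (path k.succ) = hatEdge (e k))
    (hang : 2 * Real.pi < ∑ k, ∠ (π (y k)) (π v) (π (z k))) :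
    ∃ k, (hatEdge (e k)).image π ∈ U.cuts := by
  by_contra! hc
  set f : Fin (n + 1) → {f : Finset Space3 // f ∈ P.faces} :=
    fun k => ⟨hatFace π (path k), hmem _⟩ with hf
  have hadj : ∀ k : Fin n, (P.uncutGraph U.cuts).Adj (f k.castSucc) (f k.succ) := fun k =>
    adj_hatFace hπ hmem (hinj.ne (Fin.castSucc_lt_succ).ne) (he k) (hc k)
  have hface : ∀ k, hatFace π (path k) = {π v, π (y k), π (z k)} := by
    intro k
    rw [hatFace, hyz]; simp [Finset.image_insert]
  have hset : ∀ k, ((f k).1 : Set Space3) = {π v, π (y k), π (z k)} := by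
    intro k
    change ((hatFace π (path k) : Finset Space3) : Set Space3) = _
    rw [hface]; simp
  -- Without cuts along the path, all its triangles belong to one piece, and each shared edge
  -- contains the common corner, which therefore has a single image in the plane.
  have hreach : ∀ k, (P.uncutGraph U.cuts).Reachable (f 0) (f k) ∧
      U.place (f k) (π v) = U.place (f 0) (π v) := by
    intro k
    induction k using Fin.induction with
    | zero => exact ⟨SimpleGraph.Reachable.refl _, rfl⟩
    | succ k ih =>
      refine ⟨ih.1.trans (hadj k).reachable, ?_⟩
      rw [← ih.2]
      refine (U.attached _ _ (hadj k) _ (subset_convexHull ℝ _ ?_)).symm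
      rw [Finset.mem_coe, Finset.mem_inter]
      constructor
      · rw [← Finset.mem_coe, hset]; simp
      · rw [← Finset.mem_coe, hset]; simp
  have := sum_angle_le_two_pi Finset.univ (π v) (fun k => π (y k)) (fun k => π (z k))
    (fun k => U.place (f k)) (U.place (f 0) (π v)) (fun k _ => (hreach k).2)
    (fun k _ => hP.not_collinear (hface k ▸ hmem (path k)))
    (fun k _ => by
      have := U.isometric (f k)
      rwa [hset] at this)
    (fun k _ l _ hkl => by
      have := U.nonoverlapping (f k) (f l)
        (fun h => hkl (hinj (hatFace_injective hπ (congrArg Subtype.val h))))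
        ((hreach k).1.symm.trans (hreach l).1)
      rwa [hset, hset] at this)
  linarith

open EuclideanGeometry in
open Classical in
/-- Every unfolding separates the triangles of a hat into two classes that are not attached to each
other. -/
theorem exists_separated_hatFaces {P : TriSolid} (hP : P.IsStar) (U : P.EdgeUnfolding)
    {F : Finset Space3} {π : Fin 7 → Space3} (hπ : IsHat F π)
    (hmem : ∀ i, hatFace π i ∈ P.faces) : ∃ A : Finset (Fin 9), A.Nonempty ∧ A ≠ Finset.univ ∧
      ∀ i ∈ A, ∀ j ∉ A,
        ¬ (P.uncutGraph U.cuts).Adj ⟨hatFace π i, hmem i⟩ ⟨hatFace π j, hmem j⟩ := by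
  obtain ⟨hinj, -, -, ang⟩ := hπ
  have fan : ∀ {n : ℕ} (v : Fin 7) (l : List (Fin 12)) (path : Fin (n + 1) → Fin 9)
      (y z : Fin (n + 1) → Fin 7) (e : Fin n → Fin 12), Function.Injective path →
      (∀ k, hatIndex (path k) = {v, y k, z k}) →
      (∀ k, hatIndex (path k.castSucc) ∩ hatIndex (path k.succ) = hatEdge (e k)) →
      (∀ k, e k ∈ l) → 2 * Real.pi < ∑ k, ∠ (π (y k)) (π v) (π (z k)) →
      ∃ k ∈ l, (hatEdge k).image π ∈ U.cuts := by
    intro n v l path y z e h1 h2 h3 h4 h5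
    obtain ⟨k, hk⟩ := exists_cut_of_fan hP U hinj hmem v path y z e h1 h2 h3 h5
    exact ⟨e k, h4 k, hk⟩
  have hd1 := ang.d_e
  have hd2 := ang.d_f
  have he1 := ang.e_d
  have he2 := ang.e_f
  have hf1 := ang.f_d
  have hf2 := ang.f_e
  -- Six of the fans omit one crown triangle and use an inequality of `HatAngles` directly. The
  -- other six go all the way around the vertex, and the additional crown angle is merely
  -- nonnegative.
  have pd := angle_nonneg (π 5) (π 3) (π 6)
  have pe := angle_nonneg (π 5) (π 4) (π 6)
  have pf := angle_nonneg (π 4) (π 5) (π 6)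
  obtain ⟨⟨A, l⟩, hA, hc⟩ := exists_hatSplit (fun k => (hatEdge k).image π ∈ U.cuts) (by
    simp only [hatFans, List.forall_mem_cons]
    refine ⟨?_, ?_, ?_, ?_, ?_, ?_, ?_, ?_, ?_, ?_, ?_, ?_, by simp⟩
    · refine fan 3 _ ![6, 3, 0, 2, 4] ![4, 1, 0, 0, 2] ![6, 4, 1, 2, 5] ![5, 1, 0, 2]
        (by decide) (by decide) (by decide) (by decide) ?_
      simp [Fin.sum_univ_succ]; linarith
    · refine fan 3 _ ![3, 0, 2, 4, 8] ![1, 0, 0, 2, 5] ![4, 1, 2, 5, 6] ![1, 0, 2, 7]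
        (by decide) (by decide) (by decide) (by decide) ?_
      simp [Fin.sum_univ_succ]; linarith
    · refine fan 3 _ ![2, 4, 8, 6, 3, 0] ![0, 2, 5, 4, 1, 0] ![2, 5, 6, 6, 4, 1] ![2, 7, 9, 5, 1]
        (by decide) (by decide) (by decide) (by decide) ?_
      simp [Fin.sum_univ_succ]; linarith
    · refine fan 3 _ ![0, 2, 4, 8, 6, 3] ![0, 0, 2, 5, 4, 1] ![1, 2, 5, 6, 6, 4] ![0, 2, 7, 9, 5]
        (by decide) (by decide) (by decide) (by decide) ?_
      simp [Fin.sum_univ_succ]; linarith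
    · refine fan 3 _ ![4, 8, 6, 3, 0, 2] ![2, 5, 4, 1, 0, 0] ![5, 6, 6, 4, 1, 2] ![7, 9, 5, 1, 0]
        (by decide) (by decide) (by decide) (by decide) ?_
      simp [Fin.sum_univ_succ]; linarith
    · refine fan 4 _ ![6, 3, 1, 5] ![3, 1, 1, 2] ![6, 3, 2, 5] ![5, 3, 4]
        (by decide) (by decide) (by decide) (by decide) ?_
      simp [Fin.sum_univ_succ]; linarith
    · refine fan 4 _ ![3, 1, 5, 7] ![1, 1, 2, 5] ![3, 2, 5, 6] ![3, 4, 8]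
        (by decide) (by decide) (by decide) (by decide) ?_
      simp [Fin.sum_univ_succ]; linarith
    · refine fan 4 _ ![1, 5, 7, 6, 3] ![1, 2, 5, 3, 1] ![2, 5, 6, 6, 3] ![4, 8, 10, 5]
        (by decide) (by decide) (by decide) (by decide) ?_
      simp [Fin.sum_univ_succ]; linarith
    · refine fan 4 _ ![5, 7, 6, 3, 1] ![2, 5, 3, 1, 1] ![5, 6, 6, 3, 2] ![8, 10, 5, 3]
        (by decide) (by decide) (by decide) (by decide) ?_
      simp [Fin.sum_univ_succ]; linarith
    · refine fan 5 _ ![5, 4, 8] ![2, 2, 3] ![4, 3, 6] ![6, 7]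
        (by decide) (by decide) (by decide) (by decide) ?_
      simp [Fin.sum_univ_succ]; linarith
    · refine fan 5 _ ![4, 5, 7] ![2, 2, 4] ![3, 4, 6] ![6, 8]
        (by decide) (by decide) (by decide) (by decide) ?_
      simp [Fin.sum_univ_succ]; linarith
    · refine fan 5 _ ![4, 8, 7, 5] ![2, 3, 4, 2] ![3, 6, 6, 4] ![7, 11, 8]
        (by decide) (by decide) (by decide) (by decide) ?_
      simp [Fin.sum_univ_succ]; linarith)
  obtain ⟨h1, h2, h3⟩ := hatSplits_spec _ hA
  refine ⟨A, h1, h2, fun i hi j hj hadj => ?_⟩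
  obtain ⟨-, he, hn⟩ := hadj
  change hatFace π i ∩ hatFace π j ∈ P.edges at he
  change hatFace π i ∩ hatFace π j ∉ U.cuts at hn
  have hcard : (hatFace π i ∩ hatFace π j).card = 2 := by
    obtain ⟨_, _, hx⟩ := Finset.mem_biUnion.1 he
    exact (Finset.mem_powersetCard.1 hx).2
  rw [hatFace_inter hinj] at hn hcard
  rw [Finset.card_image_of_injective _ hinj] at hcard
  obtain ⟨k, hk, hk'⟩ := h3 i hi j hj hcard
  exact hn (hk' ▸ hc k hk)

end TriSolid

/-! ### Counting the pieces. -/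

/-- A graph whose vertices are grouped into classes has at least as many components as there are
classes, minus the number of labels on edges between different classes. -/
theorem card_le_card_add_card_connectedComponent {V K E : Type*} [Finite V] [Finite K]
    (G : SimpleGraph V) (c : V → K) (hc : Function.Surjective c) (T : Finset E) (f : V → V → E)
    (hT : ∀ x y, G.Adj x y → c x ≠ c y → f x y ∈ T)
    (hf : ∀ x y x' y', G.Adj x y → G.Adj x' y' → f x y = f x' y' →
      (x = x' ∧ y = y') ∨ (x = y' ∧ y = x')) :
    Nat.card K ≤ T.card + Nat.card G.ConnectedComponent := by
  classical
  have := Fintype.ofFinite V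
  have := Fintype.ofFinite K
  have : Finite G.ConnectedComponent := Quot.finite _
  have := Fintype.ofFinite G.ConnectedComponent
  let pr (κ : K) : (K → ℚ) →ₗ[ℚ] ℚ := LinearMap.proj κ
  -- Each label imposes one linear condition on functions of the classes: equality across an edge
  -- with that label. By `hf` the edge is determined up to orientation, so the choice does not
  -- matter; a label without an edge imposes nothing.
  let L : (K → ℚ) →ₗ[ℚ] (T → ℚ) := LinearMap.pi fun e =>
    if h : ∃ p : V × V, G.Adj p.1 p.2 ∧ f p.1 p.2 = e then
      pr (c h.choose.1) - pr (c h.choose.2) else 0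
  let M : (K → ℚ) →ₗ[ℚ] (G.ConnectedComponent → ℚ) :=
    LinearMap.pi fun C => pr (c (Quot.out C))
  have hadj : ∀ φ ∈ LinearMap.ker L, ∀ x y, G.Adj x y → φ (c x) = φ (c y) := by
    intro φ hφ x y hxy
    by_cases hne : c x = c y
    · rw [hne]
    have h : ∃ p : V × V, G.Adj p.1 p.2 ∧ f p.1 p.2 = f x y := ⟨(x, y), hxy, rfl⟩
    have h0 : L φ ⟨f x y, hT x y hxy hne⟩ = 0 := by
      rw [LinearMap.mem_ker.1 hφ]; rfl
    have h1 : φ (c h.choose.1) - φ (c h.choose.2) = 0 := by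
      rw [← h0]; simp only [L, LinearMap.pi_apply, dif_pos h]; rfl
    rcases hf _ _ _ _ h.choose_spec.1 hxy h.choose_spec.2 with ⟨h2, h3⟩ | ⟨h2, h3⟩ <;>
      rw [h2, h3] at h1 <;> linarith
  have hreach : ∀ φ ∈ LinearMap.ker L, ∀ x y, G.Reachable x y → φ (c x) = φ (c y) := by
    rintro φ hφ x y ⟨w⟩
    induction w with
    | nil => rfl
    | cons h _ ih => exact (hadj φ hφ _ _ h).trans ih
  -- Functions in the kernel are constant on components, so one value per component determines them.
  -- Rank and nullity of `L` then give the count.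
  have hinj : Function.Injective (M.comp (LinearMap.ker L).subtype) := by
    rw [injective_iff_map_eq_zero]
    rintro ⟨φ, hφ⟩ h
    ext κ
    obtain ⟨x, rfl⟩ := hc κ
    have h1 : φ (c (Quot.out (G.connectedComponentMk x))) = 0 :=
      congrFun h (G.connectedComponentMk x)
    have h2 : G.Reachable (Quot.out (G.connectedComponentMk x)) x :=
      SimpleGraph.ConnectedComponent.exact (Quot.out_eq _)
    exact (hreach φ hφ _ _ h2).symm.trans h1
  have h1 := LinearMap.finrank_range_add_finrank_ker L
  have h2 := LinearMap.finrank_le_finrank_of_injective hinj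
  have h3 := Submodule.finrank_le (LinearMap.range L)
  rw [Module.finrank_fintype_fun_eq_card] at h1 h2 h3
  rw [Fintype.card_coe] at h3
  rw [Nat.card_eq_fintype_card, Nat.card_eq_fintype_card]
  omega

namespace TriSolid

/-- The cone coordinates of a point are unique, and their support is the face. -/
theorem IsConePoint.face_unique {Q : TriSolid} (hQ : Q.IsStar) {F G : Finset Space3}
    (hF : F ∈ Q.faces) (hG : G ∈ Q.faces) {d : Space3} {μ ν : Space3 → ℝ}
    (hμ : IsConePoint F d μ) (hν : IsConePoint G d ν) : F = G := by
  have h := hQ.unique F hF G hG μ ν hμ.isWeight hν.isWeight (hμ.sum_eq.trans hν.sum_eq.symm)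
  have key : ∀ {F : Finset Space3} {μ : Space3 → ℝ}, IsConePoint F d μ →
      ∀ v, v ∈ F ↔ 0 < μ v := fun hμ v =>
    ⟨hμ.pos v, fun h0 => by by_contra hv; exact h0.ne' (hμ.supp v hv)⟩
  ext v
  rw [key hμ, key hν, h]

/-- A common vertex of hats over different faces belongs to both faces. -/
theorem IsHat.mem_base {Q : TriSolid} (hQ : Q.IsStar) {F G : Finset Space3} (hF : F ∈ Q.faces)
    (hG : G ∈ Q.faces) (hne : F ≠ G) {π ρ : Fin 7 → Space3} (hπ : IsHat F π) (hρ : IsHat G ρ)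
    {i j : Fin 7} (h : π i = ρ j) : π i ∈ F := by
  have base : ∀ {F : Finset Space3} {π : Fin 7 → Space3} {i : Fin 7}, IsHat F π → ¬ 3 ≤ i →
      π i ∈ F := by
    intro F π i hπ hi
    rw [hπ.base]
    have : i = 0 ∨ i = 1 ∨ i = 2 := by revert hi; revert i; decide
    rcases this with rfl | rfl | rfl <;> simp
  by_contra hi
  have h3 : 3 ≤ i := by by_contra h3; exact hi (base hπ h3)
  obtain ⟨μ, hμ⟩ := hπ.cone i h3
  by_cases hj : 3 ≤ j
  · obtain ⟨ν, hν⟩ := hρ.cone j hj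
    exact hne (hμ.face_unique hQ hF hG (h ▸ hν))
  · exact hQ.notMem_of_isConePoint hF hμ hG (h ▸ base hρ hj)

/-- A new vertex of the common triangle would belong to `F` by `IsHat.mem_base`, although it lies in
the open cone over `F`. -/
theorem IsHat.face_unique {Q : TriSolid} (hQ : Q.IsStar) {F G : Finset Space3} (hF : F ∈ Q.faces)
    (hG : G ∈ Q.faces) {π ρ : Fin 7 → Space3} (hπ : IsHat F π) (hρ : IsHat G ρ)
    {i j : Fin 9} (h : hatFace π i = hatFace ρ j) : F = G := by
  classical
  by_contra hne
  obtain ⟨m, hm, hi⟩ := exists_new_mem_hatIndex i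
  obtain ⟨μ, hμ⟩ := hπ.cone m hm
  have h1 : π m ∈ hatFace ρ j := h ▸ Finset.mem_image_of_mem _ hi
  obtain ⟨m', -, h2⟩ := Finset.mem_image.1 h1
  exact hQ.notMem_of_isConePoint hF hμ hF (hπ.mem_base hQ hF hG hne hρ h2.symm)

open Classical in
/-- If each face of `Q` is replaced by a hat then each unfolding has at least twice as many pieces
as `Q` has faces, minus the number of edges of `Q`. -/
theorem two_mul_card_faces_le {Q P : TriSolid} (hQ : Q.IsStarStacked) (hP : P.IsStarStacked)
    {π : Finset Space3 → Fin 7 → Space3} (hπ : ∀ F ∈ Q.faces, IsHat F (π F))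
    (hfaces : ∀ h, h ∈ P.faces ↔ ∃ F ∈ Q.faces, ∃ i, h = hatFace (π F) i) (U : P.EdgeUnfolding) :
    Q.faces.card * 2 ≤ Q.edges.card + U.numPieces := by
  have hmem : ∀ F ∈ Q.faces, ∀ i, hatFace (π F) i ∈ P.faces := fun F hF i =>
    (hfaces _).2 ⟨F, hF, i, rfl⟩
  choose A hA1 hA2 hA3 using fun F : Q.faces =>
    exists_separated_hatFaces hP.star U (hπ F.1 F.2) (hmem F.1 F.2)
  choose hat hhat ind hind using fun x : {f : Finset Space3 // f ∈ P.faces} => (hfaces x.1).1 x.2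
  have hcard : Nat.card (Q.faces × Bool) = Q.faces.card * 2 := by simp
  have hinter : ∀ x y : {f : Finset Space3 // f ∈ P.faces}, (P.uncutGraph U.cuts).Adj x y →
      (x.1 ∩ y.1).card = 2 := by
    intro x y hxy
    obtain ⟨_, _, hx⟩ := Finset.mem_biUnion.1 hxy.2.1
    have := (Finset.mem_powersetCard.1 hx).2
    convert this
  rw [← hcard, EdgeUnfolding.numPieces]
  -- The class of a triangle records its hat and its side of the split of that hat; the label of an
  -- adjacency is the shared edge.
  refine card_le_card_add_card_connectedComponent (P.uncutGraph U.cuts)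
    (fun x => (⟨hat x, hhat x⟩, decide (ind x ∈ A ⟨hat x, hhat x⟩))) ?_ Q.edges
    (fun x y => x.1 ∩ y.1) ?_ ?_
  · rintro ⟨⟨F, hF⟩, b⟩
    have key : ∀ i, (⟨hat ⟨hatFace (π F) i, hmem F hF i⟩, hhat _⟩ : Q.faces) = ⟨F, hF⟩ ∧
        ind ⟨hatFace (π F) i, hmem F hF i⟩ = i := by
      intro i
      have h1 := hind ⟨hatFace (π F) i, hmem F hF i⟩
      have h2 := (hπ F hF).face_unique hQ.star hF (hhat _) (hπ _ (hhat _)) h1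
      refine ⟨Subtype.ext h2.symm, ?_⟩
      rw [← h2] at h1
      exact (hatFace_injective (hπ F hF).inj h1).symm
    have hi : ∃ i, decide (i ∈ A ⟨F, hF⟩) = b := by
      cases b
      · obtain ⟨i, hi⟩ := not_forall.1 (mt Finset.eq_univ_iff_forall.2 (hA2 ⟨F, hF⟩))
        exact ⟨i, by simpa using hi⟩
      · obtain ⟨i, hi⟩ := hA1 ⟨F, hF⟩
        exact ⟨i, by simpa using hi⟩
    obtain ⟨i, hi⟩ := hi
    refine ⟨⟨hatFace (π F) i, hmem F hF i⟩, Prod.ext (key i).1 ?_⟩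
    change decide _ = b
    rw [(key i).1, (key i).2, hi]
  · intro x y hxy hne
    -- Inside one hat the two sides are not attached, so adjacent triangles of different classes
    -- come from different hats. Their common vertices then lie in the base face, making the shared
    -- edge an edge of `Q`.
    have hsep : hat x ≠ hat y := by
      intro he
      have hx : x = ⟨hatFace (π (hat x)) (ind x), hmem _ (hhat x) _⟩ := Subtype.ext (hind x)
      have hy : y = ⟨hatFace (π (hat x)) (ind y), hmem _ (hhat x) _⟩ :=
        Subtype.ext ((hind y).trans (congrArg (fun F => hatFace (π F) (ind y)) he.symm))
      have he' : (⟨hat x, hhat x⟩ : Q.faces) = ⟨hat y, hhat y⟩ := Subtype.ext he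
      apply hne
      refine Prod.ext he' ?_
      change decide _ = decide _
      rw [← he', decide_eq_decide]
      by_contra hiff
      by_cases h1 : ind x ∈ A ⟨hat x, hhat x⟩
      · have h2 : ind y ∉ A ⟨hat x, hhat x⟩ := fun h2 => hiff ⟨fun _ => h2, fun _ => h1⟩
        have := hA3 ⟨hat x, hhat x⟩ _ h1 _ h2
        rw [hx, hy] at hxy
        exact this hxy
      · have h2 : ind y ∈ A ⟨hat x, hhat x⟩ := by
          by_contra h2
          exact hiff ⟨fun h => absurd h h1, fun h => absurd h h2⟩
        have := hA3 ⟨hat x, hhat x⟩ _ h2 _ h1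
        rw [hx, hy] at hxy
        exact this hxy.symm
    refine Finset.mem_biUnion.2 ⟨hat x, hhat x, Finset.mem_powersetCard.2 ⟨fun v hv => ?_, ?_⟩⟩
    · rw [Finset.mem_inter, hind x, hind y] at hv
      obtain ⟨m, -, rfl⟩ := Finset.mem_image.1 hv.1
      obtain ⟨m', -, hm'⟩ := Finset.mem_image.1 hv.2
      exact (hπ _ (hhat x)).mem_base hQ.star (hhat x) (hhat y) hsep (hπ _ (hhat y)) hm'.symm
    · convert hinter x y hxy
  · intro x y x' y' h h' he
    -- Since an edge lies on at most two faces, a shared edge determines the unordered pair of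
    -- triangles.
    have hle := hP.edge (x.1 ∩ y.1) (by convert hinter x y h)
    have ht : ∀ z : {f : Finset Space3 // f ∈ P.faces}, x.1 ∩ y.1 ⊆ z.1 → z = x ∨ z = y := by
      intro z hz
      by_contra! hzz
      have := hle {x.1, y.1, z.1} (by
        intro f hf
        simp only [Finset.mem_insert, Finset.mem_singleton] at hf
        rcases hf with rfl | rfl | rfl <;> exact Subtype.prop _) (by
        intro f hf
        simp only [Finset.mem_insert, Finset.mem_singleton] at hf
        rcases hf with rfl | rfl | rfl
        · exact Finset.inter_subset_left
        · exact Finset.inter_subset_right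
        · exact hz)
      rw [Finset.card_eq_three.2 ⟨x.1, y.1, z.1, fun h0 => h.1 (Subtype.ext h0),
        fun h0 => hzz.1 (Subtype.ext h0.symm), fun h0 => hzz.2 (Subtype.ext h0.symm), rfl⟩] at this
      omega
    have hx' := ht x' (he ▸ Finset.inter_subset_left)
    have hy' := ht y' (he ▸ Finset.inter_subset_right)
    rcases hx' with rfl | rfl <;> rcases hy' with rfl | rfl
    · exact absurd rfl h'.1
    · exact Or.inl ⟨rfl, rfl⟩
    · exact Or.inr ⟨rfl, rfl⟩
    · exact absurd rfl h'.1

end TriSolid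

theorem mainTheorem4 (k : ℕ) (ε : ℝ) (hε : 0 < ε) :
    ∃ Q P : TriSolid,
      TriSolid.Refinement ε k Q ∧ Q.IsStackedPolyhedron ∧
      Q.faces.card = 4 + 2 * k ∧ Q.vertices.card = 4 + k ∧
      TriSolid.AttachHats Q Q.faces P ∧
      P.IsStackedPolyhedron ∧ P.IsTopologicallyConvex ∧
      ∀ U : P.EdgeUnfolding, k + 2 ≤ U.numPieces := by
  obtain ⟨Q, hQ, hQs, hf, hv, he⟩ := TriSolid.exists_refinement k hε
  obtain ⟨P, π, hP, hPs, hfaces, hπ⟩ := TriSolid.exists_attachHats hQs Q.faces subset_rfl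
  refine ⟨Q, P, hQ, ⟨hQs.stacked, hQs.noFlat⟩, hf, hv, hP, ⟨hPs.stacked, hPs.noFlat⟩,
    hPs.stacked.isTopologicallyConvex, fun U => ?_⟩
  -- The bound reads `2 * (4 + 2 * k) ≤ (6 + 3 * k) + U.numPieces`.
  have := TriSolid.two_mul_card_faces_le hQs hPs hπ (fun h => (hfaces h).trans (by tauto)) U
  omega
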